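/- Let $K_v$ be a nonarchimedean local field of characteristic $p$ (for instance the completion at a place $v$ of the function field of a curve over a finite field of characteristic $p$), with absolute Galois group $G_v=\mathrm{Gal}(K_v^{\mathrm{sep}}/K_v)$, inertia group $I_v$ and wild inertia group $P_v$. Let $\mathbf F$ be a finite field of characteristic $\ell\neq p$ with ring of Witt vectors $W(\mathbf F)$, and let $\bar\rho_v:G_v\to\mathrm{GL}_n(\mathbf F)$ be a continuous representation. Let $\mathrm{ad}(\bar\rho)$ be $M_n(\mathbf F)$ with $G_v$ acting by conjugation through $\bar\rho_v$, let $\mathrm{ad}^0(\bar\rho)$ be its subrepresentation of trace zero matrices, and put $h^0(G_v,M)=\dim_{\mathbf F}H^0(G_v,M)$. Let $\eta_v:G_v\to W(\mathbf F)^*$ be the Teichmüller lift of $\det\bar\rho_v$. Let $\mathcal A$ be the category of complete noetherian local $W(\mathbf F)$-algebras $(R,\mathfrak m_R)$ with residue field $\mathbf F$, with local $W(\mathbf F)$-algebra homomorphisms inducing the identity on $\mathbf F$. A lift of $\bar\rho_v$ of determinant $\eta_v$ to $R\in\mathcal A$ is a continuous representation $\rho:G_v\to\mathrm{GL}_n(R)$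 with $\rho \bmod \mathfrak m_R=\bar\rho_v$ and $\det\rho=\eta_v$. Consider pairs $(\mathcal C_v,L_v)$, where $\mathcal C_v$ assigns to each $R\in\mathcal A$ a set $\mathcal C_v(R)$ of such lifts and $L_v$ is an $\mathbf F$-subspace of the continuous cohomology group $H^1(G_v,\mathrm{ad}^0(\bar\rho))$. The pair is called admissible and compatible with $\eta_v$ if: * (P1) $\bar\rho_v\in\mathcal C_v(\mathbf F)$. * (P2) $\mathcal C_v(R)$ is closed under conjugation by $1+M_n(\mathfrak m_R)$. * (P3) If $\rho\in\mathcal C_v(R)$ and $f:R\to S$ is a morphism in $\mathcal A$, then $f\circ\rho\in\mathcal C_v(S)$. * (P4) If $\rho_i\in\mathcal C_v(R_i)$ and $I_i\subsetneq R_i$ are ideals ($i=1,2$), and $\varphi:R_1/I_1\cong R_2/I_2$ is an isomorphism of $W(\mathbf F)$-algebras with $\varphi(\rho_1\bmod I_1)=\rho_2\bmod I_2$, then $(\rho_1,\rho_2)\in\mathcal C_v(R_3)$ for $R_3=\{(r_1,r_2)\in R_1\times R_2:\varphi(r_1\bmod I_1)=r_2\bmod I_2\}$. * (P5) If $\rho$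 is a lift to $R$ of determinant $\eta_v$ and $\rho\bmod\mathfrak m_R^k\in\mathcal C_v(R/\mathfrak m_R^k)$ for all $k\ge1$, then $\rho\in\mathcal C_v(R)$. * (P6) If $I\subsetneq R$ is an ideal with $\mathfrak m_RI=0$, every $\rho\in\mathcal C_v(R/I)$ is the reduction of some $\tilde\rho\in\mathcal C_v(R)$. * (P7) If $I\subset R$ is an ideal with $\mathfrak m_RI=0$, $\rho_1\in\mathcal C_v(R)$, and $\rho_2$ is a lift to $R$ of determinant $\eta_v$ with $\rho_1\equiv\rho_2\bmod I$, then $\rho_2\in\mathcal C_v(R)$ if and only if the class of $g\mapsto\rho_2(g)\rho_1(g)^{-1}-1$ in $H^1(G_v,\mathrm{ad}^0(\bar\rho))\otimes_{\mathbf F}I$ lies in $L_v\otimes_{\mathbf F}I$. For a representation $\rho$ of $G_v$ on $V=R^n$, $R\in\mathcal A$, the exponent of the conductor is $\mathrm{rank}_RV-\mathrm{rank}_RV^{I_v}+\mathrm{Sw}(V)$, where $\mathrm{Sw}(V)=\int_0^\infty(\mathrm{rank}_RV-\mathrm{rank}_RV^{G_v^w})\,dw$ is the Swan conductor, defined by the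 upper numbering filtration $(G_v^w)_w$; it is well defined if $V^{I_v}$ and all $V^{G_v^w}$, $w>0$, are free. **Proposition.** Suppose that $\bar\rho_v$ is at most tamely ramified, i.e. trivial on $P_v$, and that $h^0(G_v,\mathrm{ad}^0(\bar\rho))<h^0(G_v,\mathrm{ad}(\bar\rho))$. Then there exists an admissible pair $(\mathcal C_v,L_v)$ compatible with $\eta_v$ such that $L_v=H^1_{\mathrm{unr}}(G_v,\mathrm{ad}^0(\bar\rho))$, the image of $H^1(G_v/I_v,\mathrm{ad}^0(\bar\rho)^{I_v})$ under inflation, such that $L_v$ is finite dimensional with $\dim_{\mathbf F}L_v=h^0(G_v,\mathrm{ad}^0(\bar\rho))$, and such that for all $R\in\mathcal A$ and $\rho\in\mathcal C_v(R)$ the conductors of $\rho$ and of $\bar\rho_v$ are well defined and agree. -/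

import Mathlib

/-!
# Local deformation problems for Galois representations of local fields

Let `K` be a nonarchimedean local field of characteristic `p`, let `F` be a finite field of
characteristic `ℓ ≠ p`, and let `ρbar` be a continuous representation of the absolute Galois
group of `K` on `F ^ n`. We define: the inertia and wild inertia groups and the upper numbering
filtration; the (Artin) conductor; continuous `H¹` and its unramified part; the category of
complete noetherian local `W(F)`-algebras with residue field `F`; lifts of `ρbar` whose determinant
is the Teichmüller lift of `det ρbar`; and the conditions P1--P7 on a pair `(C, L)`.
-/

universe u v

noncomputable section

namespace LocalDeformation

open ValuativeRel IsLocalRing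

/-! ### Ramification groups -/

section Ramification

/-- The absolute Galois group `Gal(Kˢ/K)`; it carries the Krull topology. -/
abbrev AbsGal (K : Type v) [Field K] : Type v :=
  SeparableClosure K ≃ₐ[K] SeparableClosure K

variable (K : Type v) [Field K] [ValuativeRel K]

/-- The ring of integers of an algebraic extension `L` of the valued field `K`. -/
abbrev integersOf (L : Type v) [Field L] [Algebra K L] : Subalgebra 𝒪[K] L :=
  integralClosure 𝒪[K] L

/-- The maximal ideal of the ring of integers of `L`. For `K` a local field and `L / K` algebraic
this ring is local, so that its Jacobson radical is its unique maximal ideal. -/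
def maxIdealOf (L : Type v) [Field L] [Algebra K L] : Ideal (integersOf K L) :=
  (⊥ : Ideal (integersOf K L)).jacobson

/-- The ramification group `G_i` of `Gal(L/K)` in the lower numbering, `i ≥ 0`:
all `σ` with `σ x ≡ x` modulo `𝔪_L ^ (i + 1)` for every integer `x` of `L`. -/
def lowerRamification (L : Type v) [Field L] [Algebra K L] (i : ℕ) : Subgroup (L ≃ₐ[K] L) :=
  (maxIdealOf K L ^ (i + 1)).inertia (L ≃ₐ[K] L)

/-- The Herbrand function `φ_{L/K}(u) = ∫₀ᵘ dt / [G_0 : G_t]`, where `G_t = G_⌈t⌉`. -/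
def herbrand (L : Type v) [Field L] [Algebra K L] (u : ℝ) : ℝ :=
  ∫ t in (0 : ℝ)..u,
    (Nat.card (lowerRamification K L ⌈t⌉₊) : ℝ) / (Nat.card (lowerRamification K L 0) : ℝ)

/-- The ramification group of `Gal(L/K)` in the upper numbering: it is `G_u` for the
unique `u ≥ 0` such that `φ_{L/K}(u) = w`. Only `w ≥ 0` is meaningful. -/
def upperRamificationFinite (L : Type v) [Field L] [Algebra K L] (w : ℝ) :
    Subgroup (L ≃ₐ[K] L) :=
  ⨅ (u : ℝ) (_ : 0 ≤ u) (_ : herbrand K L u = w), lowerRamification K L ⌈u⌉₊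

/-- The inertia subgroup of the absolute Galois group:
the inverse limit of the inertia groups of the finite Galois extensions of `K`. -/
def inertia : Subgroup (AbsGal K) :=
  ⨅ L : FiniteGaloisIntermediateField K (SeparableClosure K),
    (lowerRamification K L 0).comap (AlgEquiv.restrictNormalHom L)

/-- The wild inertia subgroup of the absolute Galois group:
the inverse limit of the groups `G_1` of the finite Galois extensions of `K`. -/
def wildInertia : Subgroup (AbsGal K) :=
  ⨅ L : FiniteGaloisIntermediateField K (SeparableClosure K),
    (lowerRamification K L 1).comap (AlgEquiv.restrictNormalHom L)

/-- The upper numbering filtration (`w ≥ 0`) on the absolute Galois group. -/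
def upperRamification (w : ℝ) : Subgroup (AbsGal K) :=
  ⨅ L : FiniteGaloisIntermediateField K (SeparableClosure K),
    (upperRamificationFinite K L w).comap (AlgEquiv.restrictNormalHom L)

end Ramification

/-! ### Conductors -/

section Conductor

variable {G : Type v} [Group G] {n : ℕ} {R : Type u} [CommRing R]

/-- The vectors of `R ^ n` that are fixed by the subgroup `H`. -/
def fixedVectors (ρ : G →* GL (Fin n) R) (H : Subgroup G) : Submodule R (Fin n → R) where
  carrier := {x | ∀ σ ∈ H, (ρ σ).val.mulVec x = x}
  zero_mem' := fun σ _ => Matrix.mulVec_zero _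
  add_mem' := fun {x y} hx hy σ hσ => by rw [Matrix.mulVec_add, hx σ hσ, hy σ hσ]
  smul_mem' := fun c x hx σ hσ => by rw [Matrix.mulVec_smul, hx σ hσ]

/-- `rank V - rank V ^ H`, where `V = R ^ n`. -/
def fixedCorank (ρ : G →* GL (Fin n) R) (H : Subgroup G) : ℕ :=
  n - Module.finrank R (fixedVectors ρ H)

variable {K : Type v} [Field K] [ValuativeRel K]

/-- The Swan conductor, `∫_{w > 0} (rank V - rank V ^ (G ^ w)) dw`. -/
def swanConductor (ρ : AbsGal K →* GL (Fin n) R) : ENNReal :=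
  ∫⁻ w in Set.Ioi (0 : ℝ), (fixedCorank ρ (upperRamification K w) : ENNReal)

/-- The exponent of the (Artin) conductor, `rank V - rank V ^ I + Sw V`. -/
def conductor (ρ : AbsGal K →* GL (Fin n) R) : ENNReal :=
  (fixedCorank ρ (inertia K) : ENNReal) + swanConductor ρ

/-- The ranks which occur in the definition of the conductor make sense:
the modules of fixed vectors are free. -/
def ConductorWellDefined (ρ : AbsGal K →* GL (Fin n) R) : Prop :=
  Module.Free R (fixedVectors ρ (inertia K)) ∧
    ∀ w : ℝ, 0 < w → Module.Free R (fixedVectors ρ (upperRamification K w))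

end Conductor

/-! ### Continuous cohomology in degrees zero and one -/

section Cohomology

variable {F : Type u} [Field F] {G : Type v} [Group G] {V : Type u} [AddCommGroup V] [Module F V]

/-- `h⁰(G, V)`. -/
def h0 (τ : Representation F G V) : ℕ := Module.finrank F τ.invariants

variable [TopologicalSpace G]

/-- Continuous one-cocycles with values in the discrete module `V`. -/
def Z1 (τ : Representation F G V) : Submodule F (G → V) where
  carrier := {c | IsLocallyConstant c ∧ ∀ g h, c (g * h) = c g + τ g (c h)}
  zero_mem' := ⟨IsLocallyConstant.const 0, fun g h => by simp⟩
  add_mem' := fun {c d} hc hd => ⟨hc.1.add hd.1, fun g h => by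
    simp only [Pi.add_apply, hc.2 g h, hd.2 g h, map_add]; abel⟩
  smul_mem' := fun a c hc => ⟨hc.1.comp (fun x => a • x), fun g h => by
    simp only [Pi.smul_apply, hc.2 g h, smul_add, map_smul]⟩

/-- One-coboundaries. -/
def B1 (τ : Representation F G V) : Submodule F (Z1 τ) where
  carrier := {c | ∃ x : V, ∀ g, c.1 g = τ g x - x}
  zero_mem' := ⟨0, fun g => by simp⟩
  add_mem' := fun {c d} ⟨x, hx⟩ ⟨y, hy⟩ => ⟨x + y, fun g => by
    simp only [Submodule.coe_add, Pi.add_apply, hx g, hy g, map_add]; abel⟩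
  smul_mem' := fun a c ⟨x, hx⟩ => ⟨a • x, fun g => by
    simp only [Submodule.coe_smul, Pi.smul_apply, hx g, map_smul, smul_sub]⟩

/-- Continuous `H¹(G, V)` for a discrete module `V`. -/
abbrev H1 (τ : Representation F G V) : Type (max u v) := Z1 τ ⧸ B1 τ

/-- The cocycles that are inflated from a cocycle `G / I → V ^ I`. -/
def inflatedZ1 (τ : Representation F G V) (I : Subgroup G) : Submodule F (Z1 τ) where
  carrier := {c | ∀ g, ∀ σ ∈ I, c.1 (g * σ) = c.1 g ∧ τ σ (c.1 g) = c.1 g}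
  zero_mem' := fun g σ _ => by simp
  add_mem' := fun {c d} hc hd g σ hσ => by simp [hc g σ hσ, hd g σ hσ]
  smul_mem' := fun a c hc g σ hσ => by simp [hc g σ hσ]

/-- `H¹_unr(G, V) = H¹(G / I, V ^ I)`, as a subspace of `H¹(G, V)` through inflation. -/
def H1unr (τ : Representation F G V) (I : Subgroup G) : Submodule F (H1 τ) :=
  (inflatedZ1 τ I).map (B1 τ).mkQ

end Cohomology

/-! ### The adjoint representation -/

section Adjoint

variable {F : Type u} [Field F] {G : Type v} [Group G] {n : ℕ}

/-- `ad ρbar`: the matrices, with `G` acting by conjugation through `ρbar`. -/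
def adRep (ρbar : G →* GL (Fin n) F) : Representation F G (Matrix (Fin n) (Fin n) F) where
  toFun g :=
    { toFun := fun X => (ρbar g).val * X * (ρbar g)⁻¹.val
      map_add' := fun X Y => by rw [mul_add, add_mul]
      map_smul' := fun a X => by simp }
  map_one' := by ext1 X; simp
  map_mul' g h := by
    refine LinearMap.ext fun X => ?_
    simp only [map_mul, mul_inv_rev, Units.val_mul, LinearMap.coe_mk, AddHom.coe_mk,
      Module.End.mul_apply, mul_assoc]

/-- The space of matrices of trace zero. -/
abbrev TraceZero (F : Type u) [Field F] (n : ℕ) : Submodule F (Matrix (Fin n) (Fin n) F) :=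
  LinearMap.ker (Matrix.traceLinearMap (Fin n) F F)

theorem trace_adRep (ρbar : G →* GL (Fin n) F) (g : G) (X : Matrix (Fin n) (Fin n) F) :
    (adRep ρbar g X).trace = X.trace := by
  change ((ρbar g).val * X * (ρbar g)⁻¹.val).trace = X.trace
  rw [Matrix.trace_mul_comm, ← mul_assoc, ← Units.val_mul, inv_mul_cancel, Units.val_one, one_mul]

/-- `ad⁰ ρbar`: the subrepresentation of `ad ρbar` on the matrices of trace zero. -/
def ad0Rep (ρbar : G →* GL (Fin n) F) : Representation F G (TraceZero F n) where
  toFun g := (adRep ρbar g).restrict (p := TraceZero F n) (q := TraceZero F n) fun X hX => by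
    rw [LinearMap.mem_ker, Matrix.traceLinearMap_apply] at hX ⊢
    rw [trace_adRep, hX]
  map_one' := by ext1 X; exact Subtype.ext (by simp)
  map_mul' g h := by ext1 X; exact Subtype.ext (by simp)

end Adjoint

/-! ### Coefficient rings -/

section Coefficients

variable (ℓ : ℕ) [Fact ℓ.Prime] (F : Type u) [Field F]

/-- A complete noetherian local `W(F)`-algebra with residue field `F`. The residue map `residue`
is automatically surjective, so that its kernel is the maximal ideal. -/
structure CoeffRing where
  carrier : Type u
  [commRing : CommRing carrier]
  [algebra : Algebra (WittVector ℓ F) carrier]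
  [isLocalRing : IsLocalRing carrier]
  [isNoetherianRing : IsNoetherianRing carrier]
  [isAdicComplete : IsAdicComplete (maximalIdeal carrier) carrier]
  residue : carrier →+* F
  residue_algebraMap : ∀ w : WittVector ℓ F,
    residue (algebraMap (WittVector ℓ F) carrier w) = WittVector.constantCoeff w

namespace CoeffRing

instance : CoeSort (CoeffRing ℓ F) (Type u) := ⟨CoeffRing.carrier⟩

attribute [instance] CoeffRing.commRing CoeffRing.algebra CoeffRing.isLocalRing
  CoeffRing.isNoetherianRing CoeffRing.isAdicComplete

variable {ℓ F}

/-- The morphisms: local homomorphisms of `W(F)`-algebras that induce the identity on `F`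
(compatibility with the residue maps already forces locality). -/
structure Hom (R S : CoeffRing ℓ F) where
  toAlgHom : R →ₐ[WittVector ℓ F] S
  residue_comp : ∀ r : R, S.residue (toAlgHom r) = R.residue r

theorem residue_surjective (R : CoeffRing ℓ F) : Function.Surjective R.residue := fun a =>
  ⟨algebraMap (WittVector ℓ F) R (WittVector.teichmuller ℓ a), by
    rw [R.residue_algebraMap]; exact WittVector.teichmuller_coeff_zero ℓ a⟩

theorem ker_residue (R : CoeffRing ℓ F) : RingHom.ker R.residue = maximalIdeal R :=
  eq_maximalIdeal (RingHom.ker_isMaximal_of_surjective R.residue R.residue_surjective)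

variable (ℓ F) in
/-- The residue field `F` itself. -/
def residueField : CoeffRing ℓ F where
  carrier := F
  algebra := (WittVector.constantCoeff : WittVector ℓ F →+* F).toAlgebra
  isAdicComplete := by rw [maximalIdeal_eq_bot]; infer_instance
  residue := RingHom.id F
  residue_algebraMap _ := rfl

theorem isAdicComplete_quotient (R : CoeffRing ℓ F) (I : Ideal R) [IsLocalRing (R ⧸ I)] :
    IsAdicComplete (maximalIdeal (R ⧸ I)) (R ⧸ I) := by
  have hm : maximalIdeal (R ⧸ I) = (maximalIdeal R).map (algebraMap R (R ⧸ I)) := by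
    have hs : Function.Surjective (algebraMap R (R ⧸ I)) := Ideal.Quotient.mk_surjective
    have : IsLocalHom (algebraMap R (R ⧸ I)) := Function.Surjective.isLocalHom _ hs
    have hc : (maximalIdeal (R ⧸ I)).comap (algebraMap R (R ⧸ I)) = maximalIdeal R :=
      ((local_hom_TFAE (algebraMap R (R ⧸ I))).out 0 4 rfl rfl).mp this
    rw [← hc, Ideal.map_comap_of_surjective _ hs]
  rw [hm, IsAdicComplete.map_algebraMap_iff]
  have hp : IsPrecomplete (maximalIdeal R) (R ⧸ I) := by
    rw [← AdicCompletion.of_surjective_iff]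
    intro y
    obtain ⟨x, rfl⟩ := AdicCompletion.map_surjective (maximalIdeal R)
      (f := I.mkQ) (Submodule.mkQ_surjective I) y
    obtain ⟨r, rfl⟩ := AdicCompletion.of_surjective (maximalIdeal R) R x
    exact ⟨I.mkQ r, (AdicCompletion.map_of (maximalIdeal R) I.mkQ r).symm⟩
  exact { }

/-- The quotient of a coefficient ring by a proper ideal. -/
def quotient (R : CoeffRing ℓ F) (I : Ideal R) (hI : I ≠ ⊤) : CoeffRing ℓ F :=
  letI : Nontrivial (R ⧸ I) := Ideal.Quotient.nontrivial_iff.mpr hI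
  letI : IsLocalRing (R ⧸ I) :=
    IsLocalRing.of_surjective' (Ideal.Quotient.mk I) Ideal.Quotient.mk_surjective
  { carrier := R ⧸ I
    isAdicComplete := R.isAdicComplete_quotient I
    residue := Ideal.Quotient.lift I R.residue fun a ha => by
      have h : a ∈ maximalIdeal R := le_maximalIdeal hI ha
      rw [← ker_residue] at h
      exact h
    residue_algebraMap := fun w => R.residue_algebraMap w }

theorem maximalIdeal_pow_ne_top (R : CoeffRing ℓ F) (k : ℕ) :
    maximalIdeal R ^ (k + 1) ≠ ⊤ := fun h =>
  (maximalIdeal.isMaximal R).ne_top (top_le_iff.mp (h ▸ Ideal.pow_le_self (Nat.succ_ne_zero k)))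

end CoeffRing

end Coefficients

/-! ### Lifts and the conditions P1--P7 -/

section Lifts

variable {ℓ : ℕ} [Fact ℓ.Prime] {F : Type u} [Field F]
  {G : Type v} [Group G] [TopologicalSpace G] {n : ℕ}

/-- Continuity of a representation over a local ring, for the topology given by the powers
of the maximal ideal (the discrete topology if the ring is a field). -/
def IsContinuousRep {R : Type u} [CommRing R] [IsLocalRing R] (ρ : G →* GL (Fin n) R) : Prop :=
  letI : TopologicalSpace R := (maximalIdeal R).adicTopology
  Continuous ρ

/-- The Teichmüller lift of the determinant of `ρbar`. -/
def teichmullerDet (ℓ : ℕ) [Fact ℓ.Prime] (ρbar : G →* GL (Fin n) F) :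
    G →* (WittVector ℓ F)ˣ :=
  (Units.map (WittVector.teichmuller ℓ : F →* WittVector ℓ F)).comp
    (Matrix.GeneralLinearGroup.det.comp ρbar)

/-- Push a representation forward along a ring homomorphism. -/
abbrev pushRep {R S : Type u} [CommRing R] [CommRing S] (f : R →+* S) (ρ : G →* GL (Fin n) R) :
    G →* GL (Fin n) S :=
  (Matrix.GeneralLinearGroup.map f).comp ρ

/-- `ρ` is a lift of `ρbar` to `R` of determinant `η`. -/
structure IsLift (ρbar : G →* GL (Fin n) F) (η : G →* (WittVector ℓ F)ˣ)
    (R : CoeffRing ℓ F) (ρ : G →* GL (Fin n) R) : Prop where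
  continuous : IsContinuousRep ρ
  reduction : pushRep R.residue ρ = ρbar
  det_eq : ∀ g, Matrix.GeneralLinearGroup.det (ρ g) =
    Units.map (algebraMap (WittVector ℓ F) R).toMonoidHom (η g)

/-- For an ideal `I` with `𝔪 I = 0` and lifts `ρ₁`, `ρ₂` of determinant `η` with `ρ₁ ≡ ρ₂` modulo
`I`, the cocycle `g ↦ ρ₂(g) ρ₁(g)⁻¹ - 1` has values in `ad⁰ ρbar ⊗_F I`, where `I` is a vector space
over `F = R / 𝔪` through any set-theoretic section of the residue map; we use the Teichmüller
section. This says that its class in `H¹(G, ad⁰ ρbar) ⊗_F I` lies in `L ⊗_F I`: it is a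
finite sum `∑ c_j ⊗ x_j` with `x_j ∈ I` and `c_j` a cocycle whose class is in `L`
(coboundaries are among the `c_j`, as `0 ∈ L`). -/
def DifferenceMem (ρbar : G →* GL (Fin n) F) (L : Submodule F (H1 (ad0Rep ρbar)))
    {R : CoeffRing ℓ F} (I : Ideal R) (ρ₁ ρ₂ : G →* GL (Fin n) R) : Prop :=
  ∃ (m : ℕ) (c : Fin m → Z1 (ad0Rep ρbar)) (x : Fin m → R),
    (∀ j, x j ∈ I) ∧ (∀ j, (B1 (ad0Rep ρbar)).mkQ (c j) ∈ L) ∧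
    ∀ (g : G) (a b : Fin n),
      ((ρ₂ g).val * (ρ₁ g)⁻¹.val - 1) a b =
        ∑ j, algebraMap (WittVector ℓ F) R
          (WittVector.teichmuller ℓ (((c j).1 g).1 a b)) * x j

/-- `(C, L)` is an admissible pair compatible with `η`: `C` is a collection of lifts of `ρbar`
of determinant `η`, `L` is a subspace of `H¹(G, ad⁰ ρbar)`, and P1--P7 hold. -/
structure IsAdmissible (ρbar : G →* GL (Fin n) F) (η : G →* (WittVector ℓ F)ˣ)
    (C : (R : CoeffRing ℓ F) → Set (G →* GL (Fin n) R))
    (L : Submodule F (H1 (ad0Rep ρbar))) : Prop where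
  isLift : ∀ (R : CoeffRing ℓ F), ∀ ρ ∈ C R, IsLift ρbar η R ρ
  /-- `ρbar` itself belongs to `C`. -/
  P1 : ρbar ∈ C (CoeffRing.residueField ℓ F)
  /-- `C` is closed under conjugation by `1 + M_n(𝔪_R)`. -/
  P2 : ∀ (R : CoeffRing ℓ F), ∀ ρ ∈ C R, ∀ M : GL (Fin n) R,
    Matrix.GeneralLinearGroup.map R.residue M = 1 →
      (MulAut.conj M).toMonoidHom.comp ρ ∈ C R
  /-- `C` is closed under morphisms of coefficient rings. -/
  P3 : ∀ (R S : CoeffRing ℓ F) (f : R.Hom S), ∀ ρ ∈ C R, pushRep (f.toAlgHom : R →+* S) ρ ∈ C S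
  /-- Gluing: if `ρ₁ mod I₁` and `ρ₂ mod I₂` agree under an isomorphism `R₁ / I₁ ≅ R₂ / I₂`, then
  the representation `(ρ₁, ρ₂)` over the fibre product `R₃` belongs to `C`. -/
  P4 : ∀ (R₁ R₂ R₃ : CoeffRing ℓ F) (I₁ : Ideal R₁) (I₂ : Ideal R₂)
    (φ : (R₁ ⧸ I₁) ≃ₐ[WittVector ℓ F] (R₂ ⧸ I₂)) (π₁ : R₃.Hom R₁) (π₂ : R₃.Hom R₂),
    I₁ ≠ ⊤ → I₂ ≠ ⊤ →
    Function.Injective (fun r => (π₁.toAlgHom r, π₂.toAlgHom r)) →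
    Set.range (fun r => (π₁.toAlgHom r, π₂.toAlgHom r)) =
      {q : R₁ × R₂ | φ (Ideal.Quotient.mk I₁ q.1) = Ideal.Quotient.mk I₂ q.2} →
    ∀ ρ₁ ∈ C R₁, ∀ ρ₂ ∈ C R₂,
      pushRep (φ : (R₁ ⧸ I₁) →+* (R₂ ⧸ I₂)) (pushRep (Ideal.Quotient.mk I₁) ρ₁) =
        pushRep (Ideal.Quotient.mk I₂) ρ₂ →
      ∀ ρ₃ : G →* GL (Fin n) R₃,
        pushRep (π₁.toAlgHom : R₃ →+* R₁) ρ₃ = ρ₁ →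
        pushRep (π₂.toAlgHom : R₃ →+* R₂) ρ₃ = ρ₂ → ρ₃ ∈ C R₃
  /-- `C` is closed under limits: it suffices that all reductions modulo powers of `𝔪_R` belong
  to `C`. -/
  P5 : ∀ (R : CoeffRing ℓ F) (ρ : G →* GL (Fin n) R), IsLift ρbar η R ρ →
    (∀ k : ℕ, pushRep (Ideal.Quotient.mk (maximalIdeal R ^ (k + 1))) ρ ∈
      C (R.quotient (maximalIdeal R ^ (k + 1)) (R.maximalIdeal_pow_ne_top k))) →
    ρ ∈ C R
  /-- Smoothness: if `𝔪_R I = 0`, then every element of `C (R / I)` lifts to `C R`. -/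
  P6 : ∀ (R : CoeffRing ℓ F) (I : Ideal R) (hI : I ≠ ⊤), maximalIdeal R * I = ⊥ →
    ∀ ρ ∈ C (R.quotient I hI), ∃ ρ' ∈ C R, pushRep (Ideal.Quotient.mk I) ρ' = ρ
  /-- Tangent space: if `𝔪_R I = 0` and `ρ₁ ∈ C R`, `ρ₂` are lifts that agree modulo `I`,
  then `ρ₂ ∈ C R` if and only if `[ρ₂ - ρ₁] ∈ L ⊗ I`. -/
  P7 : ∀ (R : CoeffRing ℓ F) (I : Ideal R), maximalIdeal R * I = ⊥ →
    ∀ ρ₁ ∈ C R, ∀ ρ₂ : G →* GL (Fin n) R, IsLift ρbar η R ρ₂ →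
      pushRep (Ideal.Quotient.mk I) ρ₁ = pushRep (Ideal.Quotient.mk I) ρ₂ →
      (DifferenceMem ρbar L I ρ₁ ρ₂ ↔ ρ₂ ∈ C R)

end Lifts

end LocalDeformation

end

/-! ### Rings of integers of algebraic extensions, and the group `G_1`. -/

open ValuativeRel IsLocalRing

namespace LocalDeformation

/-! Since `ρbar` kills the wild inertia group `P`, and `P` is pro-`p` while matrices congruent to
`1` form a pro-`ℓ` group, every lift kills `P` too. Modulo `P` the Galois group is generated
topologically by a Frobenius element `s` and a generator `t` of tame inertia, with the single
relation `s t s⁻¹ = t ^ q` (`exists_tameGenerators`). Continuous lifts are therefore pairs of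
matrices that satisfy this relation (`TameGenerators.exists_representation`), together with a
determinant condition. The tame structure is derived by hand: in characteristic `p` the elements
with `ξ ^ p ^ N = ξ` represent the residue field of the separable closure, inertia is their
stabilizer, and Kummer theory of `e`-th roots of a uniformizer, `p ∤ e`, produces `t`.

The key choice is a matrix `T` over `W(F)` lifting `ρbar t` (`exists_matrix_lift`). As an
`F[X]`-module, `F ^ n` is a sum of modules `F[X] / p_i ^ e_i`. Each `p_i` is lifted to the
polynomial `f_i` whose roots are the Teichmüller lifts of its roots, and `T` is multiplication by
`X` on the sum of the `W(F)[X] / f_i ^ e_i`. Then the solutions of the linear equations `Y T = T Y`,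
`Y T = T ^ q Y` and `T x = x` lift along all surjections of coefficient rings; this is encoded by a
generalized inverse `A B A = A` of the coefficient matrix.

Let `C R` be the lifts of the right determinant for which `ρ t` is conjugate to `T` by a matrix
congruent to `1` (`minimalLifts`). Lifting elements of the centralizer of `T` gives gluing and half
of the tangent space condition. Lifting solutions of `Y T = T ^ q Y` gives smoothness, up to the
determinant of Frobenius, which is corrected inside the centralizer of `T`. The correction needs a
matrix of trace one commuting with `ρbar t`, and this is what the inequality of the `h⁰` provides.
Closure under limits is Krull's intersection theorem.

The tangent space consists of the classes that become trivial at `t`, that is, of the unramified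
ones. Its dimension and `h⁰` are those of the cokernel and the kernel of `s - 1` on the inertia
invariants. Finally all lifts are trivial on `P`, so the Swan conductor vanishes, and the inertia
invariants are isomorphic to the kernel of `T - 1`, which is free of a rank independent of `R`. -/

/-- A power of any element of a finite monoid is idempotent. -/
theorem exists_pow_idempotent {M : Type*} [Monoid M] [Finite M] (x : M) :
    ∃ N, 0 < N ∧ IsIdempotentElem (x ^ N) := by
  obtain ⟨a, b, hab, h⟩ := Finite.exists_ne_map_eq_of_infinite fun i : ℕ => x ^ i
  wlog hlt : a < b generalizing a b
  · exact this b a hab.symm h.symm (by omega)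
  obtain ⟨d, hd, rfl⟩ : ∃ d, 0 < d ∧ b = a + d := ⟨b - a, by omega, by omega⟩
  have key : ∀ k, x ^ (a + k * d) = x ^ a := by
    intro k
    induction k with
    | zero => simp
    | succ k ih =>
      rw [show a + (k + 1) * d = (a + k * d) + d by ring, pow_add, ih, ← pow_add]
      exact h.symm
  have key2 : ∀ c, a ≤ c → ∀ k, x ^ (c + k * d) = x ^ c := by
    intro c hc k
    obtain ⟨e, rfl⟩ := Nat.exists_eq_add_of_le hc
    rw [show a + e + k * d = (a + k * d) + e by ring, pow_add, key, ← pow_add]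
  -- From the exponent `a` on the powers are periodic with period `d`, so any positive multiple of
  -- `d` that is at least `a` works.
  refine ⟨(a + 1) * d, by positivity, ?_⟩
  have : a ≤ (a + 1) * d := by nlinarith
  rw [IsIdempotentElem, ← pow_add]
  exact key2 _ this (a + 1)

/-- A domain which is finite over a complete noetherian local ring with finite residue field
is local: idempotents lift by Hensel's lemma. -/
theorem isUnit_or_isUnit_one_sub_of_finite {A B : Type*} [CommRing A] [IsLocalRing A]
    [IsNoetherianRing A] [IsAdicComplete (maximalIdeal A) A] [Finite (ResidueField A)]
    [CommRing B] [IsDomain B] [Algebra A B] [Module.Finite A B] (x : B) :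
    IsUnit x ∨ IsUnit (1 - x) := by
  set I : Ideal B := (maximalIdeal A).map (algebraMap A B) with hI
  have hc : IsAdicComplete (maximalIdeal A) B := by
    have hp : IsPrecomplete (maximalIdeal A) B := by
      rw [← AdicCompletion.of_surjective_iff]
      intro y
      obtain ⟨t, rfl⟩ := AdicCompletion.ofTensorProduct_surjective_of_finite (maximalIdeal A) B y
      induction t with
      | zero => exact ⟨0, by simp⟩
      | tmul r x =>
        obtain ⟨r, rfl⟩ := AdicCompletion.of_surjective (maximalIdeal A) A r
        refine ⟨r • x, ?_⟩
        rw [AdicCompletion.ofTensorProduct_tmul]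
        rfl
      | add s t hs ht =>
        obtain ⟨a, ha⟩ := hs
        obtain ⟨b, hb⟩ := ht
        exact ⟨a + b, by rw [map_add, map_add, ha, hb]⟩
    have hh : IsHausdorff (maximalIdeal A) B := inferInstance
    exact { }
  have hcB : IsAdicComplete I B := by
    rw [hI, IsAdicComplete.map_algebraMap_iff]; exact hc
  have hJ : I ≤ (⊥ : Ideal B).jacobson := IsAdicComplete.le_jacobson_bot I
  have hfin : Finite (B ⧸ I) := by
    let _ : Algebra (A ⧸ maximalIdeal A) (B ⧸ I) :=
      Ideal.Quotient.algebraQuotientOfLEComap Ideal.le_comap_map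
    have : IsScalarTower A (A ⧸ maximalIdeal A) (B ⧸ I) := IsScalarTower.of_algebraMap_eq' rfl
    have : Module.Finite (A ⧸ maximalIdeal A) (B ⧸ I) :=
      Module.Finite.of_restrictScalars_finite A _ _
    have : Finite (A ⧸ maximalIdeal A) := inferInstanceAs (Finite (ResidueField A))
    exact Module.finite_of_finite (A ⧸ maximalIdeal A)
  -- A power of `x` is idempotent in the finite ring `B / I`. Its Hensel lift `E` is `0` or `1`
  -- because `B` is a domain, so `x ^ N` or `1 - x ^ N` lies in `I`, which is contained in the
  -- Jacobson radical.
  obtain ⟨N, hN, hid⟩ := exists_pow_idempotent (Ideal.Quotient.mk I x)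
  have hu : ∀ y ∈ I, IsUnit (1 - y) := fun y hy => by
    have := Ideal.mem_jacobson_bot.mp (hJ hy) (-1)
    simpa [sub_eq_neg_add] using this
  have hens : HenselianRing B I := inferInstance
  have hx2 : x ^ N * x ^ N - x ^ N ∈ I := by
    rw [← Ideal.Quotient.eq]; simpa [IsIdempotentElem] using hid
  obtain ⟨E, hE, hEx⟩ := hens.is_henselian (Polynomial.X ^ 2 - Polynomial.X)
    (by monicity!) (x ^ N)
    (by simpa [pow_two] using hx2)
    (by
      -- The derivative of `X ^ 2 - X` at an idempotent is its own inverse.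
      have h4 : (2 * x ^ N - 1) * (2 * x ^ N - 1) - 1 ∈ I := by
        have : (2 * x ^ N - 1) * (2 * x ^ N - 1) - 1 = 4 * (x ^ N * x ^ N - x ^ N) := by ring
        rw [this]; exact I.mul_mem_left _ hx2
      have h5 : (Ideal.Quotient.mk I (2 * x ^ N - 1)) * (Ideal.Quotient.mk I (2 * x ^ N - 1)) = 1 := by
        rw [← map_mul, ← map_one (Ideal.Quotient.mk I), Ideal.Quotient.eq]; exact h4
      simpa [one_add_one_eq_two, map_ofNat] using IsUnit.of_mul_eq_one _ h5)
  have hE' : E * (E - 1) = 0 := by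
    have : E ^ 2 - E = 0 := by simpa [Polynomial.IsRoot] using hE
    linear_combination this
  rcases mul_eq_zero.mp hE' with h | h
  · right
    have h1 : x ^ N ∈ I := by
      have := I.neg_mem hEx
      simpa [h] using this
    have h2 := hu _ h1
    exact isUnit_of_dvd_unit (by simpa using sub_dvd_pow_sub_pow (1 : B) x N) h2
  · left
    have h1 : 1 - x ^ N ∈ I := by
      rw [sub_eq_zero.mp h] at hEx; exact hEx
    have h2 := hu _ h1
    rw [sub_sub_cancel] at h2
    exact (isUnit_pow_iff hN.ne').mp h2

section Integers

variable (K : Type v) [Field K] [ValuativeRel K] [TopologicalSpace K]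
    [IsNonarchimedeanLocalField K] (L : Type v) [Field L] [Algebra K L]

/-- `L` may be infinite over `K`, since the question concerns only the ring generated by `x`, which
is finite over `𝒪[K]`. The ring of integers of the separable closure is thus local as well. -/
theorem isUnit_or_isUnit_one_sub_integersOf (x : integersOf K L) :
    IsUnit x ∨ IsUnit (1 - x) := by
  let := IsTopologicalAddGroup.rightUniformSpace K
  have := isUniformAddGroup_of_addCommGroup (G := K)
  set B := Algebra.adjoin 𝒪[K] {x} with hB
  have : Module.Finite 𝒪[K] B := by
    have hx : IsIntegral 𝒪[K] x := integralClosure.isIntegral x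
    exact Algebra.finite_adjoin_simple_of_isIntegral hx
  have hx : x ∈ B := Algebra.self_mem_adjoin_singleton _ _
  have : Finite (ResidueField 𝒪[K]) := inferInstanceAs (Finite 𝓀[K])
  have : IsAdicComplete (maximalIdeal 𝒪[K]) 𝒪[K] := inferInstanceAs (IsAdicComplete 𝓂[K] 𝒪[K])
  rcases isUnit_or_isUnit_one_sub_of_finite (A := 𝒪[K]) (⟨x, hx⟩ : B) with h | h
  · exact Or.inl (h.map B.val)
  · exact Or.inr (h.map B.val)

instance isLocalRing_integersOf : IsLocalRing (integersOf K L) :=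
  IsLocalRing.of_isUnit_or_isUnit_one_sub_self (isUnit_or_isUnit_one_sub_integersOf K L)

theorem maxIdealOf_eq : maxIdealOf K L = maximalIdeal (integersOf K L) :=
  IsLocalRing.jacobson_eq_maximalIdeal ⊥ bot_ne_top

theorem smul_mem_maximalIdeal (σ : L ≃ₐ[K] L) {x : integersOf K L}
    (hx : x ∈ maximalIdeal (integersOf K L)) : σ • x ∈ maximalIdeal (integersOf K L) := by
  rw [mem_maximalIdeal, mem_nonunits_iff] at hx ⊢
  intro h
  apply hx
  have := h.map (MulSemiringAction.toRingHom _ (integersOf K L) σ⁻¹)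
  simpa using this

theorem smul_mem_maximalIdeal_pow (σ : L ≃ₐ[K] L) (i : ℕ) {x : integersOf K L}
    (hx : x ∈ maximalIdeal (integersOf K L) ^ i) : σ • x ∈ maximalIdeal (integersOf K L) ^ i := by
  have h : maximalIdeal (integersOf K L) ≤ (maximalIdeal (integersOf K L)).comap
      (MulSemiringAction.toRingHom _ (integersOf K L) σ) :=
    fun y hy => smul_mem_maximalIdeal K L σ hy
  have h2 := (Ideal.pow_right_mono h i).trans (Ideal.le_comap_pow _ _)
  exact h2 hx

theorem mem_lowerRamification {i : ℕ} {σ : L ≃ₐ[K] L} :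
    σ ∈ lowerRamification K L i ↔
      ∀ x : integersOf K L, σ • x - x ∈ maximalIdeal (integersOf K L) ^ (i + 1) := by
  rw [lowerRamification, maxIdealOf_eq]; rfl

theorem lowerRamification_anti {i j : ℕ} (h : i ≤ j) :
    lowerRamification K L j ≤ lowerRamification K L i := fun σ hσ => by
  rw [mem_lowerRamification] at hσ ⊢
  exact fun x => Ideal.pow_le_pow_right (by omega) (hσ x)

variable [FiniteDimensional K L] [Algebra.IsSeparable K L]

instance isDedekindDomain_integersOf : IsDedekindDomain (integersOf K L) :=
  integralClosure.isDedekindDomain 𝒪[K] K L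

instance finite_integersOf : Module.Finite 𝒪[K] (integersOf K L) :=
  IsIntegralClosure.finite 𝒪[K] K L _

instance isFractionRing_integersOf : IsFractionRing (integersOf K L) L :=
  integralClosure.isFractionRing_of_finite_extension K L

theorem iInf_maximalIdeal_pow_integersOf :
    ⨅ i, maximalIdeal (integersOf K L) ^ i = ⊥ :=
  Ideal.iInf_pow_eq_bot_of_isDomain _ (maximalIdeal.isMaximal _).ne_top

variable (p : ℕ) [Fact p.Prime] [CharP K p]

/-- An element of `G_1` has `p`-power order. -/
theorem exists_pow_eq_one_of_mem_lowerRamification_one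
    {σ : L ≃ₐ[K] L} (hσ : σ ∈ lowerRamification K L 1) : ∃ a, σ ^ p ^ a = 1 := by
  have : CharP (integersOf K L) p := by
    have : CharP L p := charP_of_injective_algebraMap (algebraMap K L).injective p
    exact (RingHom.charP_iff (algebraMap (integersOf K L) L) Subtype.val_injective p).mpr this
  set m := maximalIdeal (integersOf K L)
  -- Elements of `G_1` act trivially on every graded piece `m ^ (i + 1) / m ^ (i + 2)`: write `y` as
  -- a sum of products and use the Leibniz rule.
  have aux : ∀ (τ : L ≃ₐ[K] L), τ ∈ lowerRamification K L 1 → ∀ (i : ℕ) (y : integersOf K L),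
      y ∈ m ^ (i + 1) → τ • y - y ∈ m ^ (i + 2) := by
    intro τ hτ i
    rw [mem_lowerRamification] at hτ
    induction i with
    | zero => intro y _; simpa using hτ y
    | succ i ih =>
      intro y hy
      rw [pow_succ] at hy
      refine Submodule.mul_induction_on hy ?_ ?_
      · intro a ha b hb
        have e : τ • (a * b) - a * b = (τ • a - a) * (τ • b) + a * (τ • b - b) := by
          rw [smul_mul']; ring
        rw [e]
        refine add_mem ?_ ?_
        · rw [pow_succ]
          exact Ideal.mul_mem_mul (ih a ha) (smul_mem_maximalIdeal K L τ hb)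
        · rw [show i + 1 + 2 = (i + 1) + 2 by ring, pow_add]
          exact Ideal.mul_mem_mul ha (hτ b)
      · intro a b ha hb
        rw [smul_add, add_sub_add_comm]; exact add_mem ha hb
  obtain ⟨a, r, hr, hord⟩ := Nat.exists_eq_pow_mul_and_not_dvd (orderOf_pos σ).ne' p
    (Fact.out : p.Prime).ne_one
  refine ⟨a, ?_⟩
  -- The order of `σ` is `p ^ a * r` with `p ∤ r`. It has to be shown that `τ`, which is killed by
  -- `r`, is trivial.
  set τ := σ ^ p ^ a with hτd
  have hτ : τ ∈ lowerRamification K L 1 := Subgroup.pow_mem _ hσ _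
  have hτr : τ ^ r = 1 := by rw [hτd, ← pow_mul, ← hord, pow_orderOf_eq_one]
  have hru : IsUnit (r : integersOf K L) := by
    have hc : Nat.Coprime r p := ((Nat.Prime.coprime_iff_not_dvd Fact.out).mpr hr).symm
    obtain ⟨x, hx⟩ := (ZMod.isUnit_iff_coprime r p).mpr hc
    have := (Units.isUnit x).map (ZMod.castHom dvd_rfl (integersOf K L))
    rw [hx] at this
    simpa using this
  -- If all displacements `τ x - x` lie in `m ^ (i + 1)`, then `τ ^ k x - x ≡ k (τ x - x)` modulo `m
  -- ^ (i + 2)`. For `k = r` the left side is zero and `r` is a unit, so the displacements lie one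
  -- step deeper.
  have key : ∀ (i : ℕ) (x : integersOf K L), τ • x - x ∈ m ^ (i + 1) := by
    intro i
    induction i with
    | zero =>
      intro x
      exact Ideal.pow_le_pow_right (by omega) ((mem_lowerRamification K L).mp hτ x)
    | succ i ih =>
      intro x
      have hstep : ∀ k : ℕ, τ ^ k • x - x - (k : integersOf K L) * (τ • x - x) ∈ m ^ (i + 2) := by
        intro k
        induction k with
        | zero => simp
        | succ k ihk =>
          have h1 := smul_mem_maximalIdeal_pow K L τ (i + 2) ihk
          have h2 := aux τ hτ i _ (ih x)
          have e : τ ^ (k + 1) • x - x - ((k + 1 : ℕ) : integersOf K L) * (τ • x - x) =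
              τ • (τ ^ k • x - x - (k : integersOf K L) * (τ • x - x)) +
              (k : integersOf K L) * (τ • (τ • x - x) - (τ • x - x)) := by
            have hk : τ • (k : integersOf K L) = k := by
              exact map_natCast (MulSemiringAction.toRingHom _ (integersOf K L) τ) k
            rw [smul_sub, smul_mul', hk, smul_sub, pow_succ', mul_smul]
            push_cast; ring
          rw [e]
          exact add_mem h1 (Ideal.mul_mem_left _ _ h2)
      have := hstep r
      rw [hτr, one_smul, sub_self, zero_sub, neg_mem_iff] at this
      exact (Ideal.unit_mul_mem_iff_mem _ hru).mp this
  have hfix : ∀ x : integersOf K L, τ • x = x := by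
    intro x
    rw [← sub_eq_zero]
    have : τ • x - x ∈ ⨅ i, m ^ i := by
      rw [Submodule.mem_iInf]
      intro i
      exact Ideal.pow_le_pow_right (by omega) (key i x)
    rwa [iInf_maximalIdeal_pow_integersOf, Ideal.mem_bot] at this
  ext y
  obtain ⟨x, z, hz, rfl⟩ := IsFractionRing.div_surjective (A := integersOf K L) y
  have h1 : τ (algebraMap (integersOf K L) L x) = algebraMap (integersOf K L) L x :=
    congrArg Subtype.val (hfix x)
  have h2 : τ (algebraMap (integersOf K L) L z) = algebraMap (integersOf K L) L z :=
    congrArg Subtype.val (hfix z)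
  rw [map_div₀, h1, h2]; rfl

end Integers

end LocalDeformation

/-! ### The tame quotient `G_0 / G_1` of a finite extension. -/

open ValuativeRel IsLocalRing

namespace LocalDeformation

theorem finite_quotient_of_finite {A B : Type*} [CommRing A] [IsLocalRing A]
    [Finite (ResidueField A)] [CommRing B] [Algebra A B] [Module.Finite A B] (m : Ideal B)
    (h : maximalIdeal A ≤ m.comap (algebraMap A B)) : Finite (B ⧸ m) := by
  let _ : Algebra (A ⧸ maximalIdeal A) (B ⧸ m) := Ideal.Quotient.algebraQuotientOfLEComap h
  have : IsScalarTower A (A ⧸ maximalIdeal A) (B ⧸ m) := IsScalarTower.of_algebraMap_eq' rfl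
  have : Module.Finite (A ⧸ maximalIdeal A) (B ⧸ m) :=
    Module.Finite.of_restrictScalars_finite A _ _
  have : Finite (A ⧸ maximalIdeal A) := inferInstanceAs (Finite (ResidueField A))
  exact Module.finite_of_finite (A ⧸ maximalIdeal A)

section Tame

variable (K : Type v) [Field K] [ValuativeRel K] [TopologicalSpace K]
    [IsNonarchimedeanLocalField K]

/-- Along an integral extension the contraction of a maximal ideal is maximal. -/
theorem algebraMap_integers_mem_maximalIdeal (L : Type v) [Field L] [Algebra K L] {a : 𝒪[K]}
    (ha : a ∈ maximalIdeal 𝒪[K]) :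
    algebraMap 𝒪[K] (integersOf K L) a ∈ maximalIdeal (integersOf K L) := by
  have hI : Algebra.IsIntegral 𝒪[K] (integersOf K L) := inferInstance
  have hinj : FaithfulSMul 𝒪[K] (integersOf K L) := by
    rw [faithfulSMul_iff_algebraMap_injective]
    intro x y hxy
    have := congrArg (algebraMap (integersOf K L) L) hxy
    rw [← IsScalarTower.algebraMap_apply, ← IsScalarTower.algebraMap_apply,
      IsScalarTower.algebraMap_apply 𝒪[K] K L, IsScalarTower.algebraMap_apply 𝒪[K] K L] at this
    exact Subtype.val_injective ((algebraMap K L).injective this)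
  have h2 : ((maximalIdeal (integersOf K L)).comap (algebraMap 𝒪[K] (integersOf K L))).IsMaximal :=
    Ideal.isMaximal_comap_of_isIntegral_of_isMaximal _
  have h3 := IsLocalRing.eq_maximalIdeal h2
  rw [← h3] at ha
  exact ha

/-- The residue field of `L` is finite. -/
theorem finite_quotient_integersOf (L : Type v) [Field L] [Algebra K L]
    [FiniteDimensional K L] [Algebra.IsSeparable K L] :
    Finite (integersOf K L ⧸ maximalIdeal (integersOf K L)) := by
  have : Finite (ResidueField 𝒪[K]) := inferInstanceAs (Finite 𝓀[K])
  exact finite_quotient_of_finite _ fun a ha => algebraMap_integers_mem_maximalIdeal K L ha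

variable (p : ℕ) [Fact p.Prime] [CharP K p]

include p in
theorem charP_integersOf (L : Type v) [Field L] [Algebra K L] : CharP (integersOf K L) p := by
  have : CharP L p := charP_of_injective_algebraMap (algebraMap K L).injective p
  exact (RingHom.charP_iff (algebraMap (integersOf K L) L) Subtype.val_injective p).mpr this

/-- In a finite field extension of characteristic `p`, every element satisfies `x ^ (p ^ f) = x`. -/
theorem exists_pow_sub_mem_of_finite_quotient {B : Type*} [CommRing B] [CharP B p] (m : Ideal B)
    [m.IsMaximal] [Finite (B ⧸ m)] : ∃ f, 0 < f ∧ ∀ x : B, x ^ p ^ f - x ∈ m := by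
  let _ : Field (B ⧸ m) := Ideal.Quotient.field m
  have : Fintype (B ⧸ m) := Fintype.ofFinite _
  have : CharP (B ⧸ m) p :=
    (CharP.charP_iff_prime_eq_zero Fact.out).mpr (by
      rw [← map_natCast (Ideal.Quotient.mk m), CharP.cast_eq_zero, map_zero])
  obtain ⟨f, -, hf⟩ := FiniteField.card (B ⧸ m) p
  refine ⟨f, f.pos, fun x => ?_⟩
  rw [← Ideal.Quotient.eq, map_pow, ← hf, FiniteField.pow_card]

section Finite

variable (L : Type v) [Field L] [Algebra K L] [FiniteDimensional K L] [Algebra.IsSeparable K L]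

/-- A local Dedekind domain is a discrete valuation ring unless it is a field, and a uniformizer of
`K` remains a nonzero nonunit. -/
instance isDiscreteValuationRing_integersOf : IsDiscreteValuationRing (integersOf K L) := by
  have hnf : ¬ IsField (integersOf K L) := by
    intro h
    obtain ⟨ϖ, hϖ⟩ := IsDiscreteValuationRing.exists_irreducible 𝒪[K]
    have h1 := algebraMap_integers_mem_maximalIdeal K L
      ((IsLocalRing.mem_maximalIdeal _).mpr hϖ.not_isUnit)
    rw [(IsLocalRing.isField_iff_maximalIdeal_eq).mp h, Ideal.mem_bot] at h1
    have := congrArg (algebraMap (integersOf K L) L) h1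
    rw [← IsScalarTower.algebraMap_apply, IsScalarTower.algebraMap_apply 𝒪[K] K L, map_zero,
      map_eq_zero] at this
    exact hϖ.ne_zero (Subtype.val_injective this)
  have h := (IsDiscreteValuationRing.TFAE (integersOf K L) hnf).out 0 2 rfl rfl
  exact h.mpr inferInstance

variable {L} {ϖ : integersOf K L} (hϖ : Irreducible ϖ)

include hϖ

theorem mul_uniformizer_mem_sq {c : integersOf K L} :
    c * ϖ ∈ maximalIdeal (integersOf K L) ^ 2 ↔ c ∈ maximalIdeal (integersOf K L) := by
  rw [hϖ.maximalIdeal_eq, Ideal.span_singleton_pow, Ideal.mem_span_singleton,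
    Ideal.mem_span_singleton, pow_two]
  exact mul_dvd_mul_iff_right hϖ.ne_zero

include p in
-- The residue field is perfect, so every integer is `y ^ p - ϖ * w`. The first term moves by `(σ y
-- - y) ^ p`, which lies in `m ^ 2` for `σ ∈ G_0`; hence only the displacement of the uniformizer
-- matters.
theorem mem_lowerRamification_one_of_uniformizer {σ : L ≃ₐ[K] L}
    (h0 : σ ∈ lowerRamification K L 0)
    (h1 : σ • ϖ - ϖ ∈ maximalIdeal (integersOf K L) ^ 2) : σ ∈ lowerRamification K L 1 := by
  have := charP_integersOf K p L
  have := finite_quotient_integersOf K L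
  obtain ⟨f, hf, hq⟩ := exists_pow_sub_mem_of_finite_quotient p (maximalIdeal (integersOf K L))
  rw [mem_lowerRamification] at h0 ⊢
  intro x
  set y := x ^ p ^ (f - 1)
  have hy : y ^ p = x ^ p ^ f := by
    rw [← pow_mul, ← pow_succ, Nat.sub_add_cancel hf]
  have hz := hq x
  rw [← hy, hϖ.maximalIdeal_eq, Ideal.mem_span_singleton] at hz
  obtain ⟨w, hw⟩ := hz
  have ex : x = y ^ p - ϖ * w := by rw [← hw]; ring
  have e : σ • x - x = (σ • y - y) ^ p - (σ • w * (σ • ϖ - ϖ) + (σ • w - w) * ϖ) := by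
    rw [sub_pow_expChar, ex, smul_sub, smul_pow', smul_mul']; ring
  rw [e]
  refine sub_mem ?_ (add_mem (Ideal.mul_mem_left _ _ h1) ?_)
  · exact Ideal.pow_le_pow_right (Fact.out : p.Prime).two_le
      (Ideal.pow_mem_pow (by simpa using h0 y) p)
  · exact (mul_uniformizer_mem_sq K hϖ).mpr (by simpa using h0 w)

/-- This is the multiplicativity, on powers of `σ`, of the tame character `σ ↦ θ mod m`: elements of
`G_0` fix `θ` modulo `m`. -/
theorem pow_smul_uniformizer {σ : L ≃ₐ[K] L} (h0 : σ ∈ lowerRamification K L 0)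
    {θ : integersOf K L} (hθ : σ • ϖ = θ * ϖ) (k : ℕ) :
    σ ^ k • ϖ - θ ^ k * ϖ ∈ maximalIdeal (integersOf K L) ^ 2 := by
  rw [mem_lowerRamification] at h0
  induction k with
  | zero => simp
  | succ k ih =>
    have e : σ ^ (k + 1) • ϖ - θ ^ (k + 1) * ϖ =
        σ • (σ ^ k • ϖ - θ ^ k * ϖ) + (θ * (σ • θ ^ k - θ ^ k)) * ϖ := by
      rw [smul_sub, smul_mul', hθ, pow_succ' σ, mul_smul]; ring
    rw [e]
    refine add_mem (smul_mem_maximalIdeal_pow K L σ 2 ih) ?_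
    exact (mul_uniformizer_mem_sq K hϖ).mpr (Ideal.mul_mem_left _ _ (by simpa using h0 (θ ^ k)))

theorem exists_smul_uniformizer (σ : L ≃ₐ[K] L) : ∃ θ : integersOf K L, σ • ϖ = θ * ϖ := by
  have h : σ • ϖ ∈ maximalIdeal (integersOf K L) :=
    smul_mem_maximalIdeal K L σ ((mem_maximalIdeal _).mpr hϖ.not_isUnit)
  rw [hϖ.maximalIdeal_eq, Ideal.mem_span_singleton'] at h
  obtain ⟨θ, hθ⟩ := h
  exact ⟨θ, hθ.symm⟩

theorem isUnit_of_smul_uniformizer {σ : L ≃ₐ[K] L} {θ : integersOf K L} (hθ : σ • ϖ = θ * ϖ) :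
    IsUnit θ := by
  obtain ⟨θ', hθ'⟩ := exists_smul_uniformizer K hϖ σ⁻¹
  have h1 : σ • (σ⁻¹ • ϖ) = ϖ := by simp
  rw [hθ', smul_mul', hθ, ← mul_assoc] at h1
  exact IsUnit.of_mul_eq_one_right _ (mul_right_cancel₀ hϖ.ne_zero (h1.trans (one_mul ϖ).symm))

include p in
-- A domain of characteristic `p` has no nontrivial roots of unity of `p`-power order, because `θ ^
-- p ^ a - 1 = (θ - 1) ^ p ^ a`. So the tame character of `σ` is trivial.
theorem mem_lowerRamification_one_of_pow_sub_one_mem {σ : L ≃ₐ[K] L}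
    (h0 : σ ∈ lowerRamification K L 0) {θ : integersOf K L} (hθ : σ • ϖ = θ * ϖ) {a : ℕ}
    (ha : θ ^ p ^ a - 1 ∈ maximalIdeal (integersOf K L)) : σ ∈ lowerRamification K L 1 := by
  have := charP_integersOf K p L
  refine mem_lowerRamification_one_of_uniformizer K p hϖ h0 ?_
  have h2 : (θ - 1) ^ p ^ a ∈ maximalIdeal (integersOf K L) := by
    rwa [sub_pow_expChar_pow, one_pow]
  have h3 := Ideal.IsPrime.mem_of_pow_mem inferInstance _ h2
  have e : σ • ϖ - ϖ = (θ - 1) * ϖ := by rw [hθ]; ring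
  rw [e]
  exact (mul_uniformizer_mem_sq K hϖ).mpr h3

omit hϖ

variable (L)

include p in
/-- The quotient `G_0 / G_1` has order prime to `p`. -/
theorem exists_pow_mem_lowerRamification_one :
    ∃ j, ¬ p ∣ j ∧ ∀ σ ∈ lowerRamification K L 0, σ ^ j ∈ lowerRamification K L 1 := by
  have := charP_integersOf K p L
  have := finite_quotient_integersOf K L
  obtain ⟨ϖ, hϖ⟩ := IsDiscreteValuationRing.exists_irreducible (integersOf K L)
  obtain ⟨f, hf, hq⟩ := exists_pow_sub_mem_of_finite_quotient p (maximalIdeal (integersOf K L))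
  have hp1 : 1 ≤ p ^ f := Nat.one_le_pow _ _ (Fact.out : p.Prime).pos
  -- As `x ^ p ^ f = x` in the residue field, this exponent kills all values of the tame character.
  refine ⟨p ^ f - 1, fun h => ?_, fun σ hσ => ?_⟩
  · have h2 : p ∣ p ^ f := dvd_pow_self _ hf.ne'
    have h3 : p ∣ 1 := by
      have := Nat.dvd_sub h2 h
      rwa [Nat.sub_sub_self hp1] at this
    exact (Fact.out : p.Prime).one_lt.ne' (Nat.dvd_one.mp h3)
  · obtain ⟨θ, hθ⟩ := exists_smul_uniformizer K hϖ σ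
    have hu := isUnit_of_smul_uniformizer K hϖ hθ
    refine mem_lowerRamification_one_of_uniformizer K p hϖ (Subgroup.pow_mem _ hσ _) ?_
    have h1 := pow_smul_uniformizer K hϖ hσ hθ (p ^ f - 1)
    have h2 : θ * (θ ^ (p ^ f - 1) - 1) ∈ maximalIdeal (integersOf K L) := by
      rw [mul_sub, mul_one, ← pow_succ', Nat.sub_add_cancel hp1]; exact hq θ
    have h3 := (Ideal.unit_mul_mem_iff_mem _ hu).mp h2
    have h4 := (mul_uniformizer_mem_sq K hϖ).mpr h3
    have e := add_mem h1 h4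
    rwa [sub_mul, one_mul, sub_add_sub_cancel] at e

variable {L}

include p in
/-- An element of `p`-power order of `G_0` lies in `G_1`. -/
theorem mem_lowerRamification_one_of_pow_eq_one {σ : L ≃ₐ[K] L}
    (h0 : σ ∈ lowerRamification K L 0) {a : ℕ} (ha : σ ^ p ^ a = 1) :
    σ ∈ lowerRamification K L 1 := by
  obtain ⟨ϖ, hϖ⟩ := IsDiscreteValuationRing.exists_irreducible (integersOf K L)
  obtain ⟨θ, hθ⟩ := exists_smul_uniformizer K hϖ σ
  refine mem_lowerRamification_one_of_pow_sub_one_mem K p hϖ h0 hθ (a := a) ?_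
  have h1 := pow_smul_uniformizer K hϖ h0 hθ (p ^ a)
  rw [ha, one_smul] at h1
  have h2 : (θ ^ p ^ a - 1) * ϖ ∈ maximalIdeal (integersOf K L) ^ 2 := by
    have := neg_mem h1
    rwa [neg_sub, show θ ^ p ^ a * ϖ - ϖ = (θ ^ p ^ a - 1) * ϖ by ring] at this
  exact (mul_uniformizer_mem_sq K hϖ).mp h2

end Finite

end Tame

end LocalDeformation

/-! ### Constants and inertia in the separable closure. -/

open ValuativeRel IsLocalRing

namespace LocalDeformation

theorem mem_integersOf_map_iff (K : Type v) [Field K] [ValuativeRel K] {L L' : Type v} [Field L]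
    [Algebra K L] [Field L'] [Algebra K L'] (f : L →ₐ[K] L') (x : L) :
    f x ∈ integersOf K L' ↔ x ∈ integersOf K L :=
  isIntegral_algHom_iff (f.restrictScalars 𝒪[K]) f.injective

section SepClosure

variable (K : Type v) [Field K] [ValuativeRel K]

/-- The ring of integers of the separable closure. -/
noncomputable abbrev SepIntegers : Subalgebra 𝒪[K] (SeparableClosure K) := integersOf K (SeparableClosure K)

variable {K}

/-- The inclusion of the ring of integers of an intermediate field. -/
noncomputable def integersInclusion (L : IntermediateField K (SeparableClosure K)) :
    integersOf K L →+* SepIntegers K where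
  toFun x := ⟨x.1.1, (mem_integersOf_map_iff K (IntermediateField.val L) x.1).mpr x.2⟩
  map_one' := rfl
  map_mul' _ _ := rfl
  map_zero' := rfl
  map_add' _ _ := rfl

theorem exists_integersInclusion_eq (L : IntermediateField K (SeparableClosure K))
    (x : SepIntegers K) (hx : x.1 ∈ L) : ∃ y : integersOf K L, integersInclusion L y = x := by
  exact ⟨⟨⟨x.1, hx⟩, (mem_integersOf_map_iff K (IntermediateField.val L) _).mp x.2⟩, rfl⟩

theorem integersInclusion_injective (L : IntermediateField K (SeparableClosure K)) :
    Function.Injective (integersInclusion L) := fun x y h =>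
  Subtype.ext (Subtype.ext
    (show x.1.1 = y.1.1 from congrArg (fun z : SepIntegers K => z.1) h))

theorem integersInclusion_smul (L : FiniteGaloisIntermediateField K (SeparableClosure K))
    (σ : AbsGal K) (x : integersOf K L) :
    integersInclusion L.toIntermediateField (AlgEquiv.restrictNormalHom L σ • x) =
      σ • integersInclusion L.toIntermediateField x :=
  Subtype.ext (AlgEquiv.restrictNormalHom_apply L.toIntermediateField σ x.1)

theorem isUnit_integersInclusion {L : IntermediateField K (SeparableClosure K)}
    {x : integersOf K L} (h : IsUnit (integersInclusion L x)) : IsUnit x := by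
  obtain ⟨y, hy⟩ := h.exists_right_inv
  have hx0 : x.1.1 ≠ 0 := by
    intro h0
    have := congrArg Subtype.val hy
    simp [integersInclusion, h0] at this
  have hy' : y.1 = (x.1.1)⁻¹ := eq_inv_of_mul_eq_one_right (congrArg Subtype.val hy)
  obtain ⟨z, hz⟩ := exists_integersInclusion_eq L y (by rw [hy']; exact L.inv_mem x.1.2)
  refine IsUnit.of_mul_eq_one z (integersInclusion_injective L ?_)
  rw [map_mul, hz, hy, map_one]

variable [TopologicalSpace K] [IsNonarchimedeanLocalField K]

theorem integersInclusion_mem_maximalIdeal {L : IntermediateField K (SeparableClosure K)}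
    {x : integersOf K L} :
    integersInclusion L x ∈ maximalIdeal (SepIntegers K) ↔ x ∈ maximalIdeal (integersOf K L) := by
  rw [mem_maximalIdeal, mem_maximalIdeal, mem_nonunits_iff, mem_nonunits_iff, not_iff_not]
  exact ⟨isUnit_integersInclusion, fun h => h.map _⟩

theorem exists_finiteGalois_mem (x : SeparableClosure K) :
    ∃ L : FiniteGaloisIntermediateField K (SeparableClosure K), x ∈ L.toIntermediateField :=
  ⟨FiniteGaloisIntermediateField.adjoin K {x},
    FiniteGaloisIntermediateField.subset_adjoin K {x} rfl⟩

/-- Every integer lies in a finite Galois level, whose maximal ideal is the contraction of that of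
the separable closure. The conditions at all levels therefore amount to one congruence. -/
theorem mem_inertia_iff {σ : AbsGal K} :
    σ ∈ inertia K ↔ ∀ x : SepIntegers K, σ • x - x ∈ maximalIdeal (SepIntegers K) := by
  simp only [inertia, Subgroup.mem_iInf, Subgroup.mem_comap, mem_lowerRamification]
  constructor
  · intro h x
    obtain ⟨L, hL⟩ := exists_finiteGalois_mem x.1
    obtain ⟨y, rfl⟩ := exists_integersInclusion_eq L.toIntermediateField x hL
    have := h L y
    rw [zero_add, pow_one] at this
    have h2 := integersInclusion_mem_maximalIdeal.mpr this
    rwa [map_sub, integersInclusion_smul] at h2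
  · intro h L x
    rw [zero_add, pow_one, ← integersInclusion_mem_maximalIdeal, map_sub, integersInclusion_smul]
    exact h _

theorem mem_lowerRamification_zero_of_mem_inertia {σ : AbsGal K} (h : σ ∈ inertia K)
    (L : FiniteGaloisIntermediateField K (SeparableClosure K)) :
    AlgEquiv.restrictNormalHom L σ ∈ lowerRamification K L 0 := by
  simp only [inertia, Subgroup.mem_iInf, Subgroup.mem_comap] at h
  exact h L

theorem wildInertia_le_inertia : wildInertia K ≤ inertia K :=
  iInf_mono fun L => Subgroup.comap_mono (lowerRamification_anti K L (Nat.zero_le 1))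

variable (p : ℕ) [Fact p.Prime]

/-- The elements of the algebraic closure of the prime field. -/
def IsConst (ξ : SepIntegers K) : Prop := ∃ N, 0 < N ∧ ξ ^ p ^ N = ξ

variable {p}

omit [TopologicalSpace K] [IsNonarchimedeanLocalField K] [Fact p.Prime] in
theorem pow_pow_mul_eq {ξ : SepIntegers K} {N : ℕ} (h : ξ ^ p ^ N = ξ) (k : ℕ) :
    ξ ^ p ^ (N * k) = ξ := by
  induction k with
  | zero => simp
  | succ k ih => rw [mul_add, mul_one, pow_add, pow_mul, ih, h]

omit [TopologicalSpace K] [IsNonarchimedeanLocalField K] [Fact p.Prime] in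
theorem IsConst.common {ξ ξ' : SepIntegers K} (h : IsConst p ξ) (h' : IsConst p ξ') :
    ∃ N, 0 < N ∧ ξ ^ p ^ N = ξ ∧ ξ' ^ p ^ N = ξ' := by
  obtain ⟨N, hN, e⟩ := h
  obtain ⟨N', hN', e'⟩ := h'
  exact ⟨N * N', by positivity, pow_pow_mul_eq e N', by rw [mul_comm]; exact pow_pow_mul_eq e' N⟩

omit [TopologicalSpace K] [IsNonarchimedeanLocalField K] [Fact p.Prime] in
theorem IsConst.pow {ξ : SepIntegers K} (h : IsConst p ξ) (k : ℕ) : IsConst p (ξ ^ k) := by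
  obtain ⟨N, hN, e⟩ := h
  exact ⟨N, hN, by rw [← pow_mul, mul_comm, pow_mul, e]⟩

omit [TopologicalSpace K] [IsNonarchimedeanLocalField K] [Fact p.Prime] in
theorem IsConst.smul {ξ : SepIntegers K} (h : IsConst p ξ) (σ : AbsGal K) : IsConst p (σ • ξ) := by
  obtain ⟨N, hN, e⟩ := h
  exact ⟨N, hN, by rw [← smul_pow', e]⟩

omit [TopologicalSpace K] [IsNonarchimedeanLocalField K] in
theorem isConst_of_pow_eq_one {ζ : SepIntegers K} {e : ℕ} (he : ¬ p ∣ e) (h : ζ ^ e = 1) :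
    IsConst p ζ := by
  have hc : Nat.Coprime p e := (Nat.Prime.coprime_iff_not_dvd Fact.out).mpr he
  have he0 : 0 < e := Nat.pos_of_ne_zero fun h0 => he (h0 ▸ dvd_zero p)
  refine ⟨e.totient, Nat.totient_pos.mpr he0, ?_⟩
  have h1 := Nat.ModEq.pow_totient hc
  have hp : 1 ≤ p ^ e.totient := Nat.one_le_pow _ _ (Fact.out : p.Prime).pos
  obtain ⟨k, hk⟩ := (Nat.modEq_iff_dvd' hp).mp h1.symm
  rw [← Nat.sub_add_cancel hp, hk, pow_succ, pow_mul, h, one_pow, one_mul]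

variable [CharP K p]

/-- The difference `δ` satisfies `δ ^ p ^ N = δ`. If it lies in the maximal ideal, then `1 - δ ^ (p
^ N - 1)` is nonzero and `δ` vanishes. Constants thus inject into the residue field. -/
theorem IsConst.eq_of_sub_mem {ξ ξ' : SepIntegers K} (h : IsConst p ξ) (h' : IsConst p ξ')
    (hm : ξ - ξ' ∈ maximalIdeal (SepIntegers K)) : ξ = ξ' := by
  have := charP_integersOf K p (SeparableClosure K)
  obtain ⟨N, hN, e, e'⟩ := h.common h'
  have h1 : (ξ - ξ') ^ p ^ N = ξ - ξ' := by rw [sub_pow_expChar_pow, e, e']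
  have h2 : 2 ≤ p ^ N := (Fact.out : p.Prime).two_le.trans (Nat.le_self_pow hN.ne' p)
  have h3 : (ξ - ξ') * (1 - (ξ - ξ') ^ (p ^ N - 1)) = 0 := by
    rw [mul_sub, mul_one, ← pow_succ', Nat.sub_add_cancel (by omega), h1, sub_self]
  rcases mul_eq_zero.mp h3 with h | h
  · exact sub_eq_zero.mp h
  · have h4 := Ideal.pow_mem_of_mem _ hm (p ^ N - 1) (by omega)
    rw [← sub_eq_zero.mp h] at h4
    exact absurd h4 ((Ideal.ne_top_iff_one _).mp (maximalIdeal.isMaximal _).ne_top)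

theorem exists_pow_sub_mem (x : SepIntegers K) :
    ∃ N, 0 < N ∧ x ^ p ^ N - x ∈ maximalIdeal (SepIntegers K) := by
  obtain ⟨L, hL⟩ := exists_finiteGalois_mem x.1
  obtain ⟨y, rfl⟩ := exists_integersInclusion_eq L.toIntermediateField x hL
  have := charP_integersOf K p L
  have := finite_quotient_integersOf K L
  obtain ⟨f, hf, hq⟩ := exists_pow_sub_mem_of_finite_quotient p (maximalIdeal (integersOf K L))
  refine ⟨f, hf, ?_⟩
  rw [← map_pow, ← map_sub]
  exact integersInclusion_mem_maximalIdeal.mpr (hq y)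

omit [ValuativeRel K] [TopologicalSpace K] [IsNonarchimedeanLocalField K] in
theorem splits_X_pow_sub_X {N : ℕ} (hN : 0 < N) :
    (Polynomial.X ^ p ^ N - Polynomial.X : Polynomial (SeparableClosure K)).Splits := by
  have : CharP (SeparableClosure K) p :=
    charP_of_injective_algebraMap (algebraMap K (SeparableClosure K)).injective p
  refine IsSepClosed.splits_of_separable _ (galois_poly_separable p _ (dvd_pow_self p hN.ne'))

/-- The element `x ^ p ^ N - x` of the maximal ideal is the product of the `x - ξ` over the roots
`ξ` of `X ^ p ^ N - X`, all of which are constants. So some factor is not a unit. -/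
theorem exists_isConst_sub_mem (x : SepIntegers K) :
    ∃ ξ : SepIntegers K, IsConst p ξ ∧ x - ξ ∈ maximalIdeal (SepIntegers K) := by
  obtain ⟨N, hN, hx⟩ := exists_pow_sub_mem (p := p) x
  by_contra hcon
  push Not at hcon
  set P : Polynomial (SeparableClosure K) := Polynomial.X ^ p ^ N - Polynomial.X
  have h1 : 1 < p ^ N := Nat.one_lt_pow hN.ne' (Fact.out : p.Prime).one_lt
  have hmon : P.Monic := by
    refine Polynomial.monic_X_pow_sub ?_
    rw [Polynomial.degree_X]; exact_mod_cast h1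
  have hev := (splits_X_pow_sub_X (K := K) (p := p) hN).eval_eq_prod_roots x.1
  rw [hmon.leadingCoeff, one_mul] at hev
  have hmem : (P.roots.map (x.1 - ·)).prod ∈
      (IsUnit.submonoid (SepIntegers K)).map (SepIntegers K).val := by
    refine Submonoid.multiset_prod_mem _ _ fun y hy => ?_
    obtain ⟨ξ, hξ, rfl⟩ := Multiset.mem_map.mp hy
    have hξ' : ξ ^ p ^ N = ξ := by
      have := (Polynomial.mem_roots'.mp hξ).2
      simpa [P, sub_eq_zero] using this
    have hint : ξ ∈ SepIntegers K := by
      refine ⟨Polynomial.X ^ p ^ N - Polynomial.X, ?_, by simp [hξ']⟩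
      refine Polynomial.monic_X_pow_sub ?_
      rw [Polynomial.degree_X]; exact_mod_cast h1
    have hu := hcon ⟨ξ, hint⟩ ⟨N, hN, Subtype.ext hξ'⟩
    rw [mem_maximalIdeal, mem_nonunits_iff, not_not] at hu
    exact ⟨x - ⟨ξ, hint⟩, hu, rfl⟩
  obtain ⟨z, hz, hzx⟩ := hmem
  rw [← hev] at hzx
  have : z = x ^ p ^ N - x := Subtype.ext (hzx.trans (by simp))
  rw [← this] at hx
  exact (mem_nonunits_iff.mp ((mem_maximalIdeal _).mp hx)) hz

variable (p) in
include p in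
/-- The inertia group is the group of all elements that fix the constants. -/
theorem mem_inertia_iff_isConst {σ : AbsGal K} :
    σ ∈ inertia K ↔ ∀ ξ : SepIntegers K, IsConst p ξ → σ • ξ = ξ := by
  rw [mem_inertia_iff]
  constructor
  · intro h ξ hξ
    exact (hξ.smul σ).eq_of_sub_mem hξ (h ξ)
  · intro h x
    obtain ⟨ξ, hξ, hx⟩ := exists_isConst_sub_mem (p := p) x
    have e : σ • x - x = σ • (x - ξ) - (x - ξ) := by rw [smul_sub, h ξ hξ]; ring
    rw [e]
    exact sub_mem (smul_mem_maximalIdeal K _ σ hx) hx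

instance normal_inertia : (inertia K).Normal := by
  refine ⟨fun σ hσ τ => ?_⟩
  rw [mem_inertia_iff] at hσ ⊢
  intro x
  have := smul_mem_maximalIdeal K _ τ (hσ (τ⁻¹ • x))
  simpa [smul_sub, mul_smul] using this

end SepClosure

end LocalDeformation

/-! ### Frobenius elements. -/

open ValuativeRel IsLocalRing

namespace LocalDeformation

/-- In a compact space, a directed family of closed sets whose intersection is contained in an
open set has a member that is contained in it. -/
theorem exists_subset_of_iInter_subset {X : Type*} [TopologicalSpace X] [CompactSpace X]
    {ι : Type*} [Nonempty ι] (Z : ι → Set X) (hd : Directed (· ⊇ ·) Z) (hc : ∀ i, IsClosed (Z i))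
    {U : Set X} (hU : IsOpen U) (h : ⋂ i, Z i ⊆ U) : ∃ i, Z i ⊆ U := by
  by_contra hcon
  push Not at hcon
  have hcl : ∀ i, IsClosed (Z i ∩ Uᶜ) := fun i => (hc i).inter hU.isClosed_compl
  obtain ⟨x, hx⟩ := IsCompact.nonempty_iInter_of_directed_nonempty_isCompact_isClosed
    (fun i => Z i ∩ Uᶜ)
    (fun i j => (hd i j).imp fun k hk => ⟨Set.inter_subset_inter_left _ hk.1,
      Set.inter_subset_inter_left _ hk.2⟩)
    (fun i => Set.not_subset.mp (hcon i)) (fun i => (hcl i).isCompact) hcl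
  rw [Set.mem_iInter] at hx
  exact (hx (Classical.arbitrary ι)).2 (h (Set.mem_iInter.mpr fun i => (hx i).1))

/-- A ring endomorphism which fixes all elements with `c ^ q = c` permutes the `q`-power orbit of
an element. -/
theorem exists_map_eq_pow_of_cycle (p : ℕ) {B : Type*} [CommRing B] [IsDomain B] [Fact p.Prime]
    [CharP B p] {f N : ℕ} (hN : 0 < N) {ξ : B} (hqN : ξ ^ (p ^ f) ^ N = ξ) (τ : B →+* B)
    (hτ : ∀ c, c ^ p ^ f = c → τ c = c) : ∃ b, τ ξ = ξ ^ (p ^ f) ^ b := by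
  -- The `q`-power map, `q = p ^ f`, permutes the roots of `P` cyclically, so it fixes the
  -- coefficients of `P`, and by assumption so does `τ`. Hence `τ ξ` is a root of `P` too.
  set P : Polynomial B :=
    ∏ i ∈ Finset.range N, (Polynomial.X - Polynomial.C (ξ ^ (p ^ f) ^ i)) with hP
  have hfrob : P.map (iterateFrobenius B p f) = P := by
    rw [hP, Polynomial.map_prod]
    simp only [Polynomial.map_sub, Polynomial.map_X, Polynomial.map_C]
    obtain ⟨M, rfl⟩ := Nat.exists_eq_succ_of_ne_zero hN.ne'
    rw [Finset.prod_range_succ, Finset.prod_range_succ' (fun i =>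
      Polynomial.X - Polynomial.C (ξ ^ (p ^ f) ^ i))]
    congr 1
    · refine Finset.prod_congr rfl fun i _ => ?_
      rw [iterateFrobenius_def, ← pow_mul, ← pow_succ]
    · rw [iterateFrobenius_def, ← pow_mul, ← pow_succ, hqN, pow_zero, pow_one]
  have hfix : P.map τ = P := by
    ext1 i
    rw [Polynomial.coeff_map]
    refine hτ _ ?_
    have := congrArg (fun R => Polynomial.coeff R i) hfrob
    simpa only [Polynomial.coeff_map, iterateFrobenius_def] using this
  have hev : P.eval (τ ξ) = 0 := by
    have h1 : P.eval ξ = 0 := by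
      rw [hP, Polynomial.eval_prod]
      exact Finset.prod_eq_zero (Finset.mem_range.mpr hN) (by simp)
    have h2 := Polynomial.eval_map_apply τ ξ (p := P)
    rw [hfix, h1, map_zero] at h2
    exact h2
  rw [hP, Polynomial.eval_prod, Finset.prod_eq_zero_iff] at hev
  obtain ⟨i, -, hi⟩ := hev
  exact ⟨i, by simpa [sub_eq_zero] using hi⟩

section Frobenius

variable {K : Type v} [Field K] [ValuativeRel K]

/-- The orbit map of `x` is locally constant, as stabilizers are open. Every condition on `σ • x` is
therefore both open and closed, which feeds the compactness arguments below. -/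
theorem isOpen_setOf_smul_mem (x : SepIntegers K) (S : Set (SepIntegers K)) :
    IsOpen {σ : AbsGal K | σ • x ∈ S} := by
  have h := stabilizer_isOpen_of_isIntegral (K := K) (L := SeparableClosure K) x.1
  rw [isOpen_iff_mem_nhds]
  intro σ hσ
  have h2 : (fun τ => σ⁻¹ * τ) ⁻¹'
      (MulAction.stabilizer (AbsGal K) x.1 : Set (AbsGal K)) ∈ nhds σ :=
    (h.preimage (continuous_const_mul σ⁻¹)).mem_nhds (by
      simp only [Set.mem_preimage, inv_mul_cancel]; exact one_mem _)
  filter_upwards [h2] with τ hτ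
  have h3 : (σ⁻¹ * τ) • x = x := Subtype.ext hτ
  rw [mul_smul, inv_smul_eq_iff] at h3
  change τ • x ∈ S
  rw [h3]
  exact hσ

theorem isClosed_setOf_smul_mem (x : SepIntegers K) (S : Set (SepIntegers K)) :
    IsClosed {σ : AbsGal K | σ • x ∈ S} :=
  ⟨by convert! isOpen_setOf_smul_mem x Sᶜ⟩

variable [TopologicalSpace K] [IsNonarchimedeanLocalField K]

variable (p : ℕ) [Fact p.Prime] [CharP K p]

/-- The order of the residue field. -/
noncomputable def residueCard (K : Type v) [Field K] [ValuativeRel K] : ℕ := Nat.card 𝓀[K]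

variable (K) in
include p in
theorem exists_residueCard_eq : ∃ f, 0 < f ∧ residueCard K = p ^ f := by
  have : Fintype 𝓀[K] := Fintype.ofFinite _
  have : CharP 𝒪[K] p :=
    (RingHom.charP_iff (algebraMap 𝒪[K] K) Subtype.val_injective p).mpr inferInstance
  have : CharP 𝓀[K] p :=
    (CharP.charP_iff_prime_eq_zero Fact.out).mpr (by
      rw [← map_natCast (residue 𝒪[K]), CharP.cast_eq_zero, map_zero])
  obtain ⟨f, -, hf⟩ := FiniteField.card 𝓀[K] p
  exact ⟨f, f.pos, by rw [residueCard, Nat.card_eq_fintype_card, hf]⟩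

theorem pow_residueCard_sub_mem (a : 𝒪[K]) : a ^ residueCard K - a ∈ maximalIdeal 𝒪[K] := by
  have : Fintype 𝓀[K] := Fintype.ofFinite _
  rw [← residue_eq_zero_iff, map_sub, map_pow, residueCard, Nat.card_eq_fintype_card,
    FiniteField.pow_card, sub_self]

include p in
-- Over the residue field of `K` the polynomial `X ^ q - X` already splits completely, so it
-- acquires no new root in the larger residue field.
theorem exists_algebraMap_sub_mem {ξ : SepIntegers K} (hξ : ξ ^ residueCard K = ξ) :
    ∃ a : 𝒪[K], algebraMap 𝒪[K] (SepIntegers K) a - ξ ∈ maximalIdeal (SepIntegers K) := by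
  classical
  have : Fintype 𝓀[K] := Fintype.ofFinite _
  let ι : 𝓀[K] →+* ResidueField (SepIntegers K) :=
    Ideal.quotientMap (maximalIdeal (SepIntegers K)) (algebraMap 𝒪[K] (SepIntegers K))
      (fun a ha => algebraMap_integers_mem_maximalIdeal K _ ha)
  obtain ⟨f, hf, hq⟩ := exists_residueCard_eq K p
  have hcard : Fintype.card 𝓀[K] = residueCard K := by rw [residueCard, Nat.card_eq_fintype_card]
  have hq1 : 1 < Fintype.card 𝓀[K] := by
    rw [hcard, hq]; exact Nat.one_lt_pow hf.ne' (Fact.out : p.Prime).one_lt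
  have hroots := FiniteField.roots_X_pow_card_sub_X 𝓀[K]
  have hmon : (Polynomial.X ^ Fintype.card 𝓀[K] - Polynomial.X : Polynomial 𝓀[K]).Monic := by
    refine Polynomial.monic_X_pow_sub ?_
    rw [Polynomial.degree_X]; exact_mod_cast hq1
  have hprod := Polynomial.prod_multiset_X_sub_C_of_monic_of_roots_card_eq hmon (by
    rw [hroots, FiniteField.X_pow_card_sub_X_natDegree_eq _ hq1]; rfl)
  have h1 := congrArg (Polynomial.eval₂ ι (residue _ ξ)) hprod
  rw [hroots, ← Finset.prod_eq_multiset_prod, Polynomial.eval₂_finsetProd] at h1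
  have h2 : Polynomial.eval₂ ι (residue _ ξ)
      (Polynomial.X ^ Fintype.card 𝓀[K] - Polynomial.X : Polynomial 𝓀[K]) = 0 := by
    rw [Polynomial.eval₂_sub, Polynomial.eval₂_pow, Polynomial.eval₂_X, ← map_pow, hcard, hξ,
      sub_self]
  rw [h2, Finset.prod_eq_zero_iff] at h1
  obtain ⟨a, -, ha⟩ := h1
  obtain ⟨a, rfl⟩ := residue_surjective a
  refine ⟨a, ?_⟩
  rw [Polynomial.eval₂_sub, Polynomial.eval₂_X, Polynomial.eval₂_C, sub_eq_zero] at ha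
  rw [← residue_eq_zero_iff, map_sub, ha]
  exact sub_self _

theorem smul_algebraMap_integers (σ : AbsGal K) (a : 𝒪[K]) :
    σ • algebraMap 𝒪[K] (SepIntegers K) a = algebraMap 𝒪[K] (SepIntegers K) a :=
  Subtype.ext (σ.commutes (a : K))

include p in
theorem isConst_of_pow_residueCard {ξ : SepIntegers K} (hξ : ξ ^ residueCard K = ξ) :
    IsConst p ξ := by
  obtain ⟨f, hf, hq⟩ := exists_residueCard_eq K p
  exact ⟨f, hf, by rw [← hq, hξ]⟩

include p in
/-- A constant of degree one over the residue field of `K` is fixed by the Galois group. -/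
theorem smul_eq_of_pow_residueCard {ξ : SepIntegers K} (hξ : ξ ^ residueCard K = ξ)
    (σ : AbsGal K) : σ • ξ = ξ := by
  obtain ⟨a, ha⟩ := exists_algebraMap_sub_mem p hξ
  have hc := isConst_of_pow_residueCard p hξ
  refine (hc.smul σ).eq_of_sub_mem hc ?_
  have h1 := smul_mem_maximalIdeal K _ σ ha
  rw [smul_sub, smul_algebraMap_integers] at h1
  have := sub_mem ha h1
  rwa [sub_sub_sub_cancel_left] at this

variable {p}

/-- The Galois group acts on the constants through powers of the Frobenius. -/
theorem IsConst.exists_smul_eq {ξ : SepIntegers K} (hξ : IsConst p ξ) (σ : AbsGal K) :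
    ∃ b, σ • ξ = ξ ^ residueCard K ^ b := by
  have := charP_integersOf K p (SeparableClosure K)
  obtain ⟨f, hf, hq⟩ := exists_residueCard_eq K p
  obtain ⟨N, hN, e⟩ := hξ
  rw [hq]
  refine exists_map_eq_pow_of_cycle p hN (by rw [← pow_mul, mul_comm]; exact pow_pow_mul_eq e f)
    (MulSemiringAction.toRingHom _ (SepIntegers K) σ) fun c hc => ?_
  rw [← hq] at hc
  exact smul_eq_of_pow_residueCard p hc σ

variable (p)

omit [TopologicalSpace K] [IsNonarchimedeanLocalField K] in
include p in
theorem exists_primitiveRoot {e : ℕ} (he : ¬ p ∣ e) : ∃ ζ : SepIntegers K, IsPrimitiveRoot ζ e := by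
  have : CharP (SeparableClosure K) p :=
    charP_of_injective_algebraMap (algebraMap K (SeparableClosure K)).injective p
  have : NeZero (e : SeparableClosure K) :=
    ⟨fun h => he ((CharP.cast_eq_zero_iff (SeparableClosure K) p e).mp h)⟩
  obtain ⟨ζ, hζ⟩ := HasEnoughRootsOfUnity.exists_primitiveRoot (SeparableClosure K) e
  have he0 : 0 < e := Nat.pos_of_ne_zero fun h0 => he (h0 ▸ dvd_zero p)
  have hint : ζ ∈ SepIntegers K := by
    refine ⟨Polynomial.X ^ e - 1, Polynomial.monic_X_pow_sub_C 1 he0.ne', by simp [hζ.pow_eq_one]⟩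
  exact ⟨⟨ζ, hint⟩, IsPrimitiveRoot.of_map_of_injective (f := (SepIntegers K).val) hζ
    Subtype.val_injective⟩

omit [TopologicalSpace K] [IsNonarchimedeanLocalField K] in
/-- The constants `ξ` with `ξ ^ (p ^ N) = ξ` are powers of a single one. -/
theorem exists_generator_const {N : ℕ} (hN : 0 < N) : ∃ ζ : SepIntegers K,
    IsPrimitiveRoot ζ (p ^ N - 1) ∧ ζ ^ p ^ N = ζ ∧
    ∀ ξ : SepIntegers K, ξ ^ p ^ N = ξ → ξ = 0 ∨ ∃ i, ξ = ζ ^ i := by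
  have hp1 : 1 < p ^ N := Nat.one_lt_pow hN.ne' (Fact.out : p.Prime).one_lt
  have hnd : ¬ p ∣ p ^ N - 1 := fun h => by
    have h3 := Nat.dvd_sub (dvd_pow_self p hN.ne') h
    rw [Nat.sub_sub_self hp1.le] at h3
    exact (Fact.out : p.Prime).one_lt.ne' (Nat.dvd_one.mp h3)
  obtain ⟨ζ, hζ⟩ := exists_primitiveRoot (K := K) p hnd
  refine ⟨ζ, hζ, ?_, fun ξ hξ => ?_⟩
  · conv_lhs => rw [← Nat.sub_add_cancel hp1.le, pow_succ, hζ.pow_eq_one, one_mul]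
  · by_cases h0 : ξ = 0
    · exact Or.inl h0
    · right
      have : NeZero (p ^ N - 1) := ⟨by omega⟩
      have h1 : ξ ^ (p ^ N - 1) = 1 := by
        have : ξ * ξ ^ (p ^ N - 1) = ξ * 1 := by
          rw [← pow_succ', Nat.sub_add_cancel hp1.le, hξ, mul_one]
        exact mul_left_cancel₀ h0 this
      obtain ⟨i, -, hi⟩ := hζ.eq_pow_of_pow_eq_one h1
      exact ⟨i, hi.symm⟩

variable {p} in
/-- A constant is conjugate to its `q`-th power. -/
theorem IsConst.exists_smul_eq_pow {ζ : SepIntegers K} (hζ : IsConst p ζ) :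
    ∃ σ : AbsGal K, σ • ζ = ζ ^ residueCard K := by
  obtain ⟨f, hf, hq⟩ := exists_residueCard_eq K p
  obtain ⟨N, hN, e⟩ := hζ
  have hcharΩ : CharP (SeparableClosure K) p :=
    charP_of_injective_algebraMap (algebraMap K (SeparableClosure K)).injective p
  have hint : IsIntegral K ζ.1 := Algebra.IsIntegral.isIntegral _
  -- The aim is that `ζ ^ q` is a root of the minimal polynomial `g` of `ζ`. All roots of `g`
  -- satisfy `r ^ p ^ N = r`, hence so do its coefficients.
  set g := minpoly K ζ.1 with hg
  have hgmon : g.Monic := minpoly.monic hint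
  have hdvd : g ∣ Polynomial.X ^ p ^ N - Polynomial.X :=
    minpoly.dvd _ _ (by simpa [sub_eq_zero] using congrArg Subtype.val e)
  have hdvd' : g.map (algebraMap K (SeparableClosure K)) ∣ Polynomial.X ^ p ^ N - Polynomial.X := by
    have := Polynomial.map_dvd (algebraMap K (SeparableClosure K)) hdvd
    simpa using this
  have hne : (Polynomial.X ^ p ^ N - Polynomial.X : Polynomial (SeparableClosure K)) ≠ 0 :=
    FiniteField.X_pow_card_pow_sub_X_ne_zero _ hN.ne' (Fact.out : p.Prime).one_lt
  have hspl : (g.map (algebraMap K (SeparableClosure K))).Splits :=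
    (splits_X_pow_sub_X (K := K) (p := p) hN).of_dvd hne hdvd'
  have hroot : ∀ r ∈ (g.map (algebraMap K (SeparableClosure K))).roots, r ^ p ^ N = r := by
    intro r hr
    have h1 := (Polynomial.mem_roots'.mp hr).2
    have h2 := h1.dvd hdvd'
    simpa [sub_eq_zero] using h2
  have hmapΩ : (g.map (algebraMap K (SeparableClosure K))).map
      (iterateFrobenius (SeparableClosure K) p N) = g.map (algebraMap K (SeparableClosure K)) := by
    have hp := hspl.eq_prod_roots_of_monic (hgmon.map _)
    conv_lhs => rw [hp]
    conv_rhs => rw [hp]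
    rw [Polynomial.map_multiset_prod, Multiset.map_map]
    congr 1
    refine Multiset.map_congr rfl fun r hr => ?_
    simp [iterateFrobenius_def, hroot r hr]
  have hcoefN : ∀ i, g.coeff i ^ p ^ N = g.coeff i := by
    intro i
    apply (algebraMap K (SeparableClosure K)).injective
    have := congrArg (fun R => Polynomial.coeff R i) hmapΩ
    simpa [Polynomial.coeff_map, iterateFrobenius_def] using this
  have hp1 : 1 < p ^ N := Nat.one_lt_pow hN.ne' (Fact.out : p.Prime).one_lt
  -- A coefficient is a constant lying in `𝒪[K]`. It is congruent to its `q`-th power, and congruent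
  -- constants are equal.
  have hcoef : ∀ i, g.coeff i ^ residueCard K = g.coeff i := by
    intro i
    have hci : IsIntegral 𝒪[K] (g.coeff i) := by
      refine ⟨Polynomial.X ^ p ^ N - Polynomial.X, ?_, by simp [hcoefN i]⟩
      refine Polynomial.monic_X_pow_sub ?_
      rw [Polynomial.degree_X]; exact_mod_cast hp1
    obtain ⟨c, hc⟩ := IsIntegrallyClosed.isIntegral_iff.mp hci
    have hc' : (c : K) = g.coeff i := hc
    have hcN : c ^ p ^ N = c := Subtype.val_injective (by simpa [hc'] using hcoefN i)
    have hconst : IsConst p (algebraMap 𝒪[K] (SepIntegers K) c) :=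
      ⟨N, hN, by rw [← map_pow, hcN]⟩
    have h1 := algebraMap_integers_mem_maximalIdeal K (SeparableClosure K)
      (pow_residueCard_sub_mem c)
    rw [map_sub, map_pow] at h1
    have h2 := (hconst.pow _).eq_of_sub_mem hconst h1
    rw [← hc']
    have h3 := congrArg Subtype.val h2
    apply (algebraMap K (SeparableClosure K)).injective
    rw [map_pow]
    exact h3
  have hfrobg : g.map (iterateFrobenius K p f) = g := by
    ext1 i
    rw [Polynomial.coeff_map, iterateFrobenius_def, ← hq, hcoef i]
  have hroot2 : Polynomial.aeval (ζ.1 ^ residueCard K) g = 0 := by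
    have h1 : Polynomial.aeval ζ.1 g = 0 := minpoly.aeval K ζ.1
    have h2 := congrArg (iterateFrobenius (SeparableClosure K) p f) h1
    rw [map_zero, Polynomial.aeval_def, Polynomial.hom_eval₂] at h2
    have h3 : (iterateFrobenius (SeparableClosure K) p f).comp (algebraMap K (SeparableClosure K)) =
        (algebraMap K (SeparableClosure K)).comp (iterateFrobenius K p f) := by
      ext x; simp [iterateFrobenius_def]
    rw [h3, ← Polynomial.eval₂_map, hfrobg, iterateFrobenius_def, ← hq] at h2
    exact h2
  have hconj : IsConjRoot K (ζ.1 ^ residueCard K) ζ.1 := by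
    rw [isConjRoot_def]
    exact (minpoly.eq_of_irreducible_of_monic (minpoly.irreducible hint) hroot2 hgmon).symm
  obtain ⟨σ, hσ⟩ := isConjRoot_iff_exists_algEquiv.mp hconj
  exact ⟨σ, Subtype.ext hσ⟩

variable (K) in
/-- Existence of a Frobenius element. -/
theorem exists_frobenius : ∃ s : AbsGal K, ∀ ξ : SepIntegers K, IsConst p ξ →
    s • ξ = ξ ^ residueCard K := by
  obtain ⟨f, hf, hq⟩ := exists_residueCard_eq K p
  -- `C N` consists of the elements that act as the `q`-th power on the finite set of constants
  -- killed by `X ^ p ^ (N + 1) - X`; the shift avoids the exponent zero, where the condition would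
  -- be vacuous as an equation. It is nonempty, since these constants are powers of one of them, and
  -- compactness gives a common element.
  let C : ℕ → Set (AbsGal K) := fun N =>
    ⋂ ξ ∈ {ξ : SepIntegers K | ξ ^ p ^ (N + 1) = ξ}, {σ | σ • ξ ∈ ({ξ ^ residueCard K} : Set _)}
  have hmem : ∀ N σ, σ ∈ C N ↔ ∀ ξ : SepIntegers K, ξ ^ p ^ (N + 1) = ξ →
      σ • ξ = ξ ^ residueCard K := by
    intro N σ; simp [C]
  have hcl : ∀ N, IsClosed (C N) := fun N =>
    isClosed_biInter fun ξ _ => isClosed_setOf_smul_mem _ _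
  obtain ⟨s, hs⟩ := IsCompact.nonempty_iInter_of_directed_nonempty_isCompact_isClosed C
    (fun N N' => ⟨(N + 1) * (N' + 1) - 1, by
      have e : (N + 1) * (N' + 1) - 1 + 1 = (N + 1) * (N' + 1) :=
        Nat.sub_add_cancel (by nlinarith)
      constructor
      · intro σ hσ
        rw [hmem, e] at hσ
        exact (hmem _ _).mpr fun ξ hξ => hσ ξ (pow_pow_mul_eq hξ _)
      · intro σ hσ
        rw [hmem, e] at hσ
        refine (hmem _ _).mpr fun ξ hξ => hσ ξ ?_
        rw [mul_comm]; exact pow_pow_mul_eq hξ _⟩)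
    (fun N => by
      obtain ⟨ζ, -, hζN, hζ⟩ := exists_generator_const (K := K) p (Nat.succ_pos N)
      obtain ⟨σ, hσ⟩ := IsConst.exists_smul_eq_pow (p := p) ⟨N + 1, N.succ_pos, hζN⟩
      refine ⟨σ, (hmem _ _).mpr fun ξ hξ => ?_⟩
      rcases hζ ξ hξ with rfl | ⟨i, rfl⟩
      · rw [smul_zero, zero_pow]
        rw [hq]; exact pow_ne_zero _ (Fact.out : p.Prime).ne_zero
      · rw [smul_pow', hσ, ← pow_mul, ← pow_mul, mul_comm])
    (fun N => (hcl N).isCompact) hcl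
  refine ⟨s, fun ξ ⟨N, hN, e⟩ => ?_⟩
  rw [Set.mem_iInter] at hs
  exact (hmem _ _).mp (hs (N - 1)) ξ (by rwa [Nat.sub_add_cancel hN])

variable {p}

theorem frobenius_pow_smul {s : AbsGal K}
    (hs : ∀ ξ : SepIntegers K, IsConst p ξ → s • ξ = ξ ^ residueCard K)
    {ξ : SepIntegers K} (hξ : IsConst p ξ) (b : ℕ) : s ^ b • ξ = ξ ^ residueCard K ^ b := by
  induction b with
  | zero => simp
  | succ b ih => rw [pow_succ', mul_smul, ih, hs _ (hξ.pow _), ← pow_mul, ← pow_succ]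

/-- A Frobenius element generates the Galois group topologically modulo inertia. -/
theorem eq_top_of_frobenius_mem {s : AbsGal K}
    (hs : ∀ ξ : SepIntegers K, IsConst p ξ → s • ξ = ξ ^ residueCard K)
    {U : Subgroup (AbsGal K)} (hU : IsOpen (U : Set (AbsGal K))) (hsU : s ∈ U)
    (hI : inertia K ≤ U) : U = ⊤ := by
  let C : ℕ → Set (AbsGal K) := fun N =>
    ⋂ ξ ∈ {ξ : SepIntegers K | ξ ^ p ^ (N + 1) = ξ}, {σ | σ • ξ ∈ ({ξ} : Set _)}
  have hmem : ∀ N σ, σ ∈ C N ↔ ∀ ξ : SepIntegers K, ξ ^ p ^ (N + 1) = ξ → σ • ξ = ξ := by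
    intro N σ; simp [C]
  -- The sets `C N` decrease along divisibility to the inertia group, so by compactness one of them
  -- lies in `U`.
  obtain ⟨N, hN⟩ := exists_subset_of_iInter_subset C
    (fun N N' => ⟨(N + 1) * (N' + 1) - 1, by
      have e : (N + 1) * (N' + 1) - 1 + 1 = (N + 1) * (N' + 1) :=
        Nat.sub_add_cancel (by nlinarith)
      constructor
      · intro σ hσ
        rw [hmem, e] at hσ
        exact (hmem _ _).mpr fun ξ hξ => hσ ξ (pow_pow_mul_eq hξ _)
      · intro σ hσ
        rw [hmem, e] at hσ
        refine (hmem _ _).mpr fun ξ hξ => hσ ξ ?_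
        rw [mul_comm]; exact pow_pow_mul_eq hξ _⟩)
    (fun N => isClosed_biInter fun ξ _ => isClosed_setOf_smul_mem _ _) hU
    (fun σ hσ => hI ((mem_inertia_iff_isConst p).mpr fun ξ ⟨N, hN, e⟩ =>
      (hmem (N - 1) σ).mp (Set.mem_iInter.mp hσ (N - 1)) ξ (by rwa [Nat.sub_add_cancel hN])))
  rw [eq_top_iff]
  intro g _
  obtain ⟨ζ, -, hζN, hζ⟩ := exists_generator_const (K := K) p (Nat.succ_pos N)
  have hζc : IsConst p ζ := ⟨N + 1, N.succ_pos, hζN⟩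
  -- On the constants of level `N` the element `g` acts as `s ^ b`, so `g` and `s ^ b` differ by an
  -- element of `C N`.
  obtain ⟨b, hb⟩ := hζc.exists_smul_eq g
  have h1 : ((s ^ b)⁻¹ * g) • ζ = ζ := by
    rw [mul_smul, hb, inv_smul_eq_iff, frobenius_pow_smul hs hζc]
  have h2 : (s ^ b)⁻¹ * g ∈ U := hN ((hmem _ _).mpr fun ξ hξ => by
    rcases hζ ξ hξ with rfl | ⟨i, rfl⟩
    · rw [smul_zero]
    · rw [smul_pow', h1])
  have h3 := U.mul_mem (U.pow_mem hsU b) h2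
  rwa [mul_inv_cancel_left] at h3

end Frobenius

end LocalDeformation

/-! ### Kummer theory and a generator of tame inertia. -/

open ValuativeRel IsLocalRing

namespace LocalDeformation

theorem modEq_of_primitiveRoot_pow_eq {B : Type*} [CommRing B] [IsDomain B] {ζ : B} {k : ℕ}
    (hk : k ≠ 0) (hζ : IsPrimitiveRoot ζ k) {a b : ℕ} (h : ζ ^ a = ζ ^ b) : a ≡ b [MOD k] := by
  wlog hab : a ≤ b generalizing a b
  · exact (this h.symm (by omega)).symm
  have hz : ζ ≠ 0 := hζ.ne_zero hk
  have h2 : ζ ^ a * (ζ ^ (b - a)) = ζ ^ a * 1 := by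
    rw [← pow_add, Nat.add_sub_cancel' hab, mul_one, h]
  have h3 := hζ.dvd_of_pow_eq_one _ (mul_left_cancel₀ (pow_ne_zero a hz) h2)
  exact (Nat.modEq_iff_dvd' hab).mpr h3

theorem not_dvd_pow_sub_one {p f : ℕ} (hp : p.Prime) (hf : 0 < f) : ¬ p ∣ p ^ f - 1 := fun h => by
  have h3 := Nat.dvd_sub (dvd_pow_self p hf.ne') h
  rw [Nat.sub_sub_self (Nat.one_le_pow _ _ hp.pos)] at h3
  exact hp.one_lt.ne' (Nat.dvd_one.mp h3)

/-- Comparing `V * U ^ m` with its image gives `τ V * Θ ^ m = V`, and `τ V ≡ V` with `V` a unit. In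
the application `U` is a uniformizer of a finite level, and `Θ` represents its tame character. -/
theorem pow_sub_one_mem_of_map_eq {B : Type*} [CommRing B] [IsDomain B] [IsLocalRing B]
    (τ : B →+* B) {V Θ U : B} {m : ℕ} (hV : IsUnit V) (hτV : τ V - V ∈ maximalIdeal B)
    (hU : U ≠ 0) (hτU : τ U = Θ * U) (h : τ (V * U ^ m) = V * U ^ m) :
    Θ ^ m - 1 ∈ maximalIdeal B := by
  have h1 : (τ V * Θ ^ m) * U ^ m = V * U ^ m := by
    rw [← h, map_mul, map_pow, hτU]; ring
  have h2 := mul_right_cancel₀ (pow_ne_zero _ hU) h1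
  have h3 : V * (Θ ^ m - 1) = -((τ V - V) * Θ ^ m) := by
    linear_combination h2
  have h4 := (maximalIdeal B).neg_mem (Ideal.mul_mem_right (Θ ^ m) _ hτV)
  rw [← h3] at h4
  exact (Ideal.unit_mul_mem_iff_mem _ hV).mp h4

section Kummer

variable {K : Type v} [Field K] [ValuativeRel K]

theorem exists_root_factor {x y w : SepIntegers K} (hy : y ≠ 0) {e : ℕ} (he : 0 < e)
    (h : x ^ e = w * y ^ e) : ∃ A : SepIntegers K, A ^ e = w ∧ x = A * y := by
  have hy' : y.1 ≠ 0 := fun h0 => hy (Subtype.ext h0)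
  have h' : x.1 ^ e = w.1 * y.1 ^ e := congrArg Subtype.val h
  have h1 : (x.1 / y.1) ^ e = w.1 := by rw [div_pow, h', mul_div_cancel_right₀ _ (pow_ne_zero _ hy')]
  have hint : x.1 / y.1 ∈ SepIntegers K :=
    IsIntegral.of_pow he (by rw [h1]; exact w.2)
  exact ⟨⟨_, hint⟩, Subtype.ext h1, Subtype.ext (div_mul_cancel₀ _ hy').symm⟩

theorem exists_root_ratio {x y : SepIntegers K} (hy : y ≠ 0) {e : ℕ} (he : 0 < e)
    (h : x ^ e = y ^ e) : ∃ A : SepIntegers K, A ^ e = 1 ∧ x = A * y :=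
  exists_root_factor hy he (by rw [one_mul, h])

variable (p : ℕ) [Fact p.Prime] [CharP K p]

theorem exists_pow_eq_sepIntegers (x : SepIntegers K) {e : ℕ} (he : ¬ p ∣ e) :
    ∃ y : SepIntegers K, y ^ e = x := by
  have : CharP (SeparableClosure K) p :=
    charP_of_injective_algebraMap (algebraMap K (SeparableClosure K)).injective p
  have : NeZero (e : SeparableClosure K) :=
    ⟨fun h => he ((CharP.cast_eq_zero_iff (SeparableClosure K) p e).mp h)⟩
  have he0 : 0 < e := Nat.pos_of_ne_zero fun h0 => he (h0 ▸ dvd_zero p)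
  obtain ⟨y, hy⟩ := IsSepClosed.exists_pow_nat_eq x.1 e
  have hint : y ∈ SepIntegers K := IsIntegral.of_pow he0 (by rw [hy]; exact x.2)
  exact ⟨⟨y, hint⟩, Subtype.ext hy⟩

variable [TopologicalSpace K] [IsNonarchimedeanLocalField K]

variable {p}

/-- The action of inertia on an `e`-th root does not depend on the choice of the root. -/
theorem smul_root_eq {σ : AbsGal K} (hσ : σ ∈ inertia K) {e : ℕ} (he : ¬ p ∣ e)
    {ϖ ϖ' A : SepIntegers K} (h0 : ϖ ≠ 0) (h : ϖ' ^ e = ϖ ^ e) (hA : σ • ϖ = A * ϖ) :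
    σ • ϖ' = A * ϖ' := by
  have he0 : 0 < e := Nat.pos_of_ne_zero fun h0 => he (h0 ▸ dvd_zero p)
  -- The two roots differ by an `e`-th root of unity, which is a constant and hence is fixed by
  -- inertia.
  obtain ⟨B, hB, rfl⟩ := exists_root_ratio h0 he0 h
  rw [smul_mul', hA, (mem_inertia_iff_isConst p).mp hσ B (isConst_of_pow_eq_one he hB)]
  ring

theorem algebraMap_sepIntegers_injective :
    Function.Injective (algebraMap 𝒪[K] (SepIntegers K)) := fun x y hxy => by
  have h : algebraMap K (SeparableClosure K) x = algebraMap K (SeparableClosure K) y :=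
    congrArg Subtype.val hxy
  exact Subtype.val_injective ((algebraMap K (SeparableClosure K)).injective h)

theorem exists_algebraMap_eq_of_smul_eq {x : SepIntegers K} (h : ∀ σ : AbsGal K, σ • x = x) :
    ∃ a : 𝒪[K], algebraMap 𝒪[K] (SepIntegers K) a = x := by
  obtain ⟨c, hc⟩ := (InfiniteGalois.mem_range_algebraMap_iff_fixed (k := K) x.1).mpr
    fun σ => congrArg Subtype.val (h σ)
  have hint : IsIntegral 𝒪[K] c := by
    have : IsIntegral 𝒪[K] (algebraMap K (SeparableClosure K) c) := by rw [hc]; exact x.2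
    exact (isIntegral_algebraMap_iff (algebraMap K (SeparableClosure K)).injective).mp this
  obtain ⟨a, ha⟩ := IsIntegrallyClosed.isIntegral_iff.mp hint
  refine ⟨a, Subtype.ext ?_⟩
  rw [← hc, ← ha]
  rfl

variable (p) in
include p in
/-- An element of inertia that fixes an `e`-th root of a uniformizer of `K`, for a suitable `e`
prime to `p`, is wild at the finite level `L`. -/
theorem exists_exponent_mem_lowerRamification_one {π : 𝒪[K]} (hπ : Irreducible π)
    (L : FiniteGaloisIntermediateField K (SeparableClosure K)) :
    ∃ e, ¬ p ∣ e ∧ ∀ σ ∈ inertia K, ∀ ϖ : SepIntegers K,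
      ϖ ^ e = algebraMap 𝒪[K] (SepIntegers K) π → σ • ϖ = ϖ →
      AlgEquiv.restrictNormalHom L σ ∈ lowerRamification K L 1 := by
  obtain ⟨U, hU⟩ := IsDiscreteValuationRing.exists_irreducible (integersOf K L)
  have hincl : integersInclusion L.toIntermediateField (algebraMap 𝒪[K] (integersOf K L) π) =
      algebraMap 𝒪[K] (SepIntegers K) π := rfl
  have hπ0 : algebraMap 𝒪[K] (SepIntegers K) π ≠ 0 := by
    rw [← map_zero (algebraMap 𝒪[K] (SepIntegers K))]
    exact fun h => hπ.ne_zero (algebraMap_sepIntegers_injective h)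
  have hπL : algebraMap 𝒪[K] (integersOf K L) π ≠ 0 := by
    intro h; rw [h, map_zero] at hincl; exact hπ0 hincl.symm
  obtain ⟨E, w, hE⟩ := IsDiscreteValuationRing.eq_unit_mul_pow_irreducible hπL hU
  have hE0 : E ≠ 0 := by
    rintro rfl
    have h1 := algebraMap_integers_mem_maximalIdeal K L
      ((IsLocalRing.mem_maximalIdeal _).mpr hπ.not_isUnit)
    rw [hE, pow_zero, mul_one] at h1
    exact h1 w.isUnit
  -- The exponent `e` is the prime-to-`p` part of the ramification index `E` of `L`.
  obtain ⟨c, e, he, rfl⟩ := Nat.exists_eq_pow_mul_and_not_dvd hE0 p (Fact.out : p.Prime).ne_one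
  have he0 : 0 < e := Nat.pos_of_ne_zero fun h0 => he (h0 ▸ dvd_zero p)
  refine ⟨e, he, fun σ hσ ϖ hϖ hfix => ?_⟩
  obtain ⟨θ, hθ⟩ := exists_smul_uniformizer K hU (AlgEquiv.restrictNormalHom L σ)
  refine mem_lowerRamification_one_of_pow_sub_one_mem K p hU
    (mem_lowerRamification_zero_of_mem_inertia hσ L) hθ (a := c) ?_
  have hθ' := congrArg (integersInclusion L.toIntermediateField) hθ
  rw [integersInclusion_smul, map_mul] at hθ'
  rw [← integersInclusion_mem_maximalIdeal, map_sub, map_pow, map_one]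
  set ι := integersInclusion L.toIntermediateField
  have hU0 : ι U ≠ 0 := fun h =>
    hU.ne_zero (integersInclusion_injective _ (h.trans (map_zero ι).symm))
  have hE' : ϖ ^ e = ι w * ((ι U) ^ p ^ c) ^ e := by
    rw [hϖ, ← hincl, hE, map_mul, map_pow, pow_mul]
  -- Thus `ϖ = V * U ^ p ^ c` with `V` a unit. If `σ` fixes `ϖ`, then `θ ^ p ^ c ≡ 1`, which forces
  -- `σ` to be wild on `L`.
  obtain ⟨V, hVe, hVϖ⟩ := exists_root_factor (pow_ne_zero (p ^ c) hU0) he0 hE'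
  have hVu : IsUnit V := by
    rw [← isUnit_pow_iff he0.ne', hVe]; exact w.isUnit.map ι
  rw [hVϖ] at hfix
  exact pow_sub_one_mem_of_map_eq (MulSemiringAction.toRingHom _ (SepIntegers K) σ) hVu
    (mem_inertia_iff.mp hσ V) hU0 hθ' hfix

/-- A uniformizer of `K` is not a proper power in the maximal unramified extension. -/
theorem eq_one_of_inertia_smul_eq {π : 𝒪[K]} (hπ : Irreducible π) {e' : ℕ} (he' : ¬ p ∣ e')
    {y : SepIntegers K} (hye : y ^ e' = algebraMap 𝒪[K] (SepIntegers K) π)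
    (hyI : ∀ σ ∈ inertia K, σ • y = y) : e' = 1 := by
  have hpp : p.Prime := Fact.out
  have he'0 : 0 < e' := Nat.pos_of_ne_zero fun h0 => he' (h0 ▸ dvd_zero p)
  have hπ0 : algebraMap 𝒪[K] (SepIntegers K) π ≠ 0 := by
    rw [← map_zero (algebraMap 𝒪[K] (SepIntegers K))]
    exact fun h => hπ.ne_zero (algebraMap_sepIntegers_injective h)
  have hy0 : y ≠ 0 := by
    rintro rfl; rw [zero_pow he'0.ne'] at hye; exact hπ0 hye.symm
  obtain ⟨s, hs⟩ := exists_frobenius K p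
  obtain ⟨f, hf, hq⟩ := exists_residueCard_eq K p
  have hq1 : 1 ≤ residueCard K := by rw [hq]; exact Nat.one_le_pow _ _ hpp.pos
  obtain ⟨B, hB, hsy⟩ := exists_root_ratio (x := s • y) hy0 he'0 (by
    rw [← smul_pow', hye, smul_algebraMap_integers])
  have hqd : ¬ p ∣ residueCard K - 1 := by rw [hq]; exact not_dvd_pow_sub_one hpp hf
  -- Here `B ^ (e' - 1) = B⁻¹`. Since `s` raises the constant `lam` to the power `q` and multiplies
  -- `y` by `B`, the product `lam * y` is fixed by `s`.
  obtain ⟨lam, hlam⟩ := exists_pow_eq_sepIntegers p (B ^ (e' - 1)) hqd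
  have hlam1 : lam ^ ((residueCard K - 1) * e') = 1 := by
    rw [pow_mul, hlam, ← pow_mul, mul_comm, pow_mul, hB, one_pow]
  have hlamc : IsConst p lam := isConst_of_pow_eq_one
    (fun h => (hpp.dvd_mul.mp h).elim hqd he') hlam1
  have hlam0 : lam ≠ 0 := by
    rintro rfl
    have hpos : (residueCard K - 1) * e' ≠ 0 := fun h => by
      rcases Nat.mul_eq_zero.mp h with h | h
      · exact hqd (h ▸ dvd_zero p)
      · omega
    rw [zero_pow hpos] at hlam1
    exact zero_ne_one hlam1
  set y' := lam * y with hy'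
  have hsy' : s • y' = y' := by
    have h1 : lam ^ residueCard K * B = lam := by
      conv_lhs => rw [← Nat.sub_add_cancel hq1, pow_succ, hlam]
      rw [mul_right_comm, ← pow_succ, Nat.sub_add_cancel he'0, hB, one_mul]
    rw [hy', smul_mul', hs lam hlamc, hsy, ← mul_assoc, h1]
  have hIy' : ∀ σ ∈ inertia K, σ • y' = y' := fun σ hσ => by
    rw [hy', smul_mul', hyI σ hσ, (mem_inertia_iff_isConst p).mp hσ lam hlamc]
  -- The stabilizer of `y'` is open and contains Frobenius and inertia, so `y'` descends to `𝒪[K]`.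
  have htop := eq_top_of_frobenius_mem hs (U := MulAction.stabilizer (AbsGal K) y')
    (isOpen_setOf_smul_mem y' {y'}) hsy' hIy'
  have hfix : ∀ σ : AbsGal K, σ • y' = y' := fun σ => by
    have : σ ∈ MulAction.stabilizer (AbsGal K) y' := by rw [htop]; exact Subgroup.mem_top σ
    exact this
  have hcπ : y' ^ e' = lam ^ e' * algebraMap 𝒪[K] (SepIntegers K) π := by
    rw [hy', mul_pow, hye]
  obtain ⟨a, ha⟩ := exists_algebraMap_eq_of_smul_eq hfix
  obtain ⟨b, hb⟩ := exists_algebraMap_eq_of_smul_eq (x := lam ^ e') fun σ => by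
    have h1 := congrArg (fun z => σ • z) hcπ
    simp only [smul_pow', smul_mul', hfix, smul_algebraMap_integers] at h1
    rw [hcπ] at h1
    rw [smul_pow']
    exact (mul_right_cancel₀ hπ0 h1).symm
  have hbu : IsUnit b := by
    by_contra hnb
    have h1 : algebraMap 𝒪[K] (SepIntegers K) b ∈ maximalIdeal (SepIntegers K) :=
      algebraMap_integers_mem_maximalIdeal K (SeparableClosure K)
        ((IsLocalRing.mem_maximalIdeal b).mpr hnb)
    rw [hb] at h1
    have h2 : IsUnit (lam ^ e') := by
      refine IsUnit.of_mul_eq_one (lam ^ ((residueCard K - 1) * e' * e' - e')) ?_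
      have hpos : 1 ≤ (residueCard K - 1) * e' := Nat.one_le_iff_ne_zero.mpr fun h => by
        rcases Nat.mul_eq_zero.mp h with h | h
        · exact hqd (h ▸ dvd_zero p)
        · omega
      rw [← pow_add, Nat.add_sub_cancel' (by nlinarith), pow_mul, hlam1, one_pow]
    exact h1 h2
  have hab : a ^ e' = b * π := algebraMap_sepIntegers_injective (by
    rw [map_pow, map_mul, ha, hb, hcπ])
  -- Up to a unit, the uniformizer is now the `e'`-th power of an element of `𝒪[K]`; an irreducible
  -- element is not a proper power.
  by_contra hne
  obtain ⟨bu, rfl⟩ := hbu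
  have hirr : Irreducible (a ^ e') := by
    rw [hab]; exact (irreducible_units_mul bu).mpr hπ
  exact not_irreducible_pow hne hirr

/-- Ramified Kummer extensions: inertia acts on the `e`-th roots of a uniformizer through all
`e`-th roots of unity. -/
theorem exists_inertia_smul_root {π : 𝒪[K]} (hπ : Irreducible π) {e : ℕ} (he : ¬ p ∣ e)
    {ϖ : SepIntegers K} (hϖ : ϖ ^ e = algebraMap 𝒪[K] (SepIntegers K) π) :
    ∃ σ ∈ inertia K, ∃ A, IsPrimitiveRoot A e ∧ σ • ϖ = A * ϖ := by
  have hpp : p.Prime := Fact.out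
  have he0 : 0 < e := Nat.pos_of_ne_zero fun h0 => he (h0 ▸ dvd_zero p)
  have hπ0 : algebraMap 𝒪[K] (SepIntegers K) π ≠ 0 := by
    rw [← map_zero (algebraMap 𝒪[K] (SepIntegers K))]
    exact fun h => hπ.ne_zero (algebraMap_sepIntegers_injective h)
  have hϖ0 : ϖ ≠ 0 := by
    rintro rfl; rw [zero_pow he0.ne'] at hϖ; exact hπ0 hϖ.symm
  have hroot : ∀ σ : AbsGal K, (σ • ϖ) ^ e = ϖ ^ e := fun σ => by
    rw [← smul_pow', hϖ, smul_algebraMap_integers]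
  have hfixroot : ∀ σ ∈ inertia K, ∀ A : SepIntegers K, A ^ e = 1 → σ • A = A := fun σ hσ A hA =>
    (mem_inertia_iff_isConst p).mp hσ A (isConst_of_pow_eq_one he hA)
  -- `H` is the image of inertia in the `e`-th roots of unity. It is a group because inertia fixes
  -- these roots, and it is cyclic of some order `d` dividing `e`.
  let H : Subgroup (SepIntegers K)ˣ :=
    { carrier := {A | A ^ e = 1 ∧ ∃ σ ∈ inertia K, σ • ϖ = A * ϖ}
      one_mem' := ⟨one_pow e, 1, one_mem _, by simp⟩
      mul_mem' := by
        rintro A B ⟨hA, σ, hσ, h⟩ ⟨hB, τ, hτ, h'⟩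
        refine ⟨by rw [mul_pow, hA, hB, one_mul], σ * τ, mul_mem hσ hτ, ?_⟩
        rw [mul_smul, h', smul_mul', h, hfixroot σ hσ B (by rw [← Units.val_pow_eq_pow_val, hB, Units.val_one])]
        push_cast; ring
      inv_mem' := by
        rintro A ⟨hA, σ, hσ, h⟩
        refine ⟨by rw [inv_pow, hA, inv_one], σ⁻¹, inv_mem hσ, ?_⟩
        have hA' : A⁻¹ ^ e = 1 := by rw [inv_pow, hA, inv_one]
        rw [inv_smul_eq_iff, smul_mul', h, hfixroot σ hσ _
          (by rw [← Units.val_pow_eq_pow_val, hA', Units.val_one]),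
          ← mul_assoc, ← Units.val_mul, inv_mul_cancel, Units.val_one, one_mul] }
  have hHle : H ≤ rootsOfUnity e (SepIntegers K) := fun A hA => hA.1
  have : NeZero e := ⟨he0.ne'⟩
  have : Finite H := Finite.of_injective _ (Subgroup.inclusion_injective hHle)
  have hcyc : IsCyclic H := inferInstance
  obtain ⟨g, hg⟩ := IsCyclic.exists_ofOrder_eq_natCard (α := H)
  set d := Nat.card H with hd
  have hgd : IsPrimitiveRoot (g : (SepIntegers K)ˣ).1 d := by
    have h1 := IsPrimitiveRoot.orderOf (g : (SepIntegers K)ˣ).1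
    rwa [orderOf_units, Subgroup.orderOf_coe, hg] at h1
  have hde : d ∣ e := by
    rw [← hg, orderOf_dvd_iff_pow_eq_one]
    exact Subtype.ext g.2.1
  have hHd : ∀ A ∈ H, A ^ d = 1 := fun A hA => by
    have := pow_card_eq_one' (x := (⟨A, hA⟩ : H))
    exact congrArg Subtype.val this
  obtain ⟨e', hee⟩ := hde
  -- Inertia fixes `ϖ ^ d`, which is an `e'`-th root of the uniformizer, where `e = d * e'`.
  have h : e' = 1 := by
    have he' : ¬ p ∣ e' := fun h => he (hee ▸ h.mul_left d)
    have hye : (ϖ ^ d) ^ e' = algebraMap 𝒪[K] (SepIntegers K) π := by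
      rw [← pow_mul, ← hee, hϖ]
    refine eq_one_of_inertia_smul_eq hπ he' hye fun σ hσ => ?_
    obtain ⟨A, hA, hA'⟩ := exists_root_ratio hϖ0 he0 (hroot σ)
    let Au : (SepIntegers K)ˣ := Units.ofPowEqOne A _ hA he0.ne'
    have hAH : Au ∈ H := ⟨Units.ext hA, σ, hσ, hA'⟩
    have hAd : A ^ d = 1 := congrArg Units.val (hHd Au hAH)
    rw [smul_pow', hA', mul_pow, hAd, one_mul]
  obtain ⟨-, σ, hσ, h2⟩ := g.2
  exact ⟨σ, hσ, _, by rw [hee, h, mul_one]; exact hgd, h2⟩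

variable (p) in
include p in
theorem isClosed_inertia : IsClosed (inertia K : Set (AbsGal K)) := by
  have : (inertia K : Set (AbsGal K)) =
      ⋂ ξ ∈ {ξ : SepIntegers K | IsConst p ξ}, {σ | σ • ξ ∈ ({ξ} : Set _)} := by
    ext σ
    rw [SetLike.mem_coe, mem_inertia_iff_isConst p]
    simp
  rw [this]
  exact isClosed_biInter fun ξ _ => isClosed_setOf_smul_mem _ _

variable (p) in
include p in
/-- Existence of a topological generator of tame inertia. -/
theorem exists_tame_generator {π : 𝒪[K]} (hπ : Irreducible π) :
    ∃ t ∈ inertia K, ∀ e, ¬ p ∣ e → ∀ ϖ : SepIntegers K,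
      ϖ ^ e = algebraMap 𝒪[K] (SepIntegers K) π →
      ∃ A, IsPrimitiveRoot A e ∧ t • ϖ = A * ϖ := by
  have hpp : p.Prime := Fact.out
  have hπ0 : algebraMap 𝒪[K] (SepIntegers K) π ≠ 0 := by
    rw [← map_zero (algebraMap 𝒪[K] (SepIntegers K))]
    exact fun h => hπ.ne_zero (algebraMap_sepIntegers_injective h)
  have hne0 : ∀ e, ¬ p ∣ e → ∀ ϖ : SepIntegers K,
      ϖ ^ e = algebraMap 𝒪[K] (SepIntegers K) π → ϖ ≠ 0 := by
    rintro e he ϖ hϖ rfl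
    rw [zero_pow (fun h0 : e = 0 => he (h0 ▸ dvd_zero p))] at hϖ
    exact hπ0 hϖ.symm
  choose ϖ hϖ using fun e : {e // ¬ p ∣ e} =>
    exists_pow_eq_sepIntegers p (algebraMap 𝒪[K] (SepIntegers K) π) e.2
  -- A tame generator is a common element of these closed sets: `C e` requires a primitive `e`-th
  -- root of unity as the action on one chosen `e`-th root of the uniformizer.
  let C : {e // ¬ p ∣ e} → Set (AbsGal K) := fun e =>
    (inertia K : Set (AbsGal K)) ∩ {σ | σ • ϖ e ∈ {z | ∃ A, IsPrimitiveRoot A e.1 ∧ z = A * ϖ e}}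
  have hcl : ∀ e, IsClosed (C e) := fun e =>
    (isClosed_inertia p).inter (isClosed_setOf_smul_mem _ _)
  -- The chosen roots need not be compatible, but `ϖ_(e m) ^ m` is another `e`-th root, and inertia
  -- acts in the same way on all of them.
  have key : ∀ (e : {e // ¬ p ∣ e}) (m : ℕ) (hm : ¬ p ∣ e.1 * m), C ⟨e.1 * m, hm⟩ ⊆ C e := by
    rintro e m hm σ ⟨hσ, A, hA, h⟩
    have hem0 : 0 < e.1 * m := Nat.pos_of_ne_zero fun h0 => hm (h0 ▸ dvd_zero p)
    refine ⟨hσ, A ^ m, hA.pow hem0 (mul_comm _ _), ?_⟩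
    have h1 : σ • (ϖ ⟨e.1 * m, hm⟩) ^ m = A ^ m * (ϖ ⟨e.1 * m, hm⟩) ^ m := by
      rw [smul_pow', h, mul_pow]
    refine smul_root_eq (e := e.1) hσ e.2 (pow_ne_zero m (hne0 _ hm _ (hϖ _))) ?_ h1
    rw [hϖ e, ← pow_mul, mul_comm m, hϖ ⟨e.1 * m, hm⟩]
  have hone : ¬ p ∣ 1 := fun h => hpp.one_lt.ne' (Nat.dvd_one.mp h)
  have : Nonempty {e // ¬ p ∣ e} := ⟨⟨1, hone⟩⟩
  obtain ⟨t, ht⟩ := IsCompact.nonempty_iInter_of_directed_nonempty_isCompact_isClosed C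
    (fun e e' => by
      have hm : ¬ p ∣ e.1 * e'.1 := fun h => (hpp.dvd_mul.mp h).elim e.2 e'.2
      refine ⟨⟨e.1 * e'.1, hm⟩, key e e'.1 hm, ?_⟩
      have hm' : ¬ p ∣ e'.1 * e.1 := by rwa [mul_comm]
      have e2 : (⟨e.1 * e'.1, hm⟩ : {e // ¬ p ∣ e}) = ⟨e'.1 * e.1, hm'⟩ :=
        Subtype.ext (mul_comm _ _)
      rw [e2]
      exact key e' e.1 hm')
    (fun e => by
      obtain ⟨σ, hσ, A, hA, h⟩ := exists_inertia_smul_root hπ e.2 (hϖ e)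
      exact ⟨σ, hσ, A, hA, h⟩)
    (fun e => (hcl e).isCompact) hcl
  rw [Set.mem_iInter] at ht
  refine ⟨t, (ht ⟨1, hone⟩).1, fun e he ϖ' hϖ' => ?_⟩
  obtain ⟨ht1, A, hA, h⟩ := ht ⟨e, he⟩
  exact ⟨A, hA, smul_root_eq ht1 he (hne0 _ he _ (hϖ _)) (by rw [hϖ', hϖ]) h⟩

end Kummer

end LocalDeformation

/-! ### Generators and relation of the Galois group modulo wild inertia. -/

open ValuativeRel IsLocalRing

namespace LocalDeformation

universe w

/-- Topological generators `s`, `t` of `G` modulo the wild inertia group `P`, where `t` generates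
the tame inertia `I / P`, subject to the only relation `s t s⁻¹ = t ^ q`. -/
structure TameGenerators (p : ℕ) {G : Type v} [Group G] [TopologicalSpace G] (I P : Subgroup G)
    (q : ℕ) (s t : G) : Prop where
  wild_le : P ≤ I
  mem_inertia : t ∈ I
  inertia_le : ∀ U : Subgroup G, IsOpen (U : Set G) → t ∈ U → P ≤ U → I ≤ U
  eq_top : ∀ U : Subgroup G, IsOpen (U : Set G) → s ∈ U → I ≤ U → U = ⊤
  exists_pow_mem : ∀ U : Subgroup G, IsOpen (U : Set G) → P ≤ U → ∃ j, ¬ p ∣ j ∧ t ^ j ∈ U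
  relation : s * t * s⁻¹ * (t ^ q)⁻¹ ∈ P
  wild_pow : ∀ σ ∈ P, ∀ U : Subgroup G, IsOpen (U : Set G) → ∃ a, σ ^ p ^ a ∈ U
  exists_hom : ∀ (H : Type w) [Group H] [Finite H] (S T : H), S * T * S⁻¹ = T ^ q →
    (∃ j, ¬ p ∣ j ∧ T ^ j = 1) →
    ∃ ψ : G →* H, IsOpen (ψ.ker : Set G) ∧ ψ s = S ∧ ψ t = T ∧ P ≤ ψ.ker

section

variable {K : Type v} [Field K] [ValuativeRel K] [TopologicalSpace K]
  [IsNonarchimedeanLocalField K]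

theorem mem_wildInertia_iff {σ : AbsGal K} : σ ∈ wildInertia K ↔
    ∀ L : FiniteGaloisIntermediateField K (SeparableClosure K),
      AlgEquiv.restrictNormalHom L σ ∈ lowerRamification K L 1 := by
  simp only [wildInertia, Subgroup.mem_iInf, Subgroup.mem_comap]

theorem restrictNormalHom_pow_eq_one_of_le {L L' : FiniteGaloisIntermediateField K
    (SeparableClosure K)} (h : L ≤ L') {σ : AbsGal K} {k : ℕ}
    (hσ : AlgEquiv.restrictNormalHom L' σ ^ k = 1) : AlgEquiv.restrictNormalHom L σ ^ k = 1 := by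
  rw [← map_pow, ← FiniteGaloisIntermediateField.mem_fixingSubgroup_iff] at hσ ⊢
  exact IntermediateField.fixingSubgroup_antitone h hσ

variable (p : ℕ) [Fact p.Prime] [CharP K p]

include p in
/-- Every open set that contains the wild inertia group contains its analogue at a finite level. -/
theorem exists_finite_level_subset {U : Set (AbsGal K)} (hU : IsOpen U)
    (h : (wildInertia K : Set (AbsGal K)) ⊆ U) :
    ∃ L : FiniteGaloisIntermediateField K (SeparableClosure K), ∀ σ ∈ inertia K,
      AlgEquiv.restrictNormalHom L σ ∈ lowerRamification K L 1 → σ ∈ U := by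
  let Z : FiniteGaloisIntermediateField K (SeparableClosure K) → Set (AbsGal K) := fun L =>
    (inertia K : Set (AbsGal K)) ∩
      (AlgEquiv.restrictNormalHom L) ⁻¹' (lowerRamification K L 1 : Set (L ≃ₐ[K] L))
  -- Within inertia, being wild at a finite level means having `p`-power order there, and this
  -- passes to smaller fields.
  have hmono : ∀ L L' : FiniteGaloisIntermediateField K (SeparableClosure K), L ≤ L' →
      Z L' ⊆ Z L := by
    rintro L L' hLL' σ ⟨hσ, hσ1⟩
    obtain ⟨a, ha⟩ := exists_pow_eq_one_of_mem_lowerRamification_one K L' p hσ1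
    exact ⟨hσ, mem_lowerRamification_one_of_pow_eq_one K p
      (mem_lowerRamification_zero_of_mem_inertia hσ L)
      (restrictNormalHom_pow_eq_one_of_le hLL' ha)⟩
  obtain ⟨L, hL⟩ := exists_subset_of_iInter_subset Z
    (fun L L' => ⟨L ⊔ L', hmono _ _ le_sup_left, hmono _ _ le_sup_right⟩)
    (fun L => (isClosed_inertia p).inter
      ((isClosed_discrete _).preimage
        (InfiniteGalois.restrictNormalHom_continuous L.toIntermediateField)))
    hU (fun σ hσ => h (mem_wildInertia_iff.mpr fun L => (Set.mem_iInter.mp hσ L).2))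
  exact ⟨L, fun σ hσ hσ1 => hL ⟨hσ, hσ1⟩⟩

theorem exists_pow_mem_of_mem_wildInertia {σ : AbsGal K} (hσ : σ ∈ wildInertia K)
    {U : Subgroup (AbsGal K)} (hU : IsOpen (U : Set (AbsGal K))) : ∃ a, σ ^ p ^ a ∈ U := by
  obtain ⟨L, hL⟩ := (InfiniteGalois.krullTopology_mem_nhds_one_iff_of_isGalois
    (U : Set (AbsGal K))).mp (hU.mem_nhds (one_mem U))
  obtain ⟨a, ha⟩ := exists_pow_eq_one_of_mem_lowerRamification_one K L p
    (mem_wildInertia_iff.mp hσ L)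
  refine ⟨a, hL ?_⟩
  rw [← map_pow, ← FiniteGaloisIntermediateField.mem_fixingSubgroup_iff] at ha
  exact ha

theorem exists_pow_residueCard_pow_eq {ζ : SepIntegers K} (hζ : IsConst p ζ) :
    ∃ N, 0 < N ∧ ∀ k, ζ ^ residueCard K ^ (N * k) = ζ := by
  obtain ⟨f, hf, hq⟩ := exists_residueCard_eq K p
  obtain ⟨N, hN, e⟩ := hζ
  refine ⟨N, hN, fun k => ?_⟩
  rw [hq, ← pow_mul, show f * (N * k) = N * (k * f) by ring]
  exact pow_pow_mul_eq e _

theorem semidirect_pow {H : Type*} [Group H] {S T : H} {q : ℕ} (h : S * T * S⁻¹ = T ^ q)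
    (b a : ℕ) : S ^ b * T ^ a = T ^ (q ^ b * a) * S ^ b := by
  have h1 : ∀ a, S * T ^ a = T ^ (q * a) * S := by
    intro a
    rw [pow_mul, ← h, conj_pow]
    group
  induction b generalizing a with
  | zero => simp
  | succ b ih =>
    rw [pow_succ, mul_assoc, h1, ← mul_assoc, ih, mul_assoc, pow_succ q, mul_assoc (q ^ b)]

/-- Two such powers differ by less than the modulus. This recovers the exponent of Frobenius modulo
`N` from its action on a primitive root of unity of order `q ^ N - 1`. -/
theorem pow_modEq_inj {q N : ℕ} (hq : 1 < q) {x y : ℕ} (hx : x < N) (hy : y < N)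
    (h : q ^ x ≡ q ^ y [MOD q ^ N - 1]) : x = y := by
  wlog hxy : x ≤ y generalizing x y
  · exact (this hy hx h.symm (by omega)).symm
  by_contra hne
  have hlt : q ^ x < q ^ y := Nat.pow_lt_pow_right hq (by omega)
  have hdvd := (Nat.modEq_iff_dvd' hlt.le).mp h
  have h1 : q ^ y < q ^ N := Nat.pow_lt_pow_right hq hy
  have h2 := Nat.le_of_dvd (by omega) hdvd
  have h3 : 0 < q ^ x := Nat.pow_pos (by omega)
  omega

set_option maxHeartbeats 800000 in
/-- Construction of homomorphisms from the Galois group to finite groups. -/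
theorem exists_tame_hom {π : 𝒪[K]} (hπ : Irreducible π) {s t : AbsGal K}
    (hs : ∀ ξ : SepIntegers K, IsConst p ξ → s • ξ = ξ ^ residueCard K) (htI : t ∈ inertia K)
    (ht : ∀ e, ¬ p ∣ e → ∀ ϖ : SepIntegers K, ϖ ^ e = algebraMap 𝒪[K] (SepIntegers K) π →
      ∃ A, IsPrimitiveRoot A e ∧ t • ϖ = A * ϖ)
    {H : Type w} [Group H] [Finite H] {S T : H} (hST : S * T * S⁻¹ = T ^ residueCard K)
    {e : ℕ} (he : ¬ p ∣ e) (hT : T ^ e = 1) :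
    ∃ ψ : AbsGal K →* H, IsOpen (ψ.ker : Set (AbsGal K)) ∧ ψ s = S ∧ ψ t = T ∧
      wildInertia K ≤ ψ.ker := by
  have hpp : p.Prime := Fact.out
  have he0 : 0 < e := Nat.pos_of_ne_zero fun h0 => he (h0 ▸ dvd_zero p)
  have : NeZero e := ⟨he0.ne'⟩
  obtain ⟨f, hf, hq⟩ := exists_residueCard_eq K p
  have hq1 : 1 < residueCard K := by rw [hq]; exact Nat.one_lt_pow hf.ne' hpp.one_lt
  have hqd : ¬ p ∣ residueCard K - 1 := by rw [hq]; exact not_dvd_pow_sub_one hpp hf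
  have hfixI : ∀ σ ∈ inertia K, ∀ ξ : SepIntegers K, IsConst p ξ → σ • ξ = ξ :=
    fun σ hσ => (mem_inertia_iff_isConst p).mp hσ
  have hπ0 : algebraMap 𝒪[K] (SepIntegers K) π ≠ 0 := by
    rw [← map_zero (algebraMap 𝒪[K] (SepIntegers K))]
    exact fun h => hπ.ne_zero (algebraMap_sepIntegers_injective h)
  obtain ⟨ϖ₀, hϖ₀⟩ := exists_pow_eq_sepIntegers p (algebraMap 𝒪[K] (SepIntegers K) π) he
  have hϖ₀0 : ϖ₀ ≠ 0 := by
    rintro rfl; rw [zero_pow he0.ne'] at hϖ₀; exact hπ0 hϖ₀.symm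
  obtain ⟨ζ, hζ, htϖ₀⟩ := ht e he ϖ₀ hϖ₀
  have hζc : IsConst p ζ := isConst_of_pow_eq_one he hζ.pow_eq_one
  -- an `e`-th root of a uniformizer that is fixed by the Frobenius element
  obtain ⟨B, hB, hsB⟩ := exists_root_ratio (K := K) (x := s • ϖ₀) hϖ₀0 he0 (by
    rw [← smul_pow', hϖ₀, smul_algebraMap_integers])
  obtain ⟨lam, hlam⟩ := exists_pow_eq_sepIntegers p (B ^ (e - 1)) hqd
  have hlam1 : lam ^ ((residueCard K - 1) * e) = 1 := by
    rw [pow_mul, hlam, ← pow_mul, mul_comm, pow_mul, hB, one_pow]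
  have hlamc : IsConst p lam := isConst_of_pow_eq_one
    (fun h => (hpp.dvd_mul.mp h).elim hqd he) hlam1
  have hlam0 : lam ≠ 0 := by
    rintro rfl
    have hpos : (residueCard K - 1) * e ≠ 0 := Nat.mul_ne_zero (by omega) he0.ne'
    rw [zero_pow hpos] at hlam1
    exact zero_ne_one hlam1
  obtain ⟨ϖ, hϖ⟩ : ∃ ϖ, ϖ = lam * ϖ₀ := ⟨_, rfl⟩
  have hϖ0 : ϖ ≠ 0 := by rw [hϖ]; exact mul_ne_zero hlam0 hϖ₀0
  have hsϖ : s • ϖ = ϖ := by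
    have h1 : lam ^ residueCard K * B = lam := by
      conv_lhs => rw [← Nat.sub_add_cancel hq1.le, pow_succ, hlam]
      rw [mul_right_comm, ← pow_succ, Nat.sub_add_cancel he0, hB, one_mul]
    rw [hϖ, smul_mul', hs lam hlamc, hsB, ← mul_assoc, h1]
  have htϖ : t • ϖ = ζ * ϖ := by
    rw [hϖ, smul_mul', hfixI t htI lam hlamc, htϖ₀]; ring
  -- `ϖ` is a root of `lam ^ e * π` rather than of the uniformizer itself. The factor `lam ^ e` is a
  -- root of unity of order dividing `q - 1`, hence Galois invariant, and conjugates of `ϖ` still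
  -- differ by `e`-th roots of unity.
  have hlame : (lam ^ e) ^ residueCard K = lam ^ e := by
    conv_lhs => rw [← Nat.sub_add_cancel hq1.le, pow_succ, ← pow_mul, mul_comm e, hlam1, one_mul]
  have hϖe : ∀ σ : AbsGal K, (σ • ϖ) ^ e = ϖ ^ e := fun σ => by
    rw [← smul_pow', hϖ, mul_pow, hϖ₀, smul_mul', smul_algebraMap_integers,
      smul_eq_of_pow_residueCard p hlame]
  -- the constants on which the Frobenius element has order `N`
  obtain ⟨N₀, hN₀, hζN⟩ := exists_pow_residueCard_pow_eq p hζc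
  -- The factor `N₀` makes `ζ` a power of the constant `ξ` below; the order of `H` ensures `S ^ N =
  -- 1`.
  obtain ⟨N, hN⟩ : ∃ N, N = N₀ * Nat.card H := ⟨_, rfl⟩
  have hNpos : 0 < N := hN ▸ Nat.mul_pos hN₀ Nat.card_pos
  have hSN : S ^ N = 1 := by rw [hN, mul_comm, pow_mul, pow_card_eq_one', one_pow]
  obtain ⟨ξ, hξ, hξN, hξgen⟩ := exists_generator_const (K := K) p (Nat.mul_pos hf hNpos)
  rw [pow_mul, ← hq] at hξ hξN
  have hξc : IsConst p ξ := ⟨f * N, Nat.mul_pos hf hNpos, by rw [pow_mul, ← hq, hξN]⟩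
  have hn0 : residueCard K ^ N - 1 ≠ 0 := by
    have := Nat.one_lt_pow hNpos.ne' hq1
    omega
  obtain ⟨i, hi⟩ : ∃ i, ζ = ξ ^ i := by
    refine (hξgen ζ ?_).resolve_left (hζ.ne_zero he0.ne')
    rw [pow_mul, ← hq, hN]; exact hζN _
  have hex : ∀ σ : AbsGal K, ∃ ab : ℕ × ℕ, σ • ϖ = ζ ^ ab.1 * ϖ ∧
      σ • ξ = ξ ^ residueCard K ^ ab.2 := by
    intro σ
    obtain ⟨A, hA, hA'⟩ := exists_root_ratio hϖ0 he0 (hϖe σ)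
    obtain ⟨a, -, rfl⟩ := hζ.eq_pow_of_pow_eq_one hA
    obtain ⟨b, hb⟩ := hξc.exists_smul_eq σ
    exact ⟨(a, b), hA', hb⟩
  choose ab hab1 hab2 using hex
  have hTmod : ∀ a a', ζ ^ a = ζ ^ a' → T ^ a = T ^ a' := fun a a' h => by
    rw [pow_eq_pow_iff_modEq]
    exact (modEq_of_primitiveRoot_pow_eq he0.ne' hζ h).of_dvd (orderOf_dvd_of_pow_eq_one hT)
  have hξmod : ∀ b, ξ ^ residueCard K ^ b = ξ ^ residueCard K ^ (b % N) := by
    intro b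
    have hk : ∀ k, ξ ^ residueCard K ^ (N * k) = ξ := by
      intro k
      induction k with
      | zero => simp
      | succ k ih => rw [mul_add, mul_one, pow_add, pow_mul, ih, hξN]
    conv_lhs => rw [← Nat.div_add_mod b N, pow_add, pow_mul, hk]
  have hSmod : ∀ b b', ξ ^ residueCard K ^ b = ξ ^ residueCard K ^ b' → S ^ b = S ^ b' := by
    intro b b' h
    rw [hξmod b, hξmod b'] at h
    have h1 := pow_modEq_inj hq1 (Nat.mod_lt b hNpos) (Nat.mod_lt b' hNpos)
      (modEq_of_primitiveRoot_pow_eq hn0 hξ h)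
    rw [pow_eq_pow_iff_modEq]
    exact Nat.ModEq.of_dvd (orderOf_dvd_of_pow_eq_one hSN) h1
  have hval : ∀ (σ : AbsGal K) a b, σ • ϖ = ζ ^ a * ϖ → σ • ξ = ξ ^ residueCard K ^ b →
      T ^ (ab σ).1 * S ^ (ab σ).2 = T ^ a * S ^ b := by
    intro σ a b ha hb
    rw [hTmod _ a (mul_right_cancel₀ hϖ0 ((hab1 σ).symm.trans ha)),
      hSmod _ b ((hab2 σ).symm.trans hb)]
  -- An automorphism with `σ ϖ = ζ ^ a ϖ` and `σ ξ = ξ ^ q ^ b` goes to `T ^ a * S ^ b`. Only these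
  -- two values matter, and since `σ ζ = ζ ^ q ^ b`, composition obeys the law that `S T S⁻¹ = T ^
  -- q` imposes in `H`.
  let ψ : AbsGal K →* H := MonoidHom.mk' (fun σ => T ^ (ab σ).1 * S ^ (ab σ).2) (by
    intro σ τ
    have h2 : (σ * τ) • ξ = ξ ^ residueCard K ^ ((ab σ).2 + (ab τ).2) := by
      rw [mul_smul, hab2 τ, smul_pow', hab2 σ, ← pow_mul, pow_add]
    have h1 : (σ * τ) • ϖ =
        ζ ^ ((ab σ).1 + residueCard K ^ (ab σ).2 * (ab τ).1) * ϖ := by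
      have h3 : σ • ζ = ζ ^ residueCard K ^ (ab σ).2 := by
        rw [hi, smul_pow', hab2 σ, ← pow_mul, ← pow_mul, mul_comm]
      rw [mul_smul, hab1 τ, smul_mul', smul_pow', h3, hab1 σ, pow_add, pow_mul]; ring
    rw [hval (σ * τ) _ _ h1 h2, pow_add, pow_add, mul_assoc, ← mul_assoc _ (S ^ (ab σ).2),
      ← semidirect_pow hST]
    group)
  have hψ : ∀ (σ : AbsGal K) a b, σ • ϖ = ζ ^ a * ϖ → σ • ξ = ξ ^ residueCard K ^ b →
      ψ σ = T ^ a * S ^ b := hval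
  have hker : IsOpen (ψ.ker : Set (AbsGal K)) := by
    have hle : MulAction.stabilizer (AbsGal K) ϖ ⊓ MulAction.stabilizer (AbsGal K) ξ ≤ ψ.ker := by
      rintro σ ⟨h1, h2⟩
      rw [MonoidHom.mem_ker, hψ σ 0 0 (by rw [pow_zero, one_mul]; exact h1)
        (by rw [pow_zero, pow_one]; exact h2), pow_zero, pow_zero, one_mul]
    exact Subgroup.isOpen_mono hle
      ((isOpen_setOf_smul_mem ϖ {ϖ}).inter (isOpen_setOf_smul_mem ξ {ξ}))
  refine ⟨ψ, hker, ?_, ?_, fun σ hσ => ?_⟩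
  · rw [hψ s 0 1 (by rw [hsϖ, pow_zero, one_mul]) (by rw [hs ξ hξc, pow_one]), pow_zero, pow_one,
      one_mul]
  · rw [hψ t 1 0 (by rw [htϖ, pow_one]) (by rw [hfixI t htI ξ hξc, pow_zero, pow_one]), pow_zero,
      pow_one, mul_one]
  · obtain ⟨a, ha⟩ := exists_pow_mem_of_mem_wildInertia p hσ hker
    rw [MonoidHom.mem_ker, map_pow] at ha
    have h1 := hψ σ _ 0 (hab1 σ) (by
      rw [hfixI σ (wildInertia_le_inertia hσ) ξ hξc, pow_zero, pow_one])
    rw [pow_zero, mul_one] at h1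
    -- The image of a wild element is a power of `T`, of order prime to `p`, and also has `p`-power
    -- order.
    have h2 : ψ σ ^ e = 1 := by rw [h1, ← pow_mul, mul_comm, pow_mul, hT, one_pow]
    have h3 := pow_gcd_eq_one.mpr ⟨ha, h2⟩
    have h4 : Nat.gcd (p ^ a) e = 1 :=
      Nat.Coprime.pow_left a ((Nat.Prime.coprime_iff_not_dvd hpp).mpr he)
    rw [h4, pow_one] at h3
    exact h3

variable (K) in
/-- The structure of the tame quotient of the absolute Galois group of a local field. -/
theorem exists_tameGenerators : ∃ (q : ℕ) (s t : AbsGal K), (∃ f, 0 < f ∧ q = p ^ f) ∧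
    TameGenerators.{v, w} p (inertia K) (wildInertia K) q s t := by
  have hpp : p.Prime := Fact.out
  obtain ⟨π, hπ⟩ := IsDiscreteValuationRing.exists_irreducible 𝒪[K]
  have hπ0 : algebraMap 𝒪[K] (SepIntegers K) π ≠ 0 := by
    rw [← map_zero (algebraMap 𝒪[K] (SepIntegers K))]
    exact fun h => hπ.ne_zero (algebraMap_sepIntegers_injective h)
  obtain ⟨s, hs⟩ := exists_frobenius K p
  obtain ⟨t, htI, ht⟩ := exists_tame_generator p hπ
  refine ⟨residueCard K, s, t, exists_residueCard_eq K p, ?_⟩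
  have hfixI : ∀ σ ∈ inertia K, ∀ ξ : SepIntegers K, IsConst p ξ → σ • ξ = ξ :=
    fun σ hσ => (mem_inertia_iff_isConst p).mp hσ
  exact
  { wild_le := wildInertia_le_inertia
    mem_inertia := htI
    inertia_le := by
      intro U hU htU hP σ hσ
      obtain ⟨L, hL⟩ := exists_finite_level_subset p hU hP
      obtain ⟨e, he, hLe⟩ := exists_exponent_mem_lowerRamification_one p hπ L
      have he0 : 0 < e := Nat.pos_of_ne_zero fun h0 => he (h0 ▸ dvd_zero p)
      have : NeZero e := ⟨he0.ne'⟩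
      obtain ⟨ϖ, hϖ⟩ := exists_pow_eq_sepIntegers p (algebraMap 𝒪[K] (SepIntegers K) π) he
      have hϖ0 : ϖ ≠ 0 := by
        rintro rfl; rw [zero_pow he0.ne'] at hϖ; exact hπ0 hϖ.symm
      obtain ⟨A, hA, htA⟩ := ht e he ϖ hϖ
      obtain ⟨B, hB, hσB⟩ := exists_root_ratio (K := K) (x := σ • ϖ) hϖ0 he0 (by
        rw [← smul_pow', hϖ, smul_algebraMap_integers])
      -- On `ϖ` the element `σ` acts as `t ^ j`, so `(t ^ j)⁻¹ * σ` fixes `ϖ`, is wild at level `L`,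
      -- and belongs to `U`.
      obtain ⟨j, -, rfl⟩ := hA.eq_pow_of_pow_eq_one hB
      have htj : ∀ j : ℕ, t ^ j • ϖ = A ^ j * ϖ := by
        intro j
        induction j with
        | zero => simp
        | succ j ih =>
          rw [pow_succ', mul_smul, ih, smul_mul', smul_pow', htA,
            hfixI t htI A (isConst_of_pow_eq_one he hA.pow_eq_one)]
          ring
      have h1 : ((t ^ j)⁻¹ * σ) • ϖ = ϖ := by
        rw [mul_smul, hσB, inv_smul_eq_iff, htj]
      have hmem : (t ^ j)⁻¹ * σ ∈ inertia K := mul_mem (inv_mem (pow_mem htI j)) hσ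
      have h2 : (t ^ j)⁻¹ * σ ∈ U := hL _ hmem (hLe _ hmem ϖ hϖ h1)
      have h3 := U.mul_mem (U.pow_mem htU j) h2
      rwa [mul_inv_cancel_left] at h3
    eq_top := fun U hU hsU hI => eq_top_of_frobenius_mem hs hU hsU hI
    exists_pow_mem := by
      intro U hU hP
      obtain ⟨L, hL⟩ := exists_finite_level_subset p hU hP
      obtain ⟨j, hj, hj2⟩ := exists_pow_mem_lowerRamification_one K p L
      refine ⟨j, hj, hL _ (pow_mem htI j) ?_⟩
      rw [map_pow]
      exact hj2 _ (mem_lowerRamification_zero_of_mem_inertia htI L)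
    relation := by
      rw [mem_wildInertia_iff]
      intro L
      obtain ⟨e, he, hLe⟩ := exists_exponent_mem_lowerRamification_one p hπ L
      have he0 : 0 < e := Nat.pos_of_ne_zero fun h0 => he (h0 ▸ dvd_zero p)
      obtain ⟨ϖ, hϖ⟩ := exists_pow_eq_sepIntegers p (algebraMap 𝒪[K] (SepIntegers K) π) he
      have hϖ0 : ϖ ≠ 0 := by
        rintro rfl; rw [zero_pow he0.ne'] at hϖ; exact hπ0 hϖ.symm
      obtain ⟨A, hA, htA⟩ := ht e he ϖ hϖ
      have hAc : IsConst p A := isConst_of_pow_eq_one he hA.pow_eq_one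
      have htj : ∀ j : ℕ, t ^ j • ϖ = A ^ j * ϖ := by
        intro j
        induction j with
        | zero => simp
        | succ j ih =>
          rw [pow_succ', mul_smul, ih, smul_mul', smul_pow', htA, hfixI t htI A hAc]
          ring
      refine hLe _ (mul_mem ((normal_inertia (K := K)).conj_mem t htI s)
        (inv_mem (pow_mem htI _))) ϖ hϖ ?_
      -- As `s⁻¹ ϖ` is another `e`-th root, `t` multiplies it by the same `A`. Applying `s` turns
      -- `A` into `A ^ q`, so `s t s⁻¹` and `t ^ q` agree on `ϖ`.
      have h1 : t • (s⁻¹ • ϖ) = A * (s⁻¹ • ϖ) := smul_root_eq htI he hϖ0 (by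
        rw [← smul_pow', hϖ, smul_algebraMap_integers]) htA
      have h2 : (s * t * s⁻¹) • ϖ = A ^ residueCard K * ϖ := by
        rw [mul_smul, mul_smul, h1, smul_mul', hs A hAc, smul_inv_smul]
      have h3 : (s * t * s⁻¹) • A = A :=
        hfixI _ ((normal_inertia (K := K)).conj_mem t htI s) A hAc
      have hA0 : A ≠ 0 := hA.ne_zero he0.ne'
      have h4 : A ^ residueCard K * ((t ^ residueCard K)⁻¹ • ϖ) = ϖ := by
        have h5 := htj (residueCard K)
        have h6 := congrArg (fun z => (t ^ residueCard K)⁻¹ • z) h5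
        simp only [inv_smul_smul, smul_mul'] at h6
        rw [hfixI _ (inv_mem (pow_mem htI _)) _ (hAc.pow _)] at h6
        exact h6.symm
      have h7 : A ^ residueCard K * ((s * t * s⁻¹) • ((t ^ residueCard K)⁻¹ • ϖ)) =
          A ^ residueCard K * ϖ := by
        conv_lhs => rw [← h3, ← smul_pow', ← smul_mul']
        rw [h4, h2]
      rw [mul_smul]
      exact mul_left_cancel₀ (pow_ne_zero _ hA0) h7
    wild_pow := fun σ hσ U hU => exists_pow_mem_of_mem_wildInertia p hσ hU
    exists_hom := by
      rintro H _ _ S T hST ⟨e, he, hT⟩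
      exact exists_tame_hom p hπ hs htI ht hST he hT }

end

end LocalDeformation

/-! ### Generalized inverses and linear systems under change of coefficients. -/

open ValuativeRel IsLocalRing

namespace LocalDeformation

section GeneralizedInverse

open Matrix

/-- A matrix over a discrete valuation ring has a generalized inverse if the kernel of its
reduction lifts. -/
theorem exists_generalizedInverse {W F : Type*} [CommRing W] [IsDomain W]
    [IsDiscreteValuationRing W] [Field F] (π : W →+* F) (hπ : Function.Surjective π)
    {ι κ : Type*} [Fintype ι] [Fintype κ] [DecidableEq ι] [DecidableEq κ] (A : Matrix κ ι W)
    (h : ∀ y : ι → F, A.map π *ᵥ y = 0 → ∃ x : ι → W, π ∘ x = y ∧ A *ᵥ x = 0) :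
    ∃ B : Matrix ι κ W, A * B * A = A := by
  obtain ⟨ϖ, hϖ⟩ := IsDiscreteValuationRing.exists_irreducible W
  have hker : RingHom.ker π = Ideal.span {ϖ} := by
    rw [← hϖ.maximalIdeal_eq]
    exact eq_maximalIdeal (RingHom.ker_isMaximal_of_surjective π hπ)
  have hϖπ : π ϖ = 0 := by
    rw [← RingHom.mem_ker, hker]; exact Ideal.mem_span_singleton_self ϖ
  let f := A.mulVecLin
  -- If `ϖ y = A z`, then `z` reduces into the kernel, so `z = x + ϖ w` with `A x = 0`, and `y = A
  -- w`.
  have hsat1 : ∀ y : κ → W, ϖ • y ∈ LinearMap.range f → y ∈ LinearMap.range f := by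
    rintro y ⟨z, hz⟩
    obtain ⟨x, hx, hAx⟩ := h (π ∘ z) (by
      have h1 : π ∘ (A *ᵥ z) = A.map π *ᵥ (π ∘ z) := by
        ext i; simp [Matrix.mulVec, dotProduct, map_sum]
      rw [← h1]
      have h2 : A *ᵥ z = ϖ • y := hz
      rw [h2]; ext i; simp [hϖπ])
    have h3 : ∀ i, ∃ w, z i - x i = ϖ * w := fun i => by
      have h4 : z i - x i ∈ RingHom.ker π := by
        rw [RingHom.mem_ker, map_sub, sub_eq_zero]; exact (congrFun hx i).symm
      rw [hker] at h4
      exact Ideal.mem_span_singleton.mp h4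
    choose w hw using h3
    refine ⟨w, ?_⟩
    have h5 : z = x + ϖ • w := by ext i; simp [← hw]
    have h6 : ϖ • (f w) = ϖ • y := by
      rw [← hz, h5, map_add, map_smul, show f x = 0 from hAx, zero_add]
    exact smul_right_injective _ hϖ.ne_zero h6
  have hsat : ∀ a : W, a ≠ 0 → ∀ y : κ → W, a • y ∈ LinearMap.range f →
      y ∈ LinearMap.range f := by
    intro a ha y hy
    obtain ⟨k, u, rfl⟩ := IsDiscreteValuationRing.eq_unit_mul_pow_irreducible ha hϖ
    rw [mul_smul] at hy
    have h7 := (LinearMap.range f).smul_mem (↑u⁻¹ : W) hy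
    rw [smul_smul, Units.inv_mul, one_smul] at h7
    clear hy ha
    induction k generalizing y with
    | zero => simpa using h7
    | succ k ih =>
      rw [pow_succ, mul_smul] at h7
      exact hsat1 y (ih _ h7)
  -- The cokernel is torsion-free, hence projective, and the image of `A` is a direct summand. `B`
  -- is the projection onto the image followed by a section of `A`.
  have htf : Module.IsTorsionFree W ((κ → W) ⧸ LinearMap.range f) := by
    refine ⟨fun a ha => ?_⟩
    rw [isSMulRegular_iff_right_eq_zero_of_smul]
    intro y hy
    obtain ⟨y, rfl⟩ := Submodule.Quotient.mk_surjective _ y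
    rw [← Submodule.Quotient.mk_smul, Submodule.Quotient.mk_eq_zero] at hy
    exact (Submodule.Quotient.mk_eq_zero _).mpr (hsat a ha.ne_zero y hy)
  obtain ⟨s, hs⟩ := Module.projective_lifting_property (LinearMap.range f).mkQ LinearMap.id
    (Submodule.mkQ_surjective _)
  obtain ⟨r, hr⟩ := Module.projective_lifting_property f.rangeRestrict LinearMap.id
    f.surjective_rangeRestrict
  have hP : ∀ y, y - s ((LinearMap.range f).mkQ y) ∈ LinearMap.range f := fun y => by
    rw [← Submodule.Quotient.mk_eq_zero, ← Submodule.mkQ_apply, map_sub, sub_eq_zero]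
    exact (LinearMap.congr_fun hs _).symm
  let P : (κ → W) →ₗ[W] LinearMap.range f :=
    (LinearMap.id - s ∘ₗ (LinearMap.range f).mkQ).codRestrict _ hP
  refine ⟨LinearMap.toMatrix' (r ∘ₗ P), ?_⟩
  apply Matrix.toLin'.injective
  refine LinearMap.ext fun x => ?_
  rw [Matrix.toLin'_mul, Matrix.toLin'_mul, Matrix.toLin'_toMatrix']
  have h8 : P (f x) = f.rangeRestrict x := by
    apply Subtype.ext
    change f x - s ((LinearMap.range f).mkQ (f x)) = f x
    rw [(Submodule.Quotient.mk_eq_zero _).mpr (LinearMap.mem_range_self f x :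
      f x ∈ LinearMap.range f) |> (fun h => (Submodule.mkQ_apply _ _).trans h), map_zero, sub_zero]
  have h9 := LinearMap.congr_fun hr (f.rangeRestrict x)
  change f (r (P (f x))) = f x
  rw [h8]
  exact congrArg Subtype.val h9

/-- Solutions of a linear system lift along surjections if its matrix has a generalized inverse. -/
theorem exists_lift_of_generalizedInverse {W R S : Type*} [CommRing W] [CommRing R] [CommRing S]
    [Algebra W R] [Algebra W S] (f : R →ₐ[W] S) (hf : Function.Surjective f)
    {ι κ : Type*} [Fintype ι] [Fintype κ] {A : Matrix κ ι W} {B : Matrix ι κ W}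
    (hB : A * B * A = A) (y : ι → S) (hy : A.map (algebraMap W S) *ᵥ y = 0) :
    ∃ x : ι → R, f ∘ x = y ∧ A.map (algebraMap W R) *ᵥ x = 0 := by
  choose z hz using fun i => hf (y i)
  have hB' : A.map (algebraMap W R) * B.map (algebraMap W R) * A.map (algebraMap W R) =
      A.map (algebraMap W R) := by
    rw [← Matrix.map_mul, ← Matrix.map_mul, hB]
  have hz' : f ∘ z = y := funext hz
  -- An arbitrary lift `z` is corrected by `B A z`. The correction maps to zero in `S`, and `A B A =
  -- A` makes the result a solution.
  refine ⟨z - B.map (algebraMap W R) *ᵥ (A.map (algebraMap W R) *ᵥ z), ?_, ?_⟩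
  · have h1 : f ∘ (z - B.map (algebraMap W R) *ᵥ (A.map (algebraMap W R) *ᵥ z)) =
        f ∘ z - f ∘ (B.map (algebraMap W R) *ᵥ (A.map (algebraMap W R) *ᵥ z)) := by
      ext i; simp
    have h2 : ∀ i, f ((B.map (algebraMap W R) *ᵥ (A.map (algebraMap W R) *ᵥ z)) i) = 0 := by
      have h3 : f ∘ (A.map (algebraMap W R) *ᵥ z) = 0 := by
        rw [← hy, ← hz']; ext i; simp [Matrix.mulVec, dotProduct, map_sum]
      intro i
      have h4 : ∀ j, f ((A.map (algebraMap W R) *ᵥ z) j) = 0 := fun j => congrFun h3 j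
      rw [Matrix.mulVec, dotProduct, map_sum]
      exact Finset.sum_eq_zero fun j _ => by rw [map_mul, h4, mul_zero]
    rw [h1, hz']; ext i
    rw [Pi.sub_apply, Function.comp_apply, h2, sub_zero]
  · rw [Matrix.mulVec_sub, Matrix.mulVec_mulVec, Matrix.mulVec_mulVec, hB', sub_self]

/-- The kernel of a matrix with a generalized inverse is free, of a rank that is invariant under
base change. -/
theorem exists_kernel_rank {W : Type*} [CommRing W] [IsDomain W] [IsPrincipalIdealRing W]
    {ι κ : Type*} [Fintype ι] [Fintype κ] [DecidableEq ι] {A : Matrix κ ι W} {B : Matrix ι κ W}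
    (hB : A * B * A = A) : ∃ r : ℕ, ∀ (R : Type*) [CommRing R] [Algebra W R],
      Nonempty (LinearMap.ker (A.map (algebraMap W R)).mulVecLin ≃ₗ[R] (Fin r → R)) := by
  obtain ⟨r, ⟨b⟩⟩ : ∃ r : ℕ, Nonempty (Module.Basis (Fin r) W (LinearMap.ker A.mulVecLin)) :=
    ⟨_, ⟨Module.finBasis W _⟩⟩
  let E : (ι → W) →ₗ[W] LinearMap.ker A.mulVecLin :=
    (LinearMap.id - (B * A).mulVecLin).codRestrict _ fun x => by
      rw [LinearMap.mem_ker]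
      simp [Matrix.mulVec_sub, Matrix.mulVec_mulVec, ← Matrix.mul_assoc, hB]
  have hE : ∀ x : LinearMap.ker A.mulVecLin, E x.1 = x := fun x => by
    have hx : A *ᵥ x.1 = 0 := x.2
    apply Subtype.ext
    simp [E]
  -- `1 - B A` projects onto the kernel and factors as `P Q` through a free module. The matrix
  -- identities `A P = 0`, `Q P = 1` and `P Q = 1 - B A` persist over every algebra and exhibit the
  -- kernel there as free of the same rank.
  let P := LinearMap.toMatrix' ((LinearMap.ker A.mulVecLin).subtype ∘ₗ b.equivFun.symm.toLinearMap)
  let Q := LinearMap.toMatrix' (b.equivFun.toLinearMap ∘ₗ E)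
  have hAP : A * P = 0 := by
    apply Matrix.toLin'.injective
    refine LinearMap.ext fun x => ?_
    rw [Matrix.toLin'_mul, Matrix.toLin'_toMatrix', map_zero]
    exact (b.equivFun.symm x).2
  have hQP : Q * P = 1 := by
    apply Matrix.toLin'.injective
    refine LinearMap.ext fun x => ?_
    rw [Matrix.toLin'_mul, Matrix.toLin'_toMatrix', Matrix.toLin'_toMatrix', Matrix.toLin'_one]
    change b.equivFun (E (b.equivFun.symm x).1) = x
    rw [hE, LinearEquiv.apply_symm_apply]
  have hPQ : P * Q = 1 - B * A := by
    apply Matrix.toLin'.injective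
    refine LinearMap.ext fun x => ?_
    rw [Matrix.toLin'_mul, Matrix.toLin'_toMatrix', Matrix.toLin'_toMatrix']
    change (b.equivFun.symm (b.equivFun (E x))).1 = _
    rw [LinearEquiv.symm_apply_apply]
    simp [E]
  refine ⟨r, fun R _ _ => ⟨?_⟩⟩
  let g := algebraMap W R
  have hAP' : A.map g * P.map g = 0 := by rw [← Matrix.map_mul, hAP, Matrix.map_zero _ (map_zero g)]
  have hQP' : Q.map g * P.map g = 1 := by
    rw [← Matrix.map_mul, hQP, Matrix.map_one _ (map_zero g) (map_one g)]
  have hPQ' : P.map g * Q.map g = 1 - B.map g * A.map g := by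
    rw [← Matrix.map_mul, hPQ, ← Matrix.map_mul, Matrix.map_sub _ (map_sub g),
      Matrix.map_one _ (map_zero g) (map_one g)]
  exact LinearEquiv.ofLinearMap
    ((Q.map g).mulVecLin ∘ₗ Submodule.subtype _)
    ((P.map g).mulVecLin.codRestrict _ fun x => by
      rw [LinearMap.mem_ker]
      change A.map g *ᵥ (P.map g *ᵥ x) = 0
      rw [Matrix.mulVec_mulVec, hAP', Matrix.zero_mulVec])
    (LinearMap.ext fun x => by
      change Q.map g *ᵥ (P.map g *ᵥ x) = x
      rw [Matrix.mulVec_mulVec, hQP', Matrix.one_mulVec])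
    (LinearMap.ext fun x => Subtype.ext (by
      change P.map g *ᵥ (Q.map g *ᵥ x.1) = x.1
      have hx : A.map g *ᵥ x.1 = 0 := x.2
      rw [Matrix.mulVec_mulVec, hPQ', Matrix.sub_mulVec, Matrix.one_mulVec, ← Matrix.mulVec_mulVec,
        hx, Matrix.mulVec_zero, sub_zero]))

end GeneralizedInverse

/-! ### Lifting irreducible polynomials through Teichmüller representatives. -/

section PolynomialLift

open Polynomial

/-- The minimal polynomial of a generator of an extension of finite fields lifts to a divisor of
some `X ^ N - 1` over the Witt vectors, where `N` is prime to the characteristic. -/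
theorem exists_lift_minpoly_dvd (ℓ : ℕ) [Fact ℓ.Prime] {F F' : Type*} [Field F] [Field F']
    [Finite F'] [CharP F ℓ] [CharP F' ℓ] [Algebra F F'] (pb : PowerBasis F F')
    (hx0 : pb.gen ≠ 0) :
    ∃ f : (WittVector ℓ F)[X], f.Monic ∧
      f.map (WittVector.constantCoeff : WittVector ℓ F →+* F) = minpoly F pb.gen ∧
      ∃ N, ¬ ℓ ∣ N ∧ f ∣ X ^ N - 1 := by
  let _ : Fintype F' := Fintype.ofFinite F'
  let _ : Fintype (F' ≃ₐ[F] F') := Fintype.ofFinite _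
  -- The lift has as roots the Teichmüller lifts of the conjugates of the generator. They are
  -- distinct roots of unity of order dividing `#F' - 1`, whence the divisibility.
  let ξ : (F' ≃ₐ[F] F') → WittVector ℓ F' := fun σ => WittVector.teichmuller ℓ (σ pb.gen)
  have hcc : ∀ a : F', WittVector.constantCoeff (WittVector.teichmuller ℓ a) = a :=
    fun a => WittVector.teichmuller_coeff_zero ℓ a
  let g : (WittVector ℓ F')[X] := ∏ σ : F' ≃ₐ[F] F', (X - C (ξ σ))
  have hgm : g.Monic := monic_prod_of_monic _ _ fun σ _ => monic_X_sub_C _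
  have hgdeg : g.natDegree = (minpoly F pb.gen).natDegree := by
    rw [natDegree_prod_of_monic _ _ fun σ _ => monic_X_sub_C _]
    simp only [natDegree_X_sub_C, Finset.sum_const, Finset.card_univ, smul_eq_mul, mul_one]
    rw [← Nat.card_eq_fintype_card, IsGalois.card_aut_eq_finrank]
    exact pb.finrank.trans pb.natDegree_minpoly.symm
  have hfix : ∀ τ : F' ≃ₐ[F] F', g.map (WittVector.map (τ : F' →+* F')) = g := fun τ => by
    simp only [g, Polynomial.map_prod, Polynomial.map_sub, map_X, map_C]
    have h1 : ∀ σ, WittVector.map (τ : F' →+* F') (ξ σ) = ξ (τ * σ) := fun σ => by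
      rw [WittVector.map_teichmuller]; rfl
    simp only [h1]
    exact Fintype.prod_equiv (Equiv.mulLeft τ) _ _ fun σ => rfl
  let ι := WittVector.map (p := ℓ) (algebraMap F F')
  have hι : Function.Injective ι := WittVector.map_injective _ (algebraMap F F').injective
  have hlifts : g ∈ lifts ι := by
    rw [lifts_iff_coeff_lifts]
    intro n
    -- Galois descent for Witt vectors holds component by component.
    have h2 : ∀ k, ∃ a : F, algebraMap F F' a = (g.coeff n).coeff k := fun k => by
      rw [← Set.mem_range, IsGalois.mem_range_algebraMap_iff_fixed]
      intro τ
      have h3 := congrArg (fun h => (h.coeff n).coeff k) (hfix τ)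
      simp only [coeff_map, WittVector.map_coeff] at h3
      exact h3
    choose a ha using h2
    exact ⟨WittVector.mk ℓ a, WittVector.ext fun k => by
      rw [WittVector.map_coeff, WittVector.coeff_mk, ha]⟩
  obtain ⟨f, hfg, hfdeg, hfm⟩ := lifts_and_natDegree_eq_and_monic hlifts hgm
  have hcomp : ∀ w : WittVector ℓ F, algebraMap F F' (WittVector.constantCoeff w) =
      WittVector.constantCoeff (ι w) := fun w => (WittVector.map_coeff _ _ _).symm
  refine ⟨f, hfm, ?_, Fintype.card F' - 1, ?_, ?_⟩
  · refine eq_of_monic_of_dvd_of_natDegree_le (minpoly.monic pb.isIntegral_gen) (hfm.map _) ?_ ?_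
    · apply minpoly.dvd
      have h4 : (f.map (WittVector.constantCoeff : WittVector ℓ F →+* F)).map (algebraMap F F') =
          g.map WittVector.constantCoeff := by
        rw [← hfg, Polynomial.map_map, Polynomial.map_map]
        exact congrArg (fun h => f.map h) (RingHom.ext hcomp)
      rw [aeval_def, ← eval_map, h4]
      simp only [g, Polynomial.map_prod, Polynomial.map_sub, map_X, map_C, eval_prod, eval_sub,
        eval_X, eval_C, ξ, hcc]
      exact Finset.prod_eq_zero (Finset.mem_univ 1) (by simp)
    · rw [hfm.natDegree_map, hfdeg, hgdeg]
  · intro h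
    obtain ⟨n, -, hn⟩ := FiniteField.card F' ℓ
    have hℓ : ℓ ∣ Fintype.card F' := by rw [hn]; exact dvd_pow_self ℓ n.ne_zero
    have h5 := Nat.dvd_sub hℓ h
    rw [Nat.sub_sub_self Fintype.card_pos] at h5
    exact (Fact.out : ℓ.Prime).one_lt.ne' (Nat.dvd_one.mp h5)
  · rw [← Polynomial.map_dvd_map ι hι hfm, hfg, Polynomial.map_sub, Polynomial.map_pow, map_X,
      Polynomial.map_one]
    have h6 : g = (Finset.univ.val.map fun σ => X - C (ξ σ)).prod := rfl
    have hN : 0 < Fintype.card F' - 1 := by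
      have := Fintype.one_lt_card (α := F')
      omega
    have hne : (X ^ (Fintype.card F' - 1) - 1 : (WittVector ℓ F')[X]) ≠ 0 := by
      rw [← C_1]; exact X_pow_sub_C_ne_zero hN 1
    have h7 : g = ((Finset.univ.val.map ξ).map fun a => X - C a).prod := by
      rw [h6, Multiset.map_map]; rfl
    rw [h7, Multiset.prod_X_sub_C_dvd_iff_le_roots hne, Multiset.le_iff_subset]
    · intro a ha
      obtain ⟨σ, -, rfl⟩ := Multiset.mem_map.mp ha
      rw [mem_roots hne, IsRoot.def, eval_sub, eval_pow, eval_X, eval_one, ← map_pow,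
        FiniteField.pow_card_sub_one_eq_one _ (by simpa using hx0), map_one, sub_self]
    · refine Multiset.Nodup.map ?_ Finset.univ.nodup
      intro σ τ hστ
      have h8 : σ pb.gen = τ pb.gen := by
        rw [← hcc (σ pb.gen), ← hcc (τ pb.gen)]; exact congrArg _ hστ
      have h9 : (σ : F' →ₐ[F] F') = τ := pb.algHom_ext h8
      exact AlgEquiv.ext fun z => DFunLike.congr_fun h9 z

/-- An irreducible polynomial over a finite field that does not vanish at zero lifts to a divisor of
some `X ^ N - 1` over the Witt vectors, where `N` is prime to the characteristic. -/
theorem exists_monic_lift_dvd (ℓ : ℕ) [Fact ℓ.Prime] {F : Type u} [Field F] [Finite F] [CharP F ℓ]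
    {p : F[X]} (hp : Irreducible p) (hpm : p.Monic) (hp0 : p.coeff 0 ≠ 0) :
    ∃ f : (WittVector ℓ F)[X], f.Monic ∧
      f.map (WittVector.constantCoeff : WittVector ℓ F →+* F) = p ∧
      ∃ N, ¬ ℓ ∣ N ∧ f ∣ X ^ N - 1 := by
  have : Fact (Irreducible p) := ⟨hp⟩
  have : Module.Finite F (AdjoinRoot p) := hpm.finite_adjoinRoot
  have : Finite (AdjoinRoot p) := Module.finite_of_finite F
  have : CharP (AdjoinRoot p) ℓ :=
    charP_of_injective_algebraMap (algebraMap F (AdjoinRoot p)).injective ℓ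
  have hmin : minpoly F (AdjoinRoot.root p) = p := by
    rw [AdjoinRoot.minpoly_root hp.ne_zero, hpm.leadingCoeff]; simp
  have h := exists_lift_minpoly_dvd ℓ (AdjoinRoot.powerBasis hp.ne_zero) (fun h => hp0 (by
    have h1 : aeval (AdjoinRoot.root p) (minpoly F (AdjoinRoot.root p)) = 0 := minpoly.aeval F _
    rw [AdjoinRoot.powerBasis_gen] at h
    rw [hmin, h, ← coeff_zero_eq_aeval_zero'] at h1
    exact (map_eq_zero_iff _ (algebraMap F (AdjoinRoot p)).injective).mp h1))
  rwa [AdjoinRoot.powerBasis_gen, hmin] at h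

end PolynomialLift

end LocalDeformation

/-! ### Lifting an automorphism of finite order to a module over the Witt vectors. -/

open ValuativeRel IsLocalRing

namespace LocalDeformation

section ModuleLift

open Polynomial

variable {ℓ : ℕ} [Fact ℓ.Prime] {F : Type u} [Field F]

/-- The residue map of the ring of Witt vectors. -/
noncomputable abbrev wittResidue (ℓ : ℕ) [Fact ℓ.Prime] (F : Type u) [Field F] : WittVector ℓ F →+* F :=
  WittVector.constantCoeff

theorem wittResidue_teichmuller (a : F) : wittResidue ℓ F (WittVector.teichmuller ℓ a) = a :=
  WittVector.teichmuller_coeff_zero ℓ a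

theorem wittResidue_surjective : Function.Surjective (wittResidue ℓ F) := fun a =>
  ⟨WittVector.teichmuller ℓ a, wittResidue_teichmuller a⟩

variable [CharP F ℓ]

theorem isUnit_of_wittResidue_ne_zero [Finite F] {w : WittVector ℓ F} (h : wittResidue ℓ F w ≠ 0) :
    IsUnit w :=
  WittVector.isUnit_of_coeff_zero_ne_zero w h

theorem natCast_dvd_of_wittResidue_eq_zero [Finite F] {w : WittVector ℓ F}
    (h : wittResidue ℓ F w = 0) : (ℓ : WittVector ℓ F) ∣ w := by
  rw [← Ideal.mem_span_singleton]
  exact (WittVector.mem_span_p_iff_coeff_zero_eq_zero w).mpr h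

variable [Finite F]

theorem natCast_dvd_of_map_wittResidue_eq_zero {g : (WittVector ℓ F)[X]}
    (h : g.map (wittResidue ℓ F) = 0) : ∃ k, g = (ℓ : (WittVector ℓ F)[X]) * k := by
  have h1 : C (ℓ : WittVector ℓ F) ∣ g := by
    rw [C_dvd_iff_dvd_coeff]
    intro i
    apply natCast_dvd_of_wittResidue_eq_zero
    rw [← coeff_map, h, coeff_zero]
  rwa [map_natCast] at h1

/-- Coprimality of monic polynomials means that their resultant is a unit, and units of `W(F)` are
detected modulo `ℓ`. -/
theorem isCoprime_of_isCoprime_map {f g : (WittVector ℓ F)[X]} (hf : f.Monic) (hg : g.Monic)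
    (h : IsCoprime (f.map (wittResidue ℓ F)) (g.map (wittResidue ℓ F))) : IsCoprime f g := by
  rw [← isUnit_resultant_iff_isCoprime hf]
  rw [← isUnit_resultant_iff_isCoprime (hf.map _), hf.natDegree_map, hg.natDegree_map,
    resultant_map_map] at h
  exact isUnit_of_wittResidue_ne_zero h.ne_zero

theorem separable_X_pow_sub_one {N : ℕ} (hN : ¬ ℓ ∣ N) : (X ^ N - 1 : F[X]).Separable := by
  rw [← C_1]
  exact separable_X_pow_sub_C 1 (fun h => hN ((CharP.cast_eq_zero_iff F ℓ N).mp h)) one_ne_zero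

/-- Divisibility among divisors of `X ^ N - 1`, where `N` is prime to the residue characteristic,
can be tested modulo `ℓ`. -/
theorem exists_eq_mul_of_map_dvd_map {f Q : (WittVector ℓ F)[X]} (hf : f.Monic) (hQ : Q.Monic)
    {N M : ℕ} (hN : ¬ ℓ ∣ N) (hM : ¬ ℓ ∣ M) (hfN : f ∣ X ^ N - 1) (hQM : Q ∣ X ^ M - 1)
    (h : f.map (wittResidue ℓ F) ∣ Q.map (wittResidue ℓ F)) :
    ∃ u, Q = f * u ∧ IsCoprime (f.map (wittResidue ℓ F)) (u.map (wittResidue ℓ F)) := by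
  have hNM : ¬ ℓ ∣ N * M := fun h1 => ((Fact.out : ℓ.Prime).dvd_mul.mp h1).elim hN hM
  have h0 : N * M ≠ 0 := fun h1 => hNM (h1 ▸ dvd_zero ℓ)
  have hf' : f ∣ X ^ (N * M) - 1 := by
    refine hfN.trans ?_
    have := sub_dvd_pow_sub_pow (X ^ N : (WittVector ℓ F)[X]) 1 M
    rwa [one_pow, ← pow_mul] at this
  obtain ⟨k, hk⟩ : Q ∣ X ^ (N * M) - 1 := by
    refine hQM.trans ?_
    have := sub_dvd_pow_sub_pow (X ^ M : (WittVector ℓ F)[X]) 1 N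
    rwa [one_pow, ← pow_mul, mul_comm M] at this
  -- As `X ^ (N * M) - 1` is separable modulo `ℓ`, a reduction of `f` dividing that of `Q` is
  -- coprime to the cofactor `k`. Then `f` itself is coprime to `k` and has to divide `Q`.
  have hsep : (Q.map (wittResidue ℓ F) * k.map (wittResidue ℓ F)).Separable := by
    have h1 : (X ^ (N * M) - 1 : F[X]) = (X ^ (N * M) - 1 : (WittVector ℓ F)[X]).map
        (wittResidue ℓ F) := by
      rw [Polynomial.map_sub, Polynomial.map_pow, map_X, Polynomial.map_one]
    rw [← Polynomial.map_mul, ← hk, ← h1]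
    exact separable_X_pow_sub_one hNM
  have hkm : k.Monic := by
    refine hQ.of_mul_monic_left ?_
    rw [← hk]
    exact monic_X_pow_sub_C 1 h0
  have hcop : IsCoprime f k := isCoprime_of_isCoprime_map hf hkm
    (IsCoprime.of_isCoprime_of_dvd_left hsep.isCoprime h)
  rw [hk] at hf'
  obtain ⟨u, rfl⟩ := hcop.dvd_of_dvd_mul_right hf'
  refine ⟨u, rfl, ?_⟩
  rw [Polynomial.map_mul] at hsep
  exact hsep.of_mul_left.isCoprime

/-- Torsion of `F[X] / f ^ e'` with respect to powers of divisors of `X ^ M - 1` lifts. -/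
theorem exists_lift_torsion {f Q : (WittVector ℓ F)[X]} (hf : f.Monic) (hQ : Q.Monic)
    (hirr : Irreducible (f.map (wittResidue ℓ F)))
    {N M : ℕ} (hN : ¬ ℓ ∣ N) (hM : ¬ ℓ ∣ M) (hfN : f ∣ X ^ N - 1) (hQM : Q ∣ X ^ M - 1)
    (e e' : ℕ) (y : F[X])
    (h : f.map (wittResidue ℓ F) ^ e' ∣ Q.map (wittResidue ℓ F) ^ e * y) :
    ∃ z : (WittVector ℓ F)[X], f.map (wittResidue ℓ F) ^ e' ∣ z.map (wittResidue ℓ F) - y ∧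
      f ^ e' ∣ Q ^ e * z := by
  have hlift : ∀ y : F[X], ∃ z : (WittVector ℓ F)[X], z.map (wittResidue ℓ F) = y :=
    Polynomial.map_surjective _ wittResidue_surjective
  -- If `Q` is coprime to `f` modulo `ℓ`, it acts injectively on the cyclic module and only the zero
  -- class is torsion. Otherwise `Q = f * u` with `u` invertible there, and the torsion is that of
  -- `f ^ e`.
  rcases hirr.isCoprime_or_dvd (Q.map (wittResidue ℓ F)) with hc | hd
  · refine ⟨0, ?_, by simp⟩
    rw [Polynomial.map_zero, zero_sub, dvd_neg]
    exact (IsCoprime.pow hc).dvd_of_dvd_mul_left h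
  · obtain ⟨u, rfl, hu⟩ := exists_eq_mul_of_map_dvd_map hf hQ hN hM hfN hQM hd
    have h1 : f.map (wittResidue ℓ F) ^ e' ∣ f.map (wittResidue ℓ F) ^ e * y := by
      rw [Polynomial.map_mul, mul_pow, mul_right_comm] at h
      exact (IsCoprime.pow hu).dvd_of_dvd_mul_right h
    rcases le_or_gt e' e with hle | hlt
    · obtain ⟨z, rfl⟩ := hlift y
      refine ⟨z, by simp, ?_⟩
      rw [mul_pow, mul_assoc]
      exact (pow_dvd_pow f hle).mul_right _
    -- With `e' = e + d` the torsion consists of the multiples of `f ^ d`, which lift visibly.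
    · obtain ⟨d, rfl⟩ := Nat.exists_eq_add_of_le hlt.le
      rw [pow_add] at h1
      obtain ⟨w, hw⟩ := (mul_dvd_mul_iff_left (pow_ne_zero e hirr.ne_zero)).mp h1
      obtain ⟨z, rfl⟩ := hlift w
      refine ⟨f ^ d * z, ?_, ?_⟩
      · rw [hw, Polynomial.map_mul, Polynomial.map_pow, sub_self]
        exact dvd_zero _
      · rw [mul_pow, pow_add]
        exact ⟨u ^ e * z, by ring⟩

/-- An automorphism of finite order of a finite dimensional vector space, viewed as a module over
the polynomial ring, lifts to a module over the Witt vectors in such a way that torsion with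
respect to powers of divisors of `X ^ N - 1` lifts. -/
theorem exists_module_lift {V : Type u} [AddCommGroup V] [Module F V] [Module.Finite F V]
    (τ : Module.End F V) {j : ℕ} (hj : 0 < j) (hτ : τ ^ j = 1) :
    ∃ (ι : Type u) (_ : Fintype ι) (f : ι → (WittVector ℓ F)[X]) (e : ι → ℕ)
      (red : (∀ i, (WittVector ℓ F)[X] ⧸ Ideal.span {f i ^ e i}) →+ V),
      (∀ i, (f i).Monic) ∧ (∀ i, ∃ N, ¬ ℓ ∣ N ∧ f i ∣ X ^ N - 1) ∧
      Function.Surjective red ∧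
      (∀ (P : (WittVector ℓ F)[X]) m, red (P • m) = aeval τ (P.map (wittResidue ℓ F)) (red m)) ∧
      (∀ m, red m = 0 → ∃ m', m = (ℓ : (WittVector ℓ F)[X]) • m') ∧
      (∀ Q : (WittVector ℓ F)[X], Q.Monic → (∃ N, ¬ ℓ ∣ N ∧ Q ∣ X ^ N - 1) → ∀ (k : ℕ) (v : V),
        aeval τ (Q.map (wittResidue ℓ F) ^ k) v = 0 → ∃ m, red m = v ∧ Q ^ k • m = 0) := by
  -- The decomposition of `V` into modules `F[X] / p_i ^ e_i` is lifted factor by factor.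
  obtain ⟨ι, hι, p, hp, e, ⟨E⟩⟩ := Module.equiv_directSum_of_isTorsion (R := F[X])
    (M := Module.AEval' τ) (Module.AEval.isTorsion_of_finiteDimensional F V τ)
  let o := Module.AEval'.of τ
  have ho : ∀ (P : F[X]) (x : Module.AEval' τ), o.symm (P • x) = aeval τ P (o.symm x) := by
    intro P x
    obtain ⟨y, rfl⟩ := o.surjective x
    rw [LinearEquiv.symm_apply_apply, LinearEquiv.symm_apply_eq]
    exact (Module.AEval.of_aeval_smul τ P y).symm
  classical
  let E' : Module.AEval' τ ≃ₗ[F[X]] ∀ i, F[X] ⧸ (F[X] ∙ p i ^ e i) :=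
    E ≪≫ₗ DirectSum.linearEquivFunOnFintype F[X] ι _
  -- This ensures that the `p i` that really occur do not vanish at zero, so that they have
  -- Teichmüller lifts dividing some `X ^ N - 1`.
  have hdvd : ∀ i, p i ^ e i ∣ X ^ j - 1 := by
    intro i
    have h1 : ∀ x : Module.AEval' τ, (X ^ j - 1 : F[X]) • x = 0 := fun x => by
      apply o.symm.injective
      rw [ho, map_sub, map_pow, aeval_X, map_one, hτ, sub_self, map_zero]; rfl
    have h2 := congrFun (congrArg E' (h1 (E'.symm (Pi.single i (Submodule.Quotient.mk 1))))) i
    rw [map_smul, LinearEquiv.apply_symm_apply, Pi.smul_apply, Pi.single_eq_same, map_zero,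
      Pi.zero_apply, ← Submodule.Quotient.mk_smul, Submodule.Quotient.mk_eq_zero,
      smul_eq_mul, mul_one] at h2
    exact Ideal.mem_span_singleton.mp h2
  have hex : ∀ i, ∃ f : (WittVector ℓ F)[X], f.Monic ∧ Irreducible (f.map (wittResidue ℓ F)) ∧
      Associated (f.map (wittResidue ℓ F) ^ e i) (p i ^ e i) ∧
      ∃ N, ¬ ℓ ∣ N ∧ f ∣ X ^ N - 1 := by
    intro i
    -- For `e i = 0` the factor is zero and `p i` is arbitrary, so any admissible polynomial serves;
    -- `X - 1` is taken.
    rcases Nat.eq_zero_or_pos (e i) with h0 | hpos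
    · refine ⟨X - C 1, monic_X_sub_C 1, ?_, by rw [h0, pow_zero, pow_zero], 1,
        (Fact.out : ℓ.Prime).one_lt.ne' ∘ Nat.dvd_one.mp, by rw [pow_one, C_1]⟩
      rw [Polynomial.map_sub, map_X, map_C]
      exact irreducible_X_sub_C _
    · have hass : Associated (normalize (p i)) (p i) := (normalize_associated (p i))
      obtain ⟨f, hf, hfp, N, hN, hfN⟩ := exists_monic_lift_dvd ℓ (hass.symm.irreducible (hp i))
        (monic_normalize (hp i).ne_zero) (fun h => by
          have h1 : normalize (p i) ∣ X ^ j - 1 :=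
            hass.dvd.trans ((dvd_pow_self _ hpos.ne').trans (hdvd i))
          have h2 := (X_dvd_iff.mpr h).trans h1
          rw [X_dvd_iff, coeff_sub, coeff_X_pow, if_neg hj.ne, coeff_one_zero, zero_sub,
            neg_eq_zero] at h2
          exact one_ne_zero h2)
      exact ⟨f, hf, by rw [hfp]; exact hass.symm.irreducible (hp i),
        by rw [hfp]; exact hass.pow_pow, N, hN, hfN⟩
  choose f hf hirr hass hN using hex
  have hspan : ∀ i, (F[X] ∙ p i ^ e i) = Ideal.span {(f i).map (wittResidue ℓ F) ^ e i} :=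
    fun i => (Ideal.span_singleton_eq_span_singleton.mpr (hass i)).symm
  have hle : ∀ i, Ideal.span {f i ^ e i} ≤
      Ideal.comap (mapRingHom (wittResidue ℓ F)) (F[X] ∙ p i ^ e i) := by
    intro i
    rw [Ideal.span_singleton_le_iff_mem, Ideal.mem_comap, coe_mapRingHom, Polynomial.map_pow, hspan]
    exact Ideal.mem_span_singleton_self _
  let ri : ∀ i, (WittVector ℓ F)[X] ⧸ Ideal.span {f i ^ e i} →+* F[X] ⧸ (F[X] ∙ p i ^ e i) :=
    fun i => Ideal.quotientMap _ (mapRingHom (wittResidue ℓ F)) (hle i)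
  have hri : ∀ i (P : (WittVector ℓ F)[X]), ri i (Ideal.Quotient.mk _ P) =
      Ideal.Quotient.mk _ (P.map (wittResidue ℓ F)) := fun i P => Ideal.quotientMap_mk
  let red : (∀ i, (WittVector ℓ F)[X] ⧸ Ideal.span {f i ^ e i}) →+ V :=
    { toFun := fun m => o.symm (E'.symm fun i => ri i (m i))
      map_zero' := by
        have : (fun i => ri i ((0 : ∀ i, (WittVector ℓ F)[X] ⧸ Ideal.span {f i ^ e i}) i)) = 0 :=
          funext fun i => map_zero _
        rw [this, map_zero, map_zero]
      map_add' := fun x y => by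
        rw [← map_add, ← map_add]
        exact congrArg (fun z => o.symm (E'.symm z)) (funext fun i => map_add _ _ _) }
  have hred : ∀ m v, (∀ i, ri i (m i) = E' (o v) i) → red m = v := by
    intro m v h
    change o.symm (E'.symm fun i => ri i (m i)) = v
    rw [LinearEquiv.symm_apply_eq, LinearEquiv.symm_apply_eq]
    exact funext h
  refine ⟨ι, hι, f, e, red, hf, hN, ?_, ?_, ?_, ?_⟩
  · intro v
    have h1 : ∀ i, ∃ P : (WittVector ℓ F)[X],
        Ideal.Quotient.mk (F[X] ∙ p i ^ e i) (P.map (wittResidue ℓ F)) = E' (o v) i := by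
      intro i
      obtain ⟨P, hP⟩ := Ideal.Quotient.mk_surjective (E' (o v) i)
      obtain ⟨P', rfl⟩ := Polynomial.map_surjective (wittResidue ℓ F) wittResidue_surjective P
      exact ⟨P', hP⟩
    choose P hP using h1
    exact ⟨fun i => Ideal.Quotient.mk _ (P i), hred _ _ fun i => by rw [hri, hP]⟩
  · intro P m
    change o.symm (E'.symm fun i => ri i (P • m i)) = _
    change _ = aeval τ (P.map (wittResidue ℓ F)) (o.symm (E'.symm fun i => ri i (m i)))
    rw [← ho, ← map_smul E'.symm]
    refine congrArg (fun z => o.symm (E'.symm z)) (funext fun i => ?_)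
    obtain ⟨y, hy⟩ := Ideal.Quotient.mk_surjective (m i)
    rw [Pi.smul_apply, ← hy, hri]
    exact hri i (P * y) |>.trans (by rw [Polynomial.map_mul]; rfl)
  · intro m hm
    have h1 : ∀ i, ri i (m i) = 0 := by
      have h2 : E'.symm (fun i => ri i (m i)) = 0 := (o.symm.map_eq_zero_iff).mp hm
      exact fun i => congrFun ((E'.symm.map_eq_zero_iff).mp h2) i
    have h3 : ∀ i, ∃ m' : (WittVector ℓ F)[X] ⧸ Ideal.span {f i ^ e i},
        m i = (ℓ : (WittVector ℓ F)[X]) • m' := by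
      intro i
      obtain ⟨y, hy⟩ := Ideal.Quotient.mk_surjective (m i)
      have h4 := h1 i
      rw [← hy, hri, Ideal.Quotient.eq_zero_iff_mem, hspan, Ideal.mem_span_singleton] at h4
      obtain ⟨w, hw⟩ := h4
      obtain ⟨w, rfl⟩ := Polynomial.map_surjective (wittResidue ℓ F) wittResidue_surjective w
      obtain ⟨k, hk⟩ := natCast_dvd_of_map_wittResidue_eq_zero (g := y - f i ^ e i * w) (by
        rw [Polynomial.map_sub, hw, Polynomial.map_mul, Polynomial.map_pow, sub_self])
      refine ⟨Ideal.Quotient.mk _ k, ?_⟩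
      rw [← hy]
      change _ = Ideal.Quotient.mk _ ((ℓ : (WittVector ℓ F)[X]) * k)
      rw [← hk, Ideal.Quotient.eq, sub_sub_cancel]
      exact Ideal.mul_mem_right _ _ (Ideal.mem_span_singleton_self _)
    choose m' hm' using h3
    exact ⟨m', funext hm'⟩
  · rintro Q hQ ⟨M, hM, hQM⟩ k v hv
    have h1 : ∀ i, ∃ z : (WittVector ℓ F)[X],
        Ideal.Quotient.mk (F[X] ∙ p i ^ e i) (z.map (wittResidue ℓ F)) = E' (o v) i ∧
        f i ^ e i ∣ Q ^ k * z := by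
      intro i
      obtain ⟨y, hy⟩ := Ideal.Quotient.mk_surjective (E' (o v) i)
      obtain ⟨N, hN, hfN⟩ := hN i
      obtain ⟨z, hz1, hz2⟩ := exists_lift_torsion (hf i) hQ (hirr i) hN hM hfN hQM k (e i) y (by
        rw [← Ideal.mem_span_singleton, ← hspan, ← Ideal.Quotient.eq_zero_iff_mem]
        have h2 : (Q.map (wittResidue ℓ F) ^ k) • o v = 0 := by
          apply o.symm.injective
          rw [ho, LinearEquiv.symm_apply_apply, hv, map_zero]
        have h3 := congrFun (congrArg E' h2) i
        rw [map_smul, Pi.smul_apply, ← hy, map_zero] at h3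
        exact h3)
      refine ⟨z, ?_, hz2⟩
      rw [← hy, Ideal.Quotient.eq, hspan]
      exact Ideal.mem_span_singleton.mpr hz1
    choose z hz1 hz2 using h1
    refine ⟨fun i => Ideal.Quotient.mk _ (z i), hred _ _ fun i => by rw [hri, hz1], ?_⟩
    funext i
    change Ideal.Quotient.mk _ (Q ^ k * z i) = 0
    rw [Ideal.Quotient.eq_zero_iff_mem]
    exact Ideal.mem_span_singleton.mpr (hz2 i)

end ModuleLift

end LocalDeformation

/-! ### Construction of the matrix `T` over the Witt vectors. -/

open ValuativeRel IsLocalRing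

namespace LocalDeformation

section MatrixLift

open Polynomial Matrix
open scoped Kronecker

/-- The characteristic polynomial of `A - 1` is a power of `X`; its value at `-1` is also the
determinant of `-A`. -/
theorem det_eq_one_of_isNilpotent_sub_one {R ι : Type*} [CommRing R] [IsDomain R] [Fintype ι]
    [DecidableEq ι] {A : Matrix ι ι R} (h : IsNilpotent (A - 1)) : A.det = 1 := by
  have h1 : (A - 1).charpoly = X ^ Fintype.card ι :=
    sub_eq_zero.mp (Matrix.isNilpotent_charpoly_sub_pow_of_isNilpotent h).eq_zero
  have h2 := Matrix.eval_charpoly (A - 1) (-1)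
  rw [h1, eval_pow, eval_X] at h2
  have h3 : Matrix.scalar ι (-1 : R) - (A - 1) = -A := by
    rw [map_neg, map_one]; abel
  rw [h3, Matrix.det_neg] at h2
  have h4 : ((-1 : R) ^ Fintype.card ι) ≠ 0 := pow_ne_zero _ (neg_ne_zero.mpr one_ne_zero)
  exact mul_left_cancel₀ h4 (by rw [← h2, mul_one])

theorem mul_aeval_eq_aeval_mul {R A : Type*} [CommRing R] [Ring A] [Algebra R A] {x a b : A}
    (h : x * a = b * x) (P : R[X]) : x * aeval a P = aeval b P * x := by
  rw [aeval_eq_sum_range, aeval_eq_sum_range, Finset.mul_sum, Finset.sum_mul]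
  refine Finset.sum_congr rfl fun k _ => ?_
  rw [mul_smul_comm, smul_mul_assoc, (show SemiconjBy x a b from h).pow_right k]

/-- The matrix of the linear map `Y ↦ Y T - T ^ c Y`. -/
def sylvester {R ι : Type*} [CommRing R] [Fintype ι] [DecidableEq ι] (T : Matrix ι ι R) (c : ℕ) :
    Matrix (ι × ι) (ι × ι) R :=
  Tᵀ ⊗ₖ (1 : Matrix ι ι R) - (1 : Matrix ι ι R) ⊗ₖ (T ^ c)

theorem sylvester_mulVec_vec {R ι : Type*} [CommRing R] [Fintype ι] [DecidableEq ι]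
    (T : Matrix ι ι R) (c : ℕ) (Y : Matrix ι ι R) :
    sylvester T c *ᵥ vec Y = vec (Y * T - T ^ c * Y) := by
  rw [sylvester, Matrix.sub_mulVec, kronecker_mulVec_vec, kronecker_mulVec_vec, Matrix.one_mul,
    Matrix.transpose_one, Matrix.mul_one, Matrix.transpose_transpose, vec_sub]

theorem sylvester_map {R S ι : Type*} [CommRing R] [CommRing S] [Fintype ι] [DecidableEq ι]
    (f : R →+* S) (T : Matrix ι ι R) (c : ℕ) :
    (sylvester T c).map f = sylvester (T.map f) c := by
  have h1 : (T ^ c).map f = T.map f ^ c := map_pow f.mapMatrix T c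
  ext ⟨i, j⟩ ⟨k, l⟩
  rw [sylvester, sylvester, ← h1]
  simp [Matrix.one_apply, apply_ite f]

theorem vec_surjective {R ι : Type*} (y : ι × ι → R) : ∃ Y : Matrix ι ι R, vec Y = y :=
  ⟨Matrix.of fun i j => y (j, i), rfl⟩

variable {ℓ : ℕ} [Fact ℓ.Prime] {F : Type u} [Field F] [CharP F ℓ] [Finite F]

/-- A module over the Witt vectors without `ℓ`-torsion is free on every lift of a basis of its
reduction. -/
theorem exists_basis_of_reduction {M : Type*} [AddCommGroup M] [Module (WittVector ℓ F) M]
    [Module.Finite (WittVector ℓ F) M] [Module.Free (WittVector ℓ F) M] {n : ℕ}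
    (red : M →+ (Fin n → F)) (hred : Function.Surjective red)
    (hsmul : ∀ (w : WittVector ℓ F) m, red (w • m) = wittResidue ℓ F w • red m)
    (hker : ∀ m, red m = 0 → ∃ m', m = (ℓ : WittVector ℓ F) • m') :
    ∃ b : Module.Basis (Fin n) (WittVector ℓ F) M, ∀ m, red m = wittResidue ℓ F ∘ b.equivFun m := by
  have hℓ : Irreducible (ℓ : WittVector ℓ F) := WittVector.irreducible ℓ
  choose b hb using fun k : Fin n => hred (Pi.single k 1)
  have hsum : ∀ w : Fin n → WittVector ℓ F, red (∑ k, w k • b k) = wittResidue ℓ F ∘ w := by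
    intro w
    rw [map_sum]
    simp only [hsmul, hb]
    ext i
    simp [Finset.sum_apply, Pi.single_apply]
  -- A relation reduces to the trivial one, so its coefficients are divisible by `ℓ`. As `M` has no
  -- `ℓ`-torsion it can be divided by `ℓ`, again and again.
  have hpow : ∀ s : ℕ, ∀ w : Fin n → WittVector ℓ F, ∑ k, w k • b k = 0 →
      ∀ k, (ℓ : WittVector ℓ F) ^ s ∣ w k := by
    intro s
    induction s with
    | zero => intro w _ k; rw [pow_zero]; exact one_dvd _
    | succ s ih =>
      intro w hw
      have h1 : ∀ k, (ℓ : WittVector ℓ F) ∣ w k := fun k => by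
        apply natCast_dvd_of_wittResidue_eq_zero
        have h2 := hsum w
        rw [hw, map_zero] at h2
        exact (congrFun h2 k).symm
      choose w' hw' using h1
      have h3 : (ℓ : WittVector ℓ F) • ∑ k, w' k • b k = 0 := by
        rw [Finset.smul_sum, ← hw]
        exact Finset.sum_congr rfl fun k _ => by rw [smul_smul, ← hw']
      intro k
      rw [hw' k, pow_succ']
      exact mul_dvd_mul_left _ (ih w' ((smul_eq_zero_iff_right hℓ.ne_zero).mp h3) k)
  have hli : LinearIndependent (WittVector ℓ F) b := by
    rw [Fintype.linearIndependent_iff]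
    intro w hw k
    by_contra hne
    obtain ⟨s, hs⟩ := FiniteMultiplicity.of_not_isUnit hℓ.not_isUnit hne
    exact hs (hpow _ w hw k)
  -- Nakayama's lemma: the lifts of the basis generate modulo `ℓ`.
  have hspan : ⊤ ≤ Submodule.span (WittVector ℓ F) (Set.range b) := by
    refine Submodule.le_of_le_smul_of_le_jacobson_bot (I := Ideal.span {(ℓ : WittVector ℓ F)})
      Module.Finite.fg_top ?_ ?_
    · rw [IsLocalRing.jacobson_eq_maximalIdeal _ bot_ne_top,
        Ideal.span_singleton_le_iff_mem, IsLocalRing.mem_maximalIdeal]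
      exact hℓ.not_isUnit
    · intro m _
      choose w hw using fun k => wittResidue_surjective (ℓ := ℓ) (red m k)
      obtain ⟨m', hm'⟩ := hker (m - ∑ k, w k • b k) (by
        rw [map_sub, hsum, sub_eq_zero]; exact funext fun k => (hw k).symm)
      rw [← sub_add_cancel m (∑ k, w k • b k), hm', add_comm]
      refine Submodule.add_mem_sup (Submodule.sum_mem _ fun k _ =>
        Submodule.smul_mem _ _ (Submodule.subset_span ⟨k, rfl⟩))
        (Submodule.smul_mem_smul (Ideal.mem_span_singleton_self _) trivial)
  refine ⟨Module.Basis.mk hli hspan, fun m => ?_⟩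
  conv_lhs => rw [← (Module.Basis.mk hli hspan).sum_equivFun m]
  simp only [Module.Basis.mk_apply]
  exact hsum _

/-- Twisted endomorphisms of a product of cyclic modules over a polynomial ring. -/
theorem exists_twisted_endomorphism {W ι : Type*} [CommRing W] [Fintype ι] [DecidableEq ι]
    (g : ι → W[X]) (c : ℕ) (m : ι → ∀ i, W[X] ⧸ Ideal.span {g i})
    (hm : ∀ i, expand W c (g i) • m i = 0) :
    ∃ Y : Module.End W (∀ i, W[X] ⧸ Ideal.span {g i}),
      (∀ (P : W[X]) x, Y (P • x) = expand W c P • Y x) ∧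
      ∀ i, Y (Pi.single i (Ideal.Quotient.mk _ 1)) = m i := by
  -- The map `P ↦ P(X ^ c) • m i` factors through the quotient by `g i`, because `g i (X ^ c)` kills
  -- `m i`.
  let φ : ∀ i, W[X] →ₗ[W] ∀ i, W[X] ⧸ Ideal.span {g i} := fun i =>
    ((LinearMap.toSpanSingleton W[X] _ (m i)).restrictScalars W) ∘ₗ (expand W c).toLinearMap
  have hφ : ∀ i P, φ i P = expand W c P • m i := fun i P => rfl
  let ψ : ∀ i, (W[X] ⧸ Ideal.span {g i}) →ₗ[W] ∀ i, W[X] ⧸ Ideal.span {g i} := fun i =>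
    (((Ideal.span {g i}).restrictScalars W).liftQ (φ i) (by
      intro P hP
      obtain ⟨Q, rfl⟩ := Ideal.mem_span_singleton.mp hP
      rw [LinearMap.mem_ker, hφ, map_mul, mul_comm, mul_smul, hm, smul_zero])) ∘ₗ
    (Submodule.Quotient.restrictScalarsEquiv W (Ideal.span {g i})).symm.toLinearMap
  have hψ : ∀ i P, ψ i (Ideal.Quotient.mk _ P) = expand W c P • m i := fun i P => rfl
  have hψsmul : ∀ i P y, ψ i (P • y) = expand W c P • ψ i y := by
    intro i P y
    obtain ⟨Q, rfl⟩ := Ideal.Quotient.mk_surjective y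
    rw [hψ, smul_smul, ← map_mul, ← hψ]; rfl
  refine ⟨∑ i, ψ i ∘ₗ LinearMap.proj i, fun P x => ?_, fun i => ?_⟩
  · simp only [LinearMap.sum_apply, LinearMap.comp_apply, LinearMap.proj_apply, Pi.smul_apply,
      hψsmul, Finset.smul_sum]
  · simp only [LinearMap.sum_apply, LinearMap.comp_apply, LinearMap.proj_apply]
    rw [Finset.sum_eq_single i, Pi.single_eq_same, hψ, map_one, one_smul]
    · intro k _ hk
      rw [Pi.single_eq_of_ne hk, map_zero]
    · exact fun h => absurd (Finset.mem_univ i) h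

/-- A matrix of finite order over a finite field lifts to the Witt vectors in such a way that
commutators, Frobenius commutators and fixed vectors lift as well. -/
theorem exists_matrix_lift {n : ℕ} (t : Matrix (Fin n) (Fin n) F) {j : ℕ} (hj : 0 < j)
    (ht : t ^ j = 1) :
    ∃ T : Matrix (Fin n) (Fin n) (WittVector ℓ F), T.map (wittResidue ℓ F) = t ∧
      (∀ c, ¬ ℓ ∣ c → ∃ B, sylvester T c * B * sylvester T c = sylvester T c) ∧
      (∃ B, (T - 1) * B * (T - 1) = T - 1) ∧ ∃ N, ¬ ℓ ∣ N ∧ T.det ^ N = 1 := by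
  let τ : Module.End F (Fin n → F) := toLin' t
  have hτ : τ ^ j = 1 := by
    rw [← toLin'_pow, ht, toLin'_one]; rfl
  obtain ⟨ι, hι, f, e, red, hf, hN, hsurj, hredP, hker, hlift⟩ :=
    exists_module_lift (ℓ := ℓ) τ hj hτ
  have hfin : ∀ i, Module.Finite (WittVector ℓ F) ((WittVector ℓ F)[X] ⧸ Ideal.span {f i ^ e i}) :=
    fun i => ((hf i).pow (e i)).finite_quotient
  have hfree : ∀ i, Module.Free (WittVector ℓ F) ((WittVector ℓ F)[X] ⧸ Ideal.span {f i ^ e i}) :=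
    fun i => ((hf i).pow (e i)).free_quotient
  have hC : ∀ (w : WittVector ℓ F) (m : ∀ i, (WittVector ℓ F)[X] ⧸ Ideal.span {f i ^ e i}),
      w • m = (C w : (WittVector ℓ F)[X]) • m := fun w m =>
    (algebraMap_smul (WittVector ℓ F)[X] w m).symm
  obtain ⟨b, hb⟩ := exists_basis_of_reduction red hsurj
    (fun w m => by rw [hC, hredP, map_C, aeval_C]; rfl)
    (fun m hm => by
      obtain ⟨m', rfl⟩ := hker m hm
      exact ⟨m', by rw [hC, map_natCast]⟩)
  classical
  let act := Algebra.lsmul (WittVector ℓ F) (WittVector ℓ F)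
    (∀ i, (WittVector ℓ F)[X] ⧸ Ideal.span {f i ^ e i}) (A := (WittVector ℓ F)[X])
  let mat := LinearMap.toMatrixAlgEquiv b
  have hmat : ∀ Y m, mat Y *ᵥ b.equivFun m = b.equivFun (Y m) := fun Y m =>
    LinearMap.toMatrix_mulVec_repr b b Y m
  let T := mat (act X)
  have hT : ∀ P, aeval T P = mat (act P) := fun P => by
    have h1 : aeval T P = mat (aeval (act X) P) := (aeval_algHom_apply mat.toAlgHom (act X) P)
    rw [h1]
    have h2 : aeval (act X) P = act (aeval X P) := aeval_algHom_apply act X P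
    rw [h2, aeval_X_left_apply]
  have hcomp : ∀ {ι κ : Type} [Fintype ι] [Fintype κ] (A : Matrix κ ι (WittVector ℓ F))
      (x : ι → WittVector ℓ F),
      wittResidue ℓ F ∘ (A *ᵥ x) = A.map (wittResidue ℓ F) *ᵥ (wittResidue ℓ F ∘ x) := by
    intro ι κ _ _ A x
    ext i
    exact RingHom.map_mulVec _ _ _ _
  have hmapeq : ∀ (Y : Module.End (WittVector ℓ F) (∀ i, (WittVector ℓ F)[X] ⧸
      Ideal.span {f i ^ e i})) (y : Matrix (Fin n) (Fin n) F),
      (∀ m, red (Y m) = y *ᵥ red m) → (mat Y).map (wittResidue ℓ F) = y := by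
    intro Y y h
    apply toLin'.injective
    refine LinearMap.ext fun v => ?_
    obtain ⟨m, rfl⟩ := hsurj v
    rw [toLin'_apply, toLin'_apply, ← h, hb, hb, ← hcomp, hmat]
  have hTt : T.map (wittResidue ℓ F) = t := hmapeq _ _ fun m => by
    change red ((X : (WittVector ℓ F)[X]) • m) = _
    rw [hredP, map_X, aeval_X]; rfl
  refine ⟨T, hTt, fun c hc => ?_, ?_, ?_⟩
  · refine exists_generalizedInverse (wittResidue ℓ F) wittResidue_surjective _ fun y hy => ?_
    obtain ⟨y, rfl⟩ := vec_surjective y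
    have hc0 : 0 < c := Nat.pos_of_ne_zero fun h0 => hc (h0 ▸ dvd_zero ℓ)
    rw [sylvester_map, sylvester_mulVec_vec, hTt, vec_eq_zero_iff, sub_eq_zero] at hy
    -- A solution of `y t = t ^ c y` is semilinear for the substitution `X ↦ X ^ c`. It is
    -- determined by the images of the cyclic generators `g i`, and it suffices to lift these images
    -- to elements killed by `f i (X ^ c) ^ e i`.
    have hyτ : toLin' y * τ = τ ^ c * toLin' y := by
      have h1 := congrArg toLin' hy
      rw [toLin'_mul, toLin'_mul, toLin'_pow] at h1
      exact h1
    let g : ∀ i, ∀ k, (WittVector ℓ F)[X] ⧸ Ideal.span {f k ^ e k} := fun i =>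
      Pi.single i (Ideal.Quotient.mk _ 1)
    have hg : ∀ i, f i ^ e i • g i = 0 := by
      intro i
      rw [← Pi.single_smul]
      have h2 : (f i ^ e i) • (Ideal.Quotient.mk (Ideal.span {f i ^ e i}) 1) = 0 := by
        change Ideal.Quotient.mk _ (f i ^ e i * 1) = 0
        rw [mul_one, Ideal.Quotient.eq_zero_iff_mem]
        exact Ideal.mem_span_singleton_self _
      rw [h2, Pi.single_zero]
    have hexp : ∀ P : (WittVector ℓ F)[X], aeval τ ((expand _ c P).map (wittResidue ℓ F)) =
        aeval (τ ^ c) (P.map (wittResidue ℓ F)) := fun P => by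
      rw [map_expand, expand_aeval]
    have hm : ∀ i, ∃ m, red m = y *ᵥ red (g i) ∧ expand _ c (f i) ^ e i • m = 0 := by
      intro i
      obtain ⟨N, hN1, hN2⟩ := hN i
      -- Here `ℓ ∤ c` enters: `f i (X ^ c)` divides `X ^ (c * N) - 1` with `c * N` still prime to
      -- `ℓ`, so its torsion lifts.
      refine hlift _ ((hf i).expand hc0) ⟨c * N, fun h => ?_, ?_⟩ (e i) _ ?_
      · exact ((Fact.out : ℓ.Prime).dvd_mul.mp h).elim hc hN1
      · have h3 := map_dvd (expand (WittVector ℓ F) c) hN2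
        rwa [map_sub, map_pow, expand_X, map_one, ← pow_mul] at h3
      · rw [← Polynomial.map_pow, ← map_pow, hexp]
        have h4 := LinearMap.congr_fun
          (mul_aeval_eq_aeval_mul hyτ ((f i ^ e i).map (wittResidue ℓ F))) (red (g i))
        rw [Module.End.mul_apply, Module.End.mul_apply, ← hredP, hg, map_zero, map_zero] at h4
        exact h4.symm
    choose m hm1 hm2 using hm
    obtain ⟨Y, hY1, hY2⟩ := exists_twisted_endomorphism (fun i => f i ^ e i) c m
      (fun i => by rw [map_pow]; exact hm2 i)
    have hYX : Y * act X = act X ^ c * Y := by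
      refine LinearMap.ext fun x => ?_
      rw [← map_pow, ← expand_X]
      exact hY1 X x
    have hYy : (mat Y).map (wittResidue ℓ F) = y := hmapeq _ _ fun x => by
      choose P hP using fun i => Ideal.Quotient.mk_surjective (x i)
      have hx : x = ∑ i, P i • g i := by
        funext k
        rw [Finset.sum_apply, Finset.sum_eq_single k, Pi.smul_apply,
          show g k k = Ideal.Quotient.mk _ 1 from Pi.single_eq_same _ _, ← hP k]
        · change _ = Ideal.Quotient.mk _ (P k * 1)
          rw [mul_one]
        · intro i _ hi
          rw [Pi.smul_apply, show g i k = 0 from Pi.single_eq_of_ne hi.symm _, smul_zero]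
        · exact fun h => absurd (Finset.mem_univ k) h
      rw [hx, map_sum, map_sum, map_sum, mulVec_sum]
      refine Finset.sum_congr rfl fun i _ => ?_
      rw [hY1, hredP, hexp, hY2, hm1, hredP]
      exact (LinearMap.congr_fun
        (mul_aeval_eq_aeval_mul hyτ ((P i).map (wittResidue ℓ F))) (red (g i))).symm
    refine ⟨vec (mat Y), ?_, ?_⟩
    · rw [← hYy]; rfl
    · rw [sylvester_mulVec_vec, vec_eq_zero_iff, sub_eq_zero, ← map_mul, hYX, map_mul, map_pow]
  · refine exists_generalizedInverse (wittResidue ℓ F) wittResidue_surjective _ fun y hy => ?_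
    -- Fixed vectors are the torsion with respect to `X - 1`, a divisor of `X ^ 1 - 1`.
    have h1 : aeval T (X - C 1 : (WittVector ℓ F)[X]) = T - 1 := by
      rw [map_sub, aeval_X, C_1, map_one]
    obtain ⟨m, hm1, hm2⟩ := hlift (X - C 1) (monic_X_sub_C 1)
      ⟨1, (Fact.out : ℓ.Prime).one_lt.ne' ∘ Nat.dvd_one.mp, by rw [pow_one, C_1]⟩ 1 y (by
        rw [Matrix.map_sub _ (map_sub _), hTt, Matrix.map_one _ (map_zero _) (map_one _)] at hy
        rw [pow_one, Polynomial.map_sub, map_X, map_C, map_one, map_sub, aeval_X, C_1, map_one]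
        rw [Matrix.sub_mulVec, Matrix.one_mulVec] at hy
        exact hy)
    refine ⟨b.equivFun m, by rw [← hb, hm1], ?_⟩
    rw [← h1, hT, hmat]
    rw [pow_one] at hm2
    exact (congrArg b.equivFun hm2).trans (map_zero _)
  -- For `N` the product of the `N i`, every `f i` divides `X ^ N - 1`. So `T ^ N - 1` is nilpotent,
  -- and `det T` is a root of unity of order prime to `ℓ`.
  · choose N hN1 hN2 using hN
    refine ⟨∏ i, N i, fun h => ?_, ?_⟩
    · obtain ⟨i, -, hi⟩ := ((Fact.out : ℓ.Prime).prime.dvd_finsetProd_iff _).mp h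
      exact hN1 i hi
    · rw [← Matrix.det_pow]
      apply det_eq_one_of_isNilpotent_sub_one
      refine ⟨∑ i, e i, ?_⟩
      have h2 : (T ^ (∏ i, N i) - 1) ^ (∑ i, e i) =
          aeval T ((X ^ (∏ i, N i) - 1) ^ (∑ i, e i) : (WittVector ℓ F)[X]) := by
        rw [map_pow, map_sub, map_pow, aeval_X, map_one]
      have h3 : act ((X ^ (∏ i, N i) - 1) ^ (∑ i, e i) : (WittVector ℓ F)[X]) = 0 := by
        refine LinearMap.ext fun x => funext fun i => ?_
        obtain ⟨P, hP⟩ := Ideal.Quotient.mk_surjective (x i)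
        change ((X ^ (∏ i, N i) - 1) ^ (∑ i, e i) : (WittVector ℓ F)[X]) • x i = 0
        rw [← hP]
        change Ideal.Quotient.mk _ (_ * P) = 0
        rw [Ideal.Quotient.eq_zero_iff_mem, Ideal.mem_span_singleton]
        refine Dvd.dvd.mul_right ?_ _
        have h4 : f i ∣ X ^ (∏ i, N i) - 1 := by
          obtain ⟨k, hk⟩ := Finset.dvd_prod_of_mem N (Finset.mem_univ i)
          refine (hN2 i).trans ?_
          rw [hk, pow_mul]
          simpa using sub_dvd_pow_sub_pow (X ^ N i : (WittVector ℓ F)[X]) 1 k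
        exact (pow_dvd_pow_of_dvd h4 _).trans
          (pow_dvd_pow _ (Finset.single_le_sum (fun _ _ => Nat.zero_le _) (Finset.mem_univ i)))
      rw [h2, hT, h3, map_zero]

end MatrixLift

end LocalDeformation

/-! ### Continuous representations in terms of their values at the generators. -/

open ValuativeRel IsLocalRing

namespace LocalDeformation

section Continuity

variable {G : Type v} [Group G] {n : ℕ} {R : Type u} [CommRing R]

theorem map_mk_eq_iff {I : Ideal R} {A B : GL (Fin n) R} :
    Matrix.GeneralLinearGroup.map (Ideal.Quotient.mk I) A =
      Matrix.GeneralLinearGroup.map (Ideal.Quotient.mk I) B ↔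
      ∀ i j, A.val i j - B.val i j ∈ I := by
  rw [Units.ext_iff, ← Matrix.ext_iff]
  exact forall_congr' fun i => forall_congr' fun j => Ideal.Quotient.eq

theorem mem_ker_pushRep_mk {I : Ideal R} {ρ : G →* GL (Fin n) R} {g : G} :
    g ∈ (pushRep (Ideal.Quotient.mk I) ρ).ker ↔
      ∀ i j, (ρ g).val i j - (1 : Matrix (Fin n) (Fin n) R) i j ∈ I := by
  rw [MonoidHom.mem_ker, pushRep, MonoidHom.comp_apply,
    ← map_one (Matrix.GeneralLinearGroup.map (Ideal.Quotient.mk I)), map_mk_eq_iff]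
  rfl

theorem eq_of_forall_map_mk_pow_eq [IsLocalRing R] [IsNoetherianRing R] {A B : GL (Fin n) R}
    (h : ∀ k, Matrix.GeneralLinearGroup.map (Ideal.Quotient.mk (maximalIdeal R ^ k)) A =
      Matrix.GeneralLinearGroup.map (Ideal.Quotient.mk (maximalIdeal R ^ k)) B) : A = B := by
  refine Units.ext (Matrix.ext fun i j => sub_eq_zero.mp ?_)
  have h1 : A.val i j - B.val i j ∈ ⨅ k, maximalIdeal R ^ k :=
    Ideal.mem_iInf.mpr fun k => map_mk_eq_iff.mp (h k) i j
  rwa [Ideal.iInf_pow_eq_bot_of_isLocalRing _ (maximalIdeal.isMaximal R).ne_top] at h1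

variable [TopologicalSpace G] [IsTopologicalGroup G]

/-- Modulo `𝔪 ^ k` the target is discrete, so continuity is openness of the kernel at every finite
level. Continuity of the inverse comes from that of `g ↦ g⁻¹`. -/
theorem isContinuousRep_iff [IsLocalRing R] {ρ : G →* GL (Fin n) R} :
    IsContinuousRep ρ ↔
      ∀ k, IsOpen ((pushRep (Ideal.Quotient.mk (maximalIdeal R ^ k)) ρ).ker : Set G) := by
  let _ : TopologicalSpace R := (maximalIdeal R).adicTopology
  have : NonarchimedeanRing R := (maximalIdeal R).nonarchimedean
  have hbasis := fun x => (maximalIdeal R).hasBasis_nhds_adic x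
  change Continuous ρ ↔ _
  constructor
  · intro h k
    refine Subgroup.isOpen_of_mem_nhds _ (g := 1) ?_
    have h1 : ∀ i j, ∀ᶠ g in nhds (1 : G),
        (ρ g).val i j - (1 : Matrix (Fin n) (Fin n) R) i j ∈ maximalIdeal R ^ k := by
      intro i j
      have h2 : Continuous fun g => (ρ g).val i j :=
        (Units.continuous_val.comp h).matrix_elem i j
      have h3 := (hbasis _).tendsto_right_iff.mp (h2.tendsto 1) k trivial
      filter_upwards [h3] with g hg
      obtain ⟨y, hy, hy'⟩ := hg
      rw [map_one] at hy'
      rw [← hy']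
      simpa using hy
    filter_upwards [Filter.eventually_all.mpr fun i => Filter.eventually_all.mpr fun j => h1 i j]
      with g hg
    exact mem_ker_pushRep_mk.mpr hg
  · intro h
    have hval : Continuous fun g => (ρ g).val := by
      refine continuous_matrix fun i j => continuous_iff_continuousAt.mpr fun g => ?_
      rw [ContinuousAt, (hbasis _).tendsto_right_iff]
      intro k _
      have h1 : {σ : G | g⁻¹ * σ ∈ (pushRep (Ideal.Quotient.mk (maximalIdeal R ^ k)) ρ).ker} ∈
          nhds g := by
        refine ((h k).preimage (continuous_const_mul g⁻¹)).mem_nhds ?_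
        rw [Set.mem_preimage, inv_mul_cancel]
        exact one_mem _
      filter_upwards [h1] with σ hσ
      have h2 : pushRep (Ideal.Quotient.mk (maximalIdeal R ^ k)) ρ σ =
          pushRep (Ideal.Quotient.mk (maximalIdeal R ^ k)) ρ g := by
        rw [MonoidHom.mem_ker, map_mul, map_inv, inv_mul_eq_one] at hσ
        exact hσ.symm
      exact ⟨_, map_mk_eq_iff.mp h2 i j, by simp⟩
    exact Units.continuous_iff.mpr ⟨hval, by
      simp_rw [← map_inv]
      exact hval.comp continuous_inv⟩

end Continuity

section PowerCongruence

variable {n : ℕ} {R : Type u} [CommRing R] [IsLocalRing R]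

/-- Matrices congruent to the identity generate pro-`ℓ` groups. -/
theorem pow_pow_sub_one_mem {ℓ : ℕ} (hℓ : (ℓ : R) ∈ maximalIdeal R)
    {A : Matrix (Fin n) (Fin n) R} (hA : ∀ i j, (A - 1) i j ∈ maximalIdeal R) (a : ℕ) :
    ∀ i j, (A ^ ℓ ^ a - 1) i j ∈ maximalIdeal R ^ (a + 1) := by
  have hcongr : ∀ {B : Matrix (Fin n) (Fin n) R}, (∀ i j, (B - 1) i j ∈ maximalIdeal R) →
      ∀ (k : ℕ) (i j : Fin n), (B ^ k - 1) i j ∈ maximalIdeal R := by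
    intro B hB k
    induction k with
    | zero => intro i j; simp
    | succ k ih =>
      intro i j
      rw [show B ^ (k + 1) - 1 = B ^ k * (B - 1) + (B ^ k - 1) by rw [pow_succ]; noncomm_ring,
        Matrix.add_apply, Matrix.mul_apply]
      exact add_mem (sum_mem fun k _ => Ideal.mul_mem_left _ _ (hB k j)) (ih i j)
  induction a with
  | zero => simpa using hA
  | succ a ih =>
    intro i j
    have h1 := hcongr hA (ℓ ^ a)
    obtain ⟨B, hB⟩ : ∃ B, B = A ^ ℓ ^ a := ⟨_, rfl⟩
    rw [← hB] at h1 ih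
    rw [pow_succ ℓ, pow_mul, ← hB]
    -- Write `B ^ ℓ - 1 = (B - 1) (1 + B + ⋯ + B ^ (ℓ - 1))`. The second factor is congruent to `ℓ`
    -- and so has entries in the maximal ideal.
    rw [← mul_geom_sum, Matrix.mul_apply, pow_succ]
    refine sum_mem fun k _ => Ideal.mul_mem_mul (ih i k) ?_
    have h2 : ∀ k j, (∑ m ∈ Finset.range ℓ, (B ^ m - 1)) k j ∈ maximalIdeal R := fun k j => by
      rw [Matrix.sum_apply]
      exact sum_mem fun m _ => hcongr h1 m k j
    have h3 := h2 k j
    rw [Finset.sum_sub_distrib, Matrix.sub_apply, Finset.sum_const, Finset.card_range] at h3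
    refine (Submodule.sub_mem_iff_left _ ?_).mp h3
    rw [Matrix.smul_apply, nsmul_eq_mul]
    exact Ideal.mul_mem_right _ _ hℓ

theorem map_mk_pow_pow_eq_one {ℓ : ℕ} (hℓ : (ℓ : R) ∈ maximalIdeal R) {A : GL (Fin n) R}
    (hA : ∀ i j, (A.val - 1) i j ∈ maximalIdeal R) (k : ℕ) :
    Matrix.GeneralLinearGroup.map (Ideal.Quotient.mk (maximalIdeal R ^ k)) A ^ ℓ ^ k = 1 := by
  rw [← map_pow, ← map_one (Matrix.GeneralLinearGroup.map (Ideal.Quotient.mk (maximalIdeal R ^ k))),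
    map_mk_eq_iff]
  intro i j
  exact Ideal.pow_le_pow_right (Nat.le_succ k) (pow_pow_sub_one_mem hℓ hA k i j)

end PowerCongruence

section Limit

variable {G : Type v} [Group G] {n : ℕ} {R : Type u} [CommRing R]

/-- Compatible representations modulo the powers of the maximal ideal of a complete ring come from
a representation over that ring. -/
theorem exists_limit_representation [IsLocalRing R] [IsNoetherianRing R]
    [IsAdicComplete (maximalIdeal R) R]
    (ψ : ∀ k, G →* GL (Fin n) (R ⧸ maximalIdeal R ^ k))
    (hψ : ∀ k l (h : k ≤ l), pushRep (Ideal.Quotient.factor (Ideal.pow_le_pow_right h)) (ψ l) =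
      ψ k) :
    ∃ ρ : G →* GL (Fin n) R, ∀ k, pushRep (Ideal.Quotient.mk (maximalIdeal R ^ k)) ρ = ψ k := by
  choose x hx using fun g k i j => Ideal.Quotient.mk_surjective ((ψ k g).val i j)
  have hcompat : ∀ g i j, ∀ {k l}, k ≤ l →
      x g k i j ≡ x g l i j [SMOD (maximalIdeal R ^ k • ⊤ : Submodule R R)] := by
    intro g i j k l hkl
    rw [SModEq.sub_mem, smul_eq_mul, Ideal.mul_top, ← Ideal.Quotient.eq, hx,
      ← Ideal.Quotient.factor_mk (Ideal.pow_le_pow_right hkl), hx, ← hψ k l hkl]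
    rfl
  choose L hL using fun g i j => IsPrecomplete.prec' (I := maximalIdeal R) (fun k => x g k i j)
    (hcompat g i j)
  have hLmk : ∀ g i j k, Ideal.Quotient.mk (maximalIdeal R ^ k) (L g i j) = (ψ k g).val i j := by
    intro g i j k
    have h1 := hL g i j k
    rw [SModEq.sub_mem, smul_eq_mul, Ideal.mul_top, ← Ideal.Quotient.eq, hx] at h1
    exact h1.symm
  have hext : ∀ A B : Matrix (Fin n) (Fin n) R,
      (∀ k, (Ideal.Quotient.mk (maximalIdeal R ^ k)).mapMatrix A =
        (Ideal.Quotient.mk (maximalIdeal R ^ k)).mapMatrix B) → A = B := by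
    intro A B h
    refine Matrix.ext fun i j => sub_eq_zero.mp ?_
    have h1 : A i j - B i j ∈ ⨅ k, maximalIdeal R ^ k := Ideal.mem_iInf.mpr fun k =>
      Ideal.Quotient.eq.mp (congrFun (congrFun (h k) i) j)
    rwa [Ideal.iInf_pow_eq_bot_of_isLocalRing _ (maximalIdeal.isMaximal R).ne_top] at h1
  have hM : ∀ g k, (Ideal.Quotient.mk (maximalIdeal R ^ k)).mapMatrix (Matrix.of (L g)) =
      (ψ k g).val := fun g k => Matrix.ext fun i j => hLmk g i j k
  let ρ : G →* Matrix (Fin n) (Fin n) R :=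
    { toFun := fun g => Matrix.of (L g)
      map_one' := hext _ _ fun k => by rw [hM, map_one, map_one]; rfl
      map_mul' := fun g h => hext _ _ fun k => by rw [map_mul, hM, hM, hM, map_mul]; rfl }
  exact ⟨ρ.toHomUnits, fun k => MonoidHom.ext fun g => Units.ext (hM g k)⟩

end Limit

namespace TameGenerators

variable {p : ℕ} [Fact p.Prime] {G : Type v} [Group G] [TopologicalSpace G] [IsTopologicalGroup G]
  {I P : Subgroup G} {q : ℕ} {s t : G}

/-- A homomorphism with open kernel that is trivial on `P` is determined by its values on the
generators. -/
theorem hom_ext (h : TameGenerators.{v, u} p I P q s t) {H : Type*} [Group H] {φ ψ : G →* H}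
    (hφ : IsOpen (φ.ker : Set G)) (hψ : IsOpen (ψ.ker : Set G)) (hs : φ s = ψ s) (ht : φ t = ψ t)
    (hφP : ∀ σ ∈ P, φ σ = 1) (hψP : ∀ σ ∈ P, ψ σ = 1) : φ = ψ := by
  have hopen : IsOpen (φ.eqLocus ψ : Set G) := by
    refine Subgroup.isOpen_mono (H₁ := φ.ker ⊓ ψ.ker) ?_ (hφ.inter hψ)
    rintro σ ⟨h1, h2⟩
    exact (MonoidHom.mem_ker.mp h1).trans (MonoidHom.mem_ker.mp h2).symm
  have htop := h.eq_top _ hopen hs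
    (h.inertia_le _ hopen ht fun σ hσ => (hφP σ hσ).trans (hψP σ hσ).symm)
  exact MonoidHom.ext fun g => (htop ▸ Subgroup.mem_top g : g ∈ φ.eqLocus ψ)

variable {n : ℕ} {R : Type u} [CommRing R] [IsLocalRing R] [IsNoetherianRing R]

/-- A continuous representation that is trivial on `P` modulo the maximal ideal is trivial
on `P`. -/
theorem eq_one_of_mem (h : TameGenerators.{v, u} p I P q s t) {ℓ : ℕ} [Fact ℓ.Prime] (hpℓ : ℓ ≠ p)
    (hℓ : (ℓ : R) ∈ maximalIdeal R) {ρ : G →* GL (Fin n) R} (hρ : IsContinuousRep ρ)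
    (hP : ∀ σ ∈ P, ∀ i j, ((ρ σ).val - 1) i j ∈ maximalIdeal R) {σ : G} (hσ : σ ∈ P) :
    ρ σ = 1 := by
  refine eq_of_forall_map_mk_pow_eq fun k => ?_
  rw [map_one]
  obtain ⟨a, ha⟩ := h.wild_pow σ hσ _ (isContinuousRep_iff.mp hρ k)
  rw [MonoidHom.mem_ker, map_pow] at ha
  -- Modulo `𝔪 ^ k` the value at a wild element has both `p`-power and `ℓ`-power order.
  have h1 := pow_gcd_eq_one.mpr ⟨ha, map_mk_pow_pow_eq_one hℓ (hP σ hσ) k⟩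
  rwa [Nat.Coprime.gcd_eq_one (Nat.Coprime.pow _ _
    ((Nat.coprime_primes Fact.out Fact.out).mpr hpℓ.symm)), pow_one] at h1

/-- Continuous representations that are trivial on `P` are determined by their values on the
generators. -/
theorem representation_ext (h : TameGenerators.{v, u} p I P q s t) {ρ ρ' : G →* GL (Fin n) R}
    (hρ : IsContinuousRep ρ) (hρ' : IsContinuousRep ρ') (hs : ρ s = ρ' s) (ht : ρ t = ρ' t)
    (hP : ∀ σ ∈ P, ρ σ = 1) (hP' : ∀ σ ∈ P, ρ' σ = 1) : ρ = ρ' := by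
  refine MonoidHom.ext fun g => eq_of_forall_map_mk_pow_eq fun k => ?_
  have h1 := h.hom_ext (isContinuousRep_iff.mp hρ k) (isContinuousRep_iff.mp hρ' k)
    (by rw [pushRep, MonoidHom.comp_apply, hs]; rfl)
    (by rw [pushRep, MonoidHom.comp_apply, ht]; rfl)
    (fun σ hσ => by rw [pushRep, MonoidHom.comp_apply, hP σ hσ, map_one])
    (fun σ hσ => by rw [pushRep, MonoidHom.comp_apply, hP' σ hσ, map_one])
  exact DFunLike.congr_fun h1 g

/-- Existence of continuous representations with given values on the generators. -/
theorem exists_representation (h : TameGenerators.{v, u} p I P q s t) {ℓ : ℕ} [Fact ℓ.Prime]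
    (hpℓ : ℓ ≠ p) (hℓ : (ℓ : R) ∈ maximalIdeal R) [IsAdicComplete (maximalIdeal R) R]
    [Finite (R ⧸ maximalIdeal R)] {S T : GL (Fin n) R} (hST : S * T * S⁻¹ = T ^ q) {j : ℕ}
    (hj : ¬ p ∣ j) (hT : ∀ a b, ((T ^ j).val - 1) a b ∈ maximalIdeal R) :
    ∃ ρ : G →* GL (Fin n) R, IsContinuousRep ρ ∧ ρ s = S ∧ ρ t = T ∧ ∀ σ ∈ P, ρ σ = 1 := by
  have hfin : ∀ k, Finite (R ⧸ maximalIdeal R ^ k) := fun k =>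
    Ideal.finite_quotient_pow (IsNoetherian.noetherian _) k
  have hex : ∀ k, ∃ ψ : G →* GL (Fin n) (R ⧸ maximalIdeal R ^ k), IsOpen (ψ.ker : Set G) ∧
      ψ s = Matrix.GeneralLinearGroup.map (Ideal.Quotient.mk (maximalIdeal R ^ k)) S ∧
      ψ t = Matrix.GeneralLinearGroup.map (Ideal.Quotient.mk (maximalIdeal R ^ k)) T ∧
      P ≤ ψ.ker := by
    intro k
    -- The group is finite modulo `𝔪 ^ k`. Since `T ^ j ≡ 1` modulo `𝔪`, the exponent `j * ℓ ^ k`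
    -- kills `T` there and is prime to `p`.
    refine h.exists_hom _ _ _ (by rw [← map_mul, ← map_inv, ← map_mul, hST, map_pow])
      ⟨j * ℓ ^ k, fun hd => ?_, ?_⟩
    · rcases (Fact.out : p.Prime).dvd_mul.mp hd with h1 | h1
      · exact hj h1
      · exact hpℓ ((Nat.prime_dvd_prime_iff_eq Fact.out Fact.out).mp
          ((Fact.out : p.Prime).dvd_of_dvd_pow h1)).symm
    · rw [pow_mul, ← map_pow]
      exact map_mk_pow_pow_eq_one hℓ hT k
  choose ψ hψ1 hψ2 hψ3 hψ4 using hex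
  -- The finite levels are compatible because each is determined by its values at `s` and `t`.
  obtain ⟨ρ, hρ⟩ := exists_limit_representation ψ (fun k l hkl => by
    refine h.hom_ext ?_ (hψ1 k) ?_ ?_ ?_ fun σ hσ => hψ4 k hσ
    · refine Subgroup.isOpen_mono (fun σ hσ => ?_) (hψ1 l)
      rw [MonoidHom.mem_ker] at hσ ⊢
      rw [pushRep, MonoidHom.comp_apply, hσ, map_one]
    · rw [pushRep, MonoidHom.comp_apply, hψ2, hψ2]; rfl
    · rw [pushRep, MonoidHom.comp_apply, hψ3, hψ3]; rfl
    · intro σ hσ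
      rw [pushRep, MonoidHom.comp_apply, MonoidHom.mem_ker.mp (hψ4 l hσ), map_one])
  have hρ' : ∀ k g, Matrix.GeneralLinearGroup.map (Ideal.Quotient.mk (maximalIdeal R ^ k)) (ρ g) =
      ψ k g := fun k g => DFunLike.congr_fun (hρ k) g
  refine ⟨ρ, isContinuousRep_iff.mpr fun k => by rw [hρ]; exact hψ1 k,
    eq_of_forall_map_mk_pow_eq fun k => by rw [hρ', hψ2],
    eq_of_forall_map_mk_pow_eq fun k => by rw [hρ', hψ3], fun σ hσ =>
    eq_of_forall_map_mk_pow_eq fun k => by rw [hρ', MonoidHom.mem_ker.mp (hψ4 k hσ), map_one]⟩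

end TameGenerators

end LocalDeformation

/-! ### The deformation condition, conjugation and functoriality. -/

open ValuativeRel IsLocalRing

namespace LocalDeformation

namespace CoeffRing

variable {ℓ : ℕ} [Fact ℓ.Prime] {F : Type u} [Field F] (R : CoeffRing ℓ F)

theorem mem_maximalIdeal_iff {r : R} : r ∈ maximalIdeal R ↔ R.residue r = 0 := by
  rw [← R.ker_residue, RingHom.mem_ker]

theorem natCast_mem_maximalIdeal [CharP F ℓ] : (ℓ : R) ∈ maximalIdeal R := by
  rw [mem_maximalIdeal_iff, map_natCast, CharP.cast_eq_zero]

theorem finite_residue [Finite F] : Finite (R ⧸ maximalIdeal R) := by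
  rw [← R.ker_residue]
  exact Finite.of_injective _ (RingHom.kerLift_injective R.residue)

theorem isUnit_iff {r : R} : IsUnit r ↔ R.residue r ≠ 0 := by
  rw [← not_iff_not, not_not, ← mem_maximalIdeal_iff, mem_maximalIdeal]; rfl

theorem Hom.map_mem {R S : CoeffRing ℓ F} (f : R.Hom S) {k : ℕ} {r : R}
    (h : r ∈ maximalIdeal R ^ k) : f.toAlgHom r ∈ maximalIdeal S ^ k := by
  have h1 : (maximalIdeal R ^ k).map f.toAlgHom ≤ maximalIdeal S ^ k := by
    rw [Ideal.map_pow]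
    refine Ideal.pow_right_mono (Ideal.map_le_iff_le_comap.mpr fun x hx => ?_) k
    rw [Ideal.mem_comap, mem_maximalIdeal_iff, f.residue_comp]
    exact (R.mem_maximalIdeal_iff).mp hx
  exact h1 (Ideal.mem_map_of_mem _ h)

/-- Matrices that are invertible modulo the maximal ideal are invertible. -/
theorem exists_unit_of_map_residue {n : ℕ} {A : Matrix (Fin n) (Fin n) R} {B : GL (Fin n) F}
    (h : A.map R.residue = B.val) :
    ∃ a : GL (Fin n) R, a.val = A ∧ Matrix.GeneralLinearGroup.map R.residue a = B := by
  have h1 : IsUnit A := by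
    rw [Matrix.isUnit_iff_isUnit_det, isUnit_iff, RingHom.map_det]
    change (A.map R.residue).det ≠ 0
    rw [h]
    exact ((Matrix.isUnit_iff_isUnit_det _).mp B.isUnit).ne_zero
  obtain ⟨a, rfl⟩ := h1
  exact ⟨a, rfl, Units.ext h⟩

end CoeffRing

section

variable {ℓ : ℕ} [Fact ℓ.Prime] {F : Type u} [Field F]
  {G : Type v} [Group G] [TopologicalSpace G] {n : ℕ}

/-- The lifts of determinant the Teichmüller lift whose value at `t` is strictly equivalent to
`T`. -/
def minimalLifts (ρbar : G →* GL (Fin n) F) (T : Matrix (Fin n) (Fin n) (WittVector ℓ F)) (t : G)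
    (R : CoeffRing ℓ F) : Set (G →* GL (Fin n) R) :=
  {ρ | IsLift ρbar (teichmullerDet ℓ ρbar) R ρ ∧
    ∃ Y : GL (Fin n) R, Matrix.GeneralLinearGroup.map R.residue Y = 1 ∧
      (ρ t).val * Y.val = Y.val * T.map (algebraMap (WittVector ℓ F) R)}

/-- The hypotheses under which the lifts in `minimalLifts` are well behaved. -/
structure LiftData.{w, z} {ℓ : ℕ} [Fact ℓ.Prime] {F : Type w} [Field F]
    {G : Type z} [Group G] [TopologicalSpace G] {n : ℕ}
    (p : ℕ) (I P : Subgroup G) (q : ℕ) (s t : G) (ρbar : G →* GL (Fin n) F)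
    (T : Matrix (Fin n) (Fin n) (WittVector ℓ F)) : Prop where
  gen : TameGenerators.{z, w} p I P q s t
  ne : ℓ ≠ p
  continuous : IsContinuousRep ρbar
  tame : ∀ σ ∈ P, ρbar σ = 1
  map_eq : T.map (wittResidue ℓ F) = (ρbar t).val
  comm : ∃ B, sylvester T 1 * B * sylvester T 1 = sylvester T 1
  frob : ∃ B, sylvester T q * B * sylvester T q = sylvester T q
  fixed : ∃ B, (T - 1) * B * (T - 1) = T - 1
  det_pow : ∃ N, ¬ ℓ ∣ N ∧ T.det ^ N = 1

theorem residue_val {ρbar : G →* GL (Fin n) F} {η : G →* (WittVector ℓ F)ˣ} {R : CoeffRing ℓ F}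
    {ρ : G →* GL (Fin n) R} (h : IsLift ρbar η R ρ) (g : G) :
    (ρ g).val.map R.residue = (ρbar g).val :=
  congrArg Units.val (DFunLike.congr_fun h.reduction g)

/-- Solutions of `Z T = T ^ c Z` lift along surjections. -/
theorem exists_lift_intertwiner {T : Matrix (Fin n) (Fin n) (WittVector ℓ F)} {c : ℕ}
    (hB : ∃ B, sylvester T c * B * sylvester T c = sylvester T c)
    {R S : Type*} [CommRing R] [CommRing S] [Algebra (WittVector ℓ F) R]
    [Algebra (WittVector ℓ F) S] (f : R →ₐ[WittVector ℓ F] S) (hf : Function.Surjective f)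
    (Z : Matrix (Fin n) (Fin n) S)
    (hZ : Z * T.map (algebraMap (WittVector ℓ F) S) =
      T.map (algebraMap (WittVector ℓ F) S) ^ c * Z) :
    ∃ Z' : Matrix (Fin n) (Fin n) R, Z'.map f = Z ∧
      Z' * T.map (algebraMap (WittVector ℓ F) R) =
        T.map (algebraMap (WittVector ℓ F) R) ^ c * Z' := by
  obtain ⟨B, hB⟩ := hB
  obtain ⟨x, hx, hx0⟩ := exists_lift_of_generalizedInverse f hf hB (Matrix.vec Z) (by
    rw [sylvester_map, sylvester_mulVec_vec, hZ, sub_self, Matrix.vec_zero])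
  obtain ⟨Z', rfl⟩ := vec_surjective x
  rw [sylvester_map, sylvester_mulVec_vec, Matrix.vec_eq_zero_iff, sub_eq_zero] at hx0
  exact ⟨Z', Matrix.ext fun i j => congrFun hx (j, i), hx0⟩

theorem map_map_algebraMap (T : Matrix (Fin n) (Fin n) (WittVector ℓ F)) {R S : Type*} [CommRing R]
    [CommRing S] [Algebra (WittVector ℓ F) R] [Algebra (WittVector ℓ F) S]
    (f : R →ₐ[WittVector ℓ F] S) :
    (T.map (algebraMap (WittVector ℓ F) R)).map f = T.map (algebraMap (WittVector ℓ F) S) :=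
  Matrix.ext fun _ _ => f.commutes _

theorem map_residue_algebraMap (T : Matrix (Fin n) (Fin n) (WittVector ℓ F)) (R : CoeffRing ℓ F) :
    (T.map (algebraMap (WittVector ℓ F) R)).map R.residue = T.map (wittResidue ℓ F) :=
  Matrix.ext fun _ _ => R.residue_algebraMap _

end

section

variable {ℓ : ℕ} [Fact ℓ.Prime] {F : Type u} [Field F]
  {G : Type v} [Group G] [TopologicalSpace G] [IsTopologicalGroup G] {n : ℕ}

theorem IsContinuousRep.of_forall_mem {R S : Type u} [CommRing R] [IsLocalRing R] [CommRing S]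
    [IsLocalRing S] {ρ : G →* GL (Fin n) R} {ρ' : G →* GL (Fin n) S} (hρ : IsContinuousRep ρ)
    (h : ∀ k g, (∀ i j, (ρ g).val i j - (1 : Matrix (Fin n) (Fin n) R) i j ∈ maximalIdeal R ^ k) →
      ∀ i j, (ρ' g).val i j - (1 : Matrix (Fin n) (Fin n) S) i j ∈ maximalIdeal S ^ k) :
    IsContinuousRep ρ' :=
  isContinuousRep_iff.mpr fun k => Subgroup.isOpen_mono
    (fun _ hg => mem_ker_pushRep_mk.mpr (h k _ (mem_ker_pushRep_mk.mp hg)))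
    (isContinuousRep_iff.mp hρ k)

theorem IsContinuousRep.isOpen_ker {ρbar : G →* GL (Fin n) F} (h : IsContinuousRep ρbar) :
    IsOpen (ρbar.ker : Set G) := by
  refine Subgroup.isOpen_mono (fun g hg => ?_) (isContinuousRep_iff.mp h 1)
  rw [mem_ker_pushRep_mk, pow_one, maximalIdeal_eq_bot] at hg
  exact Units.ext (Matrix.ext fun i j => sub_eq_zero.mp (hg i j))

theorem IsContinuousRep.conj {R : Type u} [CommRing R] [IsLocalRing R] {ρ : G →* GL (Fin n) R}
    (hρ : IsContinuousRep ρ) (M : GL (Fin n) R) :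
    IsContinuousRep ((MulAut.conj M).toMonoidHom.comp ρ) :=
  isContinuousRep_iff.mpr fun k => Subgroup.isOpen_mono (fun g hg => by
    rw [MonoidHom.mem_ker] at hg ⊢
    rw [pushRep, MonoidHom.comp_apply] at hg
    change Matrix.GeneralLinearGroup.map _ (M * ρ g * M⁻¹) = 1
    rw [map_mul, map_mul, hg, mul_one, ← map_mul, mul_inv_cancel, map_one])
    (isContinuousRep_iff.mp hρ k)

theorem IsContinuousRep.push {R S : CoeffRing ℓ F} (f : R.Hom S) {ρ : G →* GL (Fin n) R}
    (hρ : IsContinuousRep ρ) : IsContinuousRep (pushRep (f.toAlgHom : R →+* S) ρ) :=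
  hρ.of_forall_mem fun k g h i j => by
    have h1 := f.map_mem (h i j)
    rw [map_sub] at h1
    have h2 : f.toAlgHom ((1 : Matrix (Fin n) (Fin n) R) i j) =
        (1 : Matrix (Fin n) (Fin n) S) i j := by
      rw [Matrix.one_apply, Matrix.one_apply, apply_ite f.toAlgHom, map_one, map_zero]
    rwa [h2] at h1

theorem IsLift.conj {ρbar : G →* GL (Fin n) F} {η : G →* (WittVector ℓ F)ˣ} {R : CoeffRing ℓ F}
    {ρ : G →* GL (Fin n) R} (h : IsLift ρbar η R ρ) {M : GL (Fin n) R}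
    (hM : Matrix.GeneralLinearGroup.map R.residue M = 1) :
    IsLift ρbar η R ((MulAut.conj M).toMonoidHom.comp ρ) where
  continuous := h.continuous.conj M
  reduction := by
    rw [← h.reduction]
    refine MonoidHom.ext fun g => ?_
    change Matrix.GeneralLinearGroup.map _ (M * ρ g * M⁻¹) = _
    rw [map_mul, map_mul, map_inv, hM, inv_one, one_mul, mul_one]; rfl
  det_eq g := by
    rw [← h.det_eq g]
    change Matrix.GeneralLinearGroup.det (M * ρ g * M⁻¹) = _
    rw [map_mul, map_mul, map_inv, mul_right_comm, mul_inv_cancel, one_mul]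

theorem IsLift.push {ρbar : G →* GL (Fin n) F} {η : G →* (WittVector ℓ F)ˣ} {R S : CoeffRing ℓ F}
    (f : R.Hom S) {ρ : G →* GL (Fin n) R} (h : IsLift ρbar η R ρ) :
    IsLift ρbar η S (pushRep (f.toAlgHom : R →+* S) ρ) where
  continuous := h.continuous.push f
  reduction := by
    rw [← h.reduction]
    exact MonoidHom.ext fun g => Units.ext (Matrix.ext fun i j => f.residue_comp _)
  det_eq g := by
    have h1 := congrArg (Units.map (f.toAlgHom : R →* S)) (h.det_eq g)
    refine Eq.trans ?_ (h1.trans ?_)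
    · exact Units.ext (RingHom.map_det (f.toAlgHom : R →+* S) (ρ g).val).symm
    · exact Units.ext (f.toAlgHom.commutes _)

variable [CharP F ℓ] [Finite F]

namespace LiftData

variable {p : ℕ} [Fact p.Prime] {I P : Subgroup G} {q : ℕ} {s t : G} {ρbar : G →* GL (Fin n) F}
  {T : Matrix (Fin n) (Fin n) (WittVector ℓ F)}

theorem eq_one_of_mem (h : LiftData p I P q s t ρbar T) {η : G →* (WittVector ℓ F)ˣ}
    {R : CoeffRing ℓ F} {ρ : G →* GL (Fin n) R} (hρ : IsLift ρbar η R ρ) {σ : G} (hσ : σ ∈ P) :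
    ρ σ = 1 :=
  h.gen.eq_one_of_mem h.ne R.natCast_mem_maximalIdeal hρ.continuous (fun σ hσ i j => by
    have h1 := congrFun (congrFun (residue_val hρ σ) i) j
    rw [h.tame σ hσ, Matrix.map_apply] at h1
    rw [R.mem_maximalIdeal_iff, Matrix.sub_apply, map_sub, h1, Units.val_one, Matrix.one_apply,
      Matrix.one_apply, apply_ite R.residue, map_one, map_zero, sub_self]) hσ

theorem relation (h : LiftData p I P q s t ρbar T) {η : G →* (WittVector ℓ F)ˣ}
    {R : CoeffRing ℓ F} {ρ : G →* GL (Fin n) R} (hρ : IsLift ρbar η R ρ) :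
    ρ s * ρ t * (ρ s)⁻¹ = ρ t ^ q := by
  have h1 := h.eq_one_of_mem hρ h.gen.relation
  rwa [map_mul, map_mul, map_mul, map_inv, map_inv, map_pow, mul_inv_eq_one] at h1

/-- The order of `ρbar t` is prime to `p`. -/
theorem exists_pow_eq_one (h : LiftData p I P q s t ρbar T) : ∃ j, ¬ p ∣ j ∧ ρbar t ^ j = 1 := by
  obtain ⟨j, hj, hj2⟩ := h.gen.exists_pow_mem _ h.continuous.isOpen_ker h.tame
  exact ⟨j, hj, by rw [← map_pow]; exact hj2⟩

/-- The lift with given values on the generators. -/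
theorem exists_representation (h : LiftData p I P q s t ρbar T) {R : CoeffRing ℓ F}
    {S T' : GL (Fin n) R} (hST : S * T' * S⁻¹ = T' ^ q)
    (hT : Matrix.GeneralLinearGroup.map R.residue T' = ρbar t) :
    ∃ ρ : G →* GL (Fin n) R, IsContinuousRep ρ ∧ ρ s = S ∧ ρ t = T' ∧ ∀ σ ∈ P, ρ σ = 1 := by
  obtain ⟨j, hj, hj1⟩ := h.exists_pow_eq_one
  have := R.finite_residue
  refine h.gen.exists_representation h.ne R.natCast_mem_maximalIdeal hST hj fun a b => ?_
  rw [← hT, ← map_pow] at hj1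
  have h1 : R.residue ((T' ^ j).val a b) = (1 : Matrix (Fin n) (Fin n) F) a b := by
    rw [← Units.val_one, ← hj1]; rfl
  rw [R.mem_maximalIdeal_iff, Matrix.sub_apply, map_sub, sub_eq_zero, h1]
  rw [Matrix.one_apply, Matrix.one_apply, apply_ite R.residue, map_one, map_zero]

/-- Both sides are `N`-th roots of unity with the same residue `d`, where `ℓ ∤ N`. The cofactor of
their difference in `x ^ N - y ^ N` has residue `N * d ^ (N - 1)`, so it is a unit and the
difference vanishes. -/
theorem det_eq (h : LiftData p I P q s t ρbar T) : T.det = teichmullerDet ℓ ρbar t := by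
  obtain ⟨N, hN, hN1⟩ := h.det_pow
  have hN0 : 0 < N := Nat.pos_of_ne_zero fun h0 => hN (h0 ▸ dvd_zero ℓ)
  have h1 : wittResidue ℓ F T.det = (ρbar t).val.det := by
    rw [RingHom.map_det, ← h.map_eq]; rfl
  have h2 : (teichmullerDet ℓ ρbar t : WittVector ℓ F) =
    WittVector.teichmuller ℓ (ρbar t).val.det := rfl
  have h3 : (ρbar t).val.det ^ N = 1 := by rw [← h1, ← map_pow, hN1, map_one]
  have h4 : (teichmullerDet ℓ ρbar t : WittVector ℓ F) ^ N = 1 := by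
    rw [h2, ← map_pow, h3, map_one]
  have h5 := geom_sum₂_mul T.det (teichmullerDet ℓ ρbar t : WittVector ℓ F) N
  rw [hN1, h4, sub_self] at h5
  have h6 : wittResidue ℓ F (∑ i ∈ Finset.range N, T.det ^ i *
      (teichmullerDet ℓ ρbar t : WittVector ℓ F) ^ (N - 1 - i)) ≠ 0 := by
    rw [map_sum]
    have h7 : ∀ i ∈ Finset.range N, wittResidue ℓ F (T.det ^ i *
        (teichmullerDet ℓ ρbar t : WittVector ℓ F) ^ (N - 1 - i)) =
        (ρbar t).val.det ^ (N - 1) := by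
      intro i hi
      rw [map_mul, map_pow, map_pow, h1, h2, wittResidue_teichmuller, ← pow_add]
      congr 1
      have := Finset.mem_range.mp hi
      omega
    rw [Finset.sum_congr rfl h7, Finset.sum_const, Finset.card_range, nsmul_eq_mul]
    refine mul_ne_zero (fun h0 => hN ((CharP.cast_eq_zero_iff F ℓ N).mp h0)) (pow_ne_zero _ ?_)
    intro h0
    rw [h0, zero_pow hN0.ne'] at h3
    exact zero_ne_one h3
  exact sub_eq_zero.mp (((isUnit_of_wittResidue_ne_zero h6).mul_right_eq_zero).mp h5)

theorem minimalLifts_P1 (h : LiftData p I P q s t ρbar T) :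
    ρbar ∈ minimalLifts ρbar T t (CoeffRing.residueField ℓ F) := by
  refine ⟨⟨h.continuous, rfl, fun g => Units.ext ?_⟩, 1, map_one _, ?_⟩
  · exact (wittResidue_teichmuller (ℓ := ℓ) (ρbar g).val.det).symm
  · rw [Units.val_one, mul_one, one_mul]
    exact h.map_eq.symm

omit [CharP F ℓ] [Finite F] in
theorem minimalLifts_P2 (R : CoeffRing ℓ F) {ρ : G →* GL (Fin n) R}
    (hρ : ρ ∈ minimalLifts ρbar T t R) {M : GL (Fin n) R}
    (hM : Matrix.GeneralLinearGroup.map R.residue M = 1) :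
    (MulAut.conj M).toMonoidHom.comp ρ ∈ minimalLifts ρbar T t R := by
  obtain ⟨h1, Y, hY, hYT⟩ := hρ
  refine ⟨h1.conj hM, M * Y, by rw [map_mul, hM, hY, one_mul], ?_⟩
  change (M * ρ t * M⁻¹).val * (M * Y).val = (M * Y).val * _
  rw [← Units.val_mul, show M * ρ t * M⁻¹ * (M * Y) = M * (ρ t * Y) by group, Units.val_mul,
    Units.val_mul, hYT, Units.val_mul, mul_assoc]

omit [CharP F ℓ] [Finite F] in
theorem minimalLifts_P3 (R S : CoeffRing ℓ F) (f : R.Hom S) {ρ : G →* GL (Fin n) R}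
    (hρ : ρ ∈ minimalLifts ρbar T t R) :
    pushRep (f.toAlgHom : R →+* S) ρ ∈ minimalLifts ρbar T t S := by
  obtain ⟨h1, Y, hY, hYT⟩ := hρ
  refine ⟨h1.push f, Matrix.GeneralLinearGroup.map (f.toAlgHom : R →+* S) Y, ?_, ?_⟩
  · rw [← hY]
    exact Units.ext (Matrix.ext fun i j => f.residue_comp _)
  · have h2 := congrArg (fun A => A.map f.toAlgHom) hYT
    simp only [Matrix.map_mul, map_map_algebraMap] at h2
    exact h2

end LiftData

end

end LocalDeformation

/-! ### Closure under limits and gluing. -/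

open ValuativeRel IsLocalRing

namespace LocalDeformation

variable {ℓ : ℕ} [Fact ℓ.Prime] {F : Type u} [Field F]
  {G : Type v} [Group G] [TopologicalSpace G] [IsTopologicalGroup G] {n : ℕ}

theorem CoeffRing.map_residue_eq_one_iff {R : CoeffRing ℓ F} {A : Matrix (Fin n) (Fin n) R} :
    A.map R.residue = 1 ↔ ∀ i j, (A - 1) i j ∈ maximalIdeal R := by
  rw [← Matrix.ext_iff]
  refine forall_congr' fun i => forall_congr' fun j => ?_
  rw [R.mem_maximalIdeal_iff, Matrix.sub_apply, map_sub, sub_eq_zero, Matrix.one_apply,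
    Matrix.one_apply, apply_ite R.residue, map_one, map_zero, Matrix.map_apply]

/-- The projection to a quotient, as a morphism of coefficient rings. -/
noncomputable def CoeffRing.mkHom (R : CoeffRing ℓ F) (I : Ideal R) (hI : I ≠ ⊤) :
    R.Hom (R.quotient I hI) where
  toAlgHom := Ideal.Quotient.mkₐ (WittVector ℓ F) I
  residue_comp _ := rfl

namespace LiftData

section

variable {ρbar : G →* GL (Fin n) F} {T : Matrix (Fin n) (Fin n) (WittVector ℓ F)} {t : G}

omit [IsTopologicalGroup G] in
-- The conjugating matrices at the finite levels need not be compatible. Instead consider the linear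
-- map `D Y = ρ(t) Y - Y T` and the module `N` of matrices over the maximal ideal. The conjugators
-- show that `D 1` is arbitrarily close to zero modulo `D N`, so `D 1 ∈ D N` by Krull's intersection
-- theorem, which yields an exact conjugator.
theorem minimalLifts_P5 (R : CoeffRing ℓ F) {ρ : G →* GL (Fin n) R}
    (hρ : IsLift ρbar (teichmullerDet ℓ ρbar) R ρ)
    (h : ∀ k : ℕ, pushRep (Ideal.Quotient.mk (maximalIdeal R ^ (k + 1))) ρ ∈
      minimalLifts ρbar T t
        (R.quotient (maximalIdeal R ^ (k + 1)) (R.maximalIdeal_pow_ne_top k))) :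
    ρ ∈ minimalLifts ρbar T t R := by
  obtain ⟨TR, hTR⟩ : ∃ TR, TR = T.map (algebraMap (WittVector ℓ F) R) := ⟨_, rfl⟩
  have hex : ∀ k : ℕ, ∃ Y : Matrix (Fin n) (Fin n) R, Y.map R.residue = 1 ∧
      ∀ i j, ((ρ t).val * Y - Y * TR) i j ∈ maximalIdeal R ^ (k + 1) := by
    intro k
    obtain ⟨-, Y, hY, hYT⟩ := h k
    choose Y' hY' using fun i j => Ideal.Quotient.mk_surjective (Y.val i j)
    have h1 : (Matrix.of Y').map (Ideal.Quotient.mk (maximalIdeal R ^ (k + 1))) = Y.val :=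
      Matrix.ext hY'
    refine ⟨Matrix.of Y', ?_, fun i j => ?_⟩
    · refine Eq.trans ?_ (congrArg Units.val hY)
      change _ = Y.val.map _
      rw [← h1]; rfl
    · rw [← Ideal.Quotient.eq_zero_iff_mem, ← Matrix.map_apply (f := Ideal.Quotient.mk _),
        Matrix.map_sub _ (map_sub _), Matrix.map_mul, Matrix.map_mul, h1, hTR]
      exact congrFun (congrFun (sub_eq_zero.mpr hYT) i) j
  let D : Matrix (Fin n) (Fin n) R →ₗ[R] Matrix (Fin n) (Fin n) R :=
    LinearMap.mulLeft R (ρ t).val - LinearMap.mulRight R TR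
  let N : Submodule R (Matrix (Fin n) (Fin n) R) :=
    { carrier := {A | ∀ i j, A i j ∈ maximalIdeal R}
      zero_mem' := fun i j => zero_mem _
      add_mem' := fun ha hb i j => add_mem (ha i j) (hb i j)
      smul_mem' := fun c _ ha i j => Ideal.mul_mem_left _ c (ha i j) }
  have hmem : D 1 ∈ N.map D := by
    rw [← Submodule.Quotient.mk_eq_zero, ← Submodule.mem_bot R,
      ← Ideal.iInf_pow_smul_eq_bot_of_isLocalRing (maximalIdeal R)
        (maximalIdeal.isMaximal R).ne_top, Submodule.mem_iInf]
    intro k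
    obtain ⟨Y, hY1, hY2⟩ := hex k
    have h2 : (Submodule.Quotient.mk (D 1) : Matrix (Fin n) (Fin n) R ⧸ N.map D) =
        Submodule.Quotient.mk (D Y) := by
      rw [eq_comm, Submodule.Quotient.eq, ← map_sub]
      exact Submodule.mem_map_of_mem (CoeffRing.map_residue_eq_one_iff.mp hY1)
    rw [h2, Matrix.matrix_eq_sum_single (D Y), ← Submodule.mkQ_apply, map_sum]
    refine sum_mem fun i _ => ?_
    rw [map_sum]
    refine sum_mem fun j _ => ?_
    rw [show Matrix.single i j (D Y i j) = D Y i j • Matrix.single i j (1 : R) by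
      rw [Matrix.smul_single, smul_eq_mul, mul_one], map_smul]
    exact Submodule.smul_mem_smul (Ideal.pow_le_pow_right (Nat.le_succ k) (hY2 i j)) trivial
  obtain ⟨A, hA, hAD⟩ := hmem
  have hA1 : (1 - A).map R.residue = 1 := CoeffRing.map_residue_eq_one_iff.mpr fun i j => by
    rw [sub_sub_cancel_left]; exact neg_mem (hA i j)
  obtain ⟨Y, hY, hY1⟩ := R.exists_unit_of_map_residue (B := 1) hA1
  refine ⟨hρ, Y, hY1, ?_⟩
  have h3 : D (1 - A) = 0 := by rw [map_sub, hAD, sub_self]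
  rw [hY, ← hTR]
  exact sub_eq_zero.mp h3

end

variable [CharP F ℓ] [Finite F]
variable {p : ℕ} [Fact p.Prime] {I P : Subgroup G} {q : ℕ} {s t : G} {ρbar : G →* GL (Fin n) F}
  {T : Matrix (Fin n) (Fin n) (WittVector ℓ F)}

/-- The conjugators over `R₁` and `R₂` may disagree over the common quotient, but only by an element
of the centralizer of `T`, and such elements lift. -/
theorem minimalLifts_P4 (h : LiftData p I P q s t ρbar T) (R₁ R₂ R₃ : CoeffRing ℓ F)
    (I₁ : Ideal R₁) (I₂ : Ideal R₂) (φ : (R₁ ⧸ I₁) ≃ₐ[WittVector ℓ F] (R₂ ⧸ I₂))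
    (π₁ : R₃.Hom R₁) (π₂ : R₃.Hom R₂)
    (hinj : Function.Injective (fun r => (π₁.toAlgHom r, π₂.toAlgHom r)))
    (hrange : Set.range (fun r => (π₁.toAlgHom r, π₂.toAlgHom r)) =
      {q : R₁ × R₂ | φ (Ideal.Quotient.mk I₁ q.1) = Ideal.Quotient.mk I₂ q.2})
    {ρ₁ : G →* GL (Fin n) R₁} (hρ₁ : ρ₁ ∈ minimalLifts ρbar T t R₁)
    {ρ₂ : G →* GL (Fin n) R₂} (hρ₂ : ρ₂ ∈ minimalLifts ρbar T t R₂)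
    (heq : pushRep (φ : (R₁ ⧸ I₁) →+* (R₂ ⧸ I₂)) (pushRep (Ideal.Quotient.mk I₁) ρ₁) =
      pushRep (Ideal.Quotient.mk I₂) ρ₂)
    (ρ₃ : G →* GL (Fin n) R₃) (h31 : pushRep (π₁.toAlgHom : R₃ →+* R₁) ρ₃ = ρ₁)
    (h32 : pushRep (π₂.toAlgHom : R₃ →+* R₂) ρ₃ = ρ₂) : ρ₃ ∈ minimalLifts ρbar T t R₃ := by
  have hext : ∀ a b : R₃, π₁.toAlgHom a = π₁.toAlgHom b → π₂.toAlgHom a = π₂.toAlgHom b → a = b :=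
    fun a b h1 h2 => hinj (Prod.ext h1 h2)
  have hextGL : ∀ A B : GL (Fin n) R₃,
      Matrix.GeneralLinearGroup.map (π₁.toAlgHom : R₃ →+* R₁) A =
        Matrix.GeneralLinearGroup.map (π₁.toAlgHom : R₃ →+* R₁) B →
      Matrix.GeneralLinearGroup.map (π₂.toAlgHom : R₃ →+* R₂) A =
        Matrix.GeneralLinearGroup.map (π₂.toAlgHom : R₃ →+* R₂) B → A = B :=
    fun A B h1 h2 => Units.ext (Matrix.ext fun i j => hext _ _
      (congrArg (fun M : GL (Fin n) R₁ => M.val i j) h1)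
      (congrArg (fun M : GL (Fin n) R₂ => M.val i j) h2))
  have h31' : ∀ g, Matrix.GeneralLinearGroup.map (π₁.toAlgHom : R₃ →+* R₁) (ρ₃ g) = ρ₁ g :=
    fun g => DFunLike.congr_fun h31 g
  have h32' : ∀ g, Matrix.GeneralLinearGroup.map (π₂.toAlgHom : R₃ →+* R₂) (ρ₃ g) = ρ₂ g :=
    fun g => DFunLike.congr_fun h32 g
  have hres : pushRep R₃.residue ρ₃ = ρbar := by
    rw [← hρ₁.1.reduction, ← h31]
    exact MonoidHom.ext fun g => Units.ext (Matrix.ext fun i j => (π₁.residue_comp _).symm)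
  have hrel : ρ₃ s * ρ₃ t * (ρ₃ s)⁻¹ = ρ₃ t ^ q := by
    apply hextGL
    · rw [map_mul, map_mul, map_inv, map_pow, h31', h31', h.relation hρ₁.1]
    · rw [map_mul, map_mul, map_inv, map_pow, h32', h32', h.relation hρ₂.1]
  -- Continuity of `ρ₃` is not given. A continuous representation with the same values at the
  -- generators is built, and it equals `ρ₃` because both have the same projections.
  obtain ⟨ρ', hρ', hs', ht', hP'⟩ := h.exists_representation hrel (DFunLike.congr_fun hres t)
  have h1 : pushRep (π₁.toAlgHom : R₃ →+* R₁) ρ' = ρ₁ := by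
    refine h.gen.representation_ext (hρ'.push π₁) hρ₁.1.continuous ?_ ?_ ?_
      fun σ hσ => h.eq_one_of_mem hρ₁.1 hσ
    · rw [pushRep, MonoidHom.comp_apply, hs', h31']
    · rw [pushRep, MonoidHom.comp_apply, ht', h31']
    · intro σ hσ
      rw [pushRep, MonoidHom.comp_apply, hP' σ hσ, map_one]
  have h2 : pushRep (π₂.toAlgHom : R₃ →+* R₂) ρ' = ρ₂ := by
    refine h.gen.representation_ext (hρ'.push π₂) hρ₂.1.continuous ?_ ?_ ?_
      fun σ hσ => h.eq_one_of_mem hρ₂.1 hσ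
    · rw [pushRep, MonoidHom.comp_apply, hs', h32']
    · rw [pushRep, MonoidHom.comp_apply, ht', h32']
    · intro σ hσ
      rw [pushRep, MonoidHom.comp_apply, hP' σ hσ, map_one]
  obtain rfl : ρ' = ρ₃ := MonoidHom.ext fun g => hextGL _ _
    (by rw [h31', ← h1]; rfl) (by rw [h32', ← h2]; rfl)
  obtain ⟨hl₁, Y₁, hY₁, hYT₁⟩ := hρ₁
  obtain ⟨hl₂, Y₂, hY₂, hYT₂⟩ := hρ₂
  refine ⟨⟨hρ', hres, fun g => ?_⟩, ?_⟩
  · refine Units.ext (hext _ _ ?_ ?_)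
    · have h3 := congrArg Units.val (hl₁.det_eq g)
      rw [← h31' g] at h3
      refine (RingHom.map_det (π₁.toAlgHom : R₃ →+* R₁) (ρ' g).val).trans
        (h3.trans (π₁.toAlgHom.commutes _).symm)
    · have h3 := congrArg Units.val (hl₂.det_eq g)
      rw [← h32' g] at h3
      refine (RingHom.map_det (π₂.toAlgHom : R₃ →+* R₂) (ρ' g).val).trans
        (h3.trans (π₂.toAlgHom.commutes _).symm)
  · -- the two conjugating matrices are made compatible
    let mk₂ := Ideal.Quotient.mkₐ (WittVector ℓ F) I₂
    let f₁ : R₁ →ₐ[WittVector ℓ F] (R₂ ⧸ I₂) :=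
      (φ : (R₁ ⧸ I₁) →ₐ[WittVector ℓ F] (R₂ ⧸ I₂)).comp (Ideal.Quotient.mkₐ (WittVector ℓ F) I₁)
    let y₁ := Matrix.GeneralLinearGroup.map (f₁ : R₁ →+* R₂ ⧸ I₂) Y₁
    let y₂ := Matrix.GeneralLinearGroup.map (mk₂ : R₂ →+* R₂ ⧸ I₂) Y₂
    let a := Matrix.GeneralLinearGroup.map (mk₂ : R₂ →+* R₂ ⧸ I₂) (ρ₂ t)
    have ha : Matrix.GeneralLinearGroup.map (f₁ : R₁ →+* R₂ ⧸ I₂) (ρ₁ t) = a :=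
      DFunLike.congr_fun heq t
    have ha₁ : a.val * y₁.val = y₁.val * T.map (algebraMap (WittVector ℓ F) (R₂ ⧸ I₂)) := by
      have h3 := congrArg (fun A => A.map f₁) hYT₁
      simp only [Matrix.map_mul, map_map_algebraMap] at h3
      rw [← ha]
      exact h3
    have ha₂ : a.val * y₂.val = y₂.val * T.map (algebraMap (WittVector ℓ F) (R₂ ⧸ I₂)) := by
      have h3 := congrArg (fun A => A.map mk₂) hYT₂
      simp only [Matrix.map_mul, map_map_algebraMap] at h3
      exact h3
    have hZ : (y₂⁻¹ * y₁).val * T.map (algebraMap (WittVector ℓ F) (R₂ ⧸ I₂)) =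
        T.map (algebraMap (WittVector ℓ F) (R₂ ⧸ I₂)) ^ 1 * (y₂⁻¹ * y₁).val := by
      have h3 : T.map (algebraMap (WittVector ℓ F) (R₂ ⧸ I₂)) = (y₂⁻¹ * a * y₂).val := by
        rw [mul_assoc, Units.val_mul, Units.val_mul, ha₂, Units.inv_mul_cancel_left]
      rw [pow_one, Units.val_mul, mul_assoc, ← ha₁, h3, ← Units.val_mul, ← Units.val_mul,
        ← Units.val_mul, ← Units.val_mul]
      congr 1
      group
    -- Replacing `Y₂` by `Y₂ * Z` keeps it an intertwiner and makes its image in the quotient agree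
    -- with that of `Y₁`.
    obtain ⟨Z, hZ1, hZ2⟩ := exists_lift_intertwiner h.comm mk₂ Ideal.Quotient.mk_surjective _ hZ
    have hY₂' : (Y₂.val * Z).map mk₂ = y₁.val := by
      rw [Matrix.map_mul, hZ1]
      change y₂.val * (y₂⁻¹ * y₁).val = _
      rw [← Units.val_mul, mul_inv_cancel_left]
    have hex : ∀ i j, ∃ r : R₃, π₁.toAlgHom r = Y₁.val i j ∧
        π₂.toAlgHom r = (Y₂.val * Z) i j := by
      intro i j
      have h3 : (Y₁.val i j, (Y₂.val * Z) i j) ∈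
          Set.range (fun r => (π₁.toAlgHom r, π₂.toAlgHom r)) := by
        rw [hrange]
        exact (congrFun (congrFun hY₂' i) j).symm
      obtain ⟨r, hr⟩ := h3
      exact ⟨r, congrArg Prod.fst hr, congrArg Prod.snd hr⟩
    choose Y₃ hY₃₁ hY₃₂ using hex
    have hm₁ : (Matrix.of Y₃).map π₁.toAlgHom = Y₁.val := Matrix.ext hY₃₁
    have hm₂ : (Matrix.of Y₃).map π₂.toAlgHom = Y₂.val * Z := Matrix.ext hY₃₂
    -- The residue of `Y₃` is computed through `R₁`, so no condition on the residue of `Z` is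
    -- needed.
    obtain ⟨Y, hY, hY1⟩ := R₃.exists_unit_of_map_residue (A := Matrix.of Y₃) (B := 1) (by
      rw [← hY₁]
      refine Matrix.ext fun i j => (π₁.residue_comp _).symm.trans ?_
      exact congrArg R₁.residue (hY₃₁ i j))
    refine ⟨Y, hY1, ?_⟩
    rw [hY]
    have he₁ : ((ρ' t).val * Matrix.of Y₃).map π₁.toAlgHom =
        (Matrix.of Y₃ * T.map (algebraMap (WittVector ℓ F) R₃)).map π₁.toAlgHom := by
      rw [Matrix.map_mul, Matrix.map_mul, map_map_algebraMap, hm₁, ← hYT₁, ← h31']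
      rfl
    have he₂ : ((ρ' t).val * Matrix.of Y₃).map π₂.toAlgHom =
        (Matrix.of Y₃ * T.map (algebraMap (WittVector ℓ F) R₃)).map π₂.toAlgHom := by
      rw [Matrix.map_mul, Matrix.map_mul, map_map_algebraMap, hm₂, mul_assoc Y₂.val, hZ2,
        pow_one, ← mul_assoc Y₂.val, ← hYT₂, ← h32', mul_assoc]
      rfl
    exact Matrix.ext fun i j => hext _ _ (congrFun (congrFun he₁ i) j)
      (congrFun (congrFun he₂ i) j)

end LiftData

end LocalDeformation

/-! ### Smoothness and inertia invariants. -/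

open ValuativeRel IsLocalRing

namespace LocalDeformation

variable {ℓ : ℕ} [Fact ℓ.Prime] {F : Type u} [Field F]

/-- The residue map, as a morphism of coefficient rings. -/
noncomputable def CoeffRing.residueHom (R : CoeffRing ℓ F) : R.Hom (CoeffRing.residueField ℓ F) where
  toAlgHom := { R.residue with commutes' := R.residue_algebraMap }
  residue_comp _ := rfl

namespace LiftData

variable {G : Type v} [Group G] [TopologicalSpace G] [IsTopologicalGroup G] {n : ℕ}
  [CharP F ℓ] [Finite F] {p : ℕ} [Fact p.Prime] {I P : Subgroup G} {q : ℕ} {s t : G}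
  {ρbar : G →* GL (Fin n) F} {T : Matrix (Fin n) (Fin n) (WittVector ℓ F)}

/-- The determinant condition can be checked on the generators. -/
theorem det_eq_of_generators (h : LiftData p I P q s t ρbar T) {R : CoeffRing ℓ F}
    {ρ : G →* GL (Fin n) R} (hc : IsContinuousRep ρ) (hP : ∀ σ ∈ P, ρ σ = 1)
    (hs : Matrix.GeneralLinearGroup.det (ρ s) =
      Units.map (algebraMap (WittVector ℓ F) R).toMonoidHom (teichmullerDet ℓ ρbar s))
    (ht : Matrix.GeneralLinearGroup.det (ρ t) =
      Units.map (algebraMap (WittVector ℓ F) R).toMonoidHom (teichmullerDet ℓ ρbar t)) (g : G) :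
    Matrix.GeneralLinearGroup.det (ρ g) =
      Units.map (algebraMap (WittVector ℓ F) R).toMonoidHom (teichmullerDet ℓ ρbar g) := by
  let φ : G →* Rˣ := Matrix.GeneralLinearGroup.det.comp ρ
  let ψ : G →* Rˣ :=
    (Units.map (algebraMap (WittVector ℓ F) R).toMonoidHom).comp (teichmullerDet ℓ ρbar)
  have hψ : ∀ σ, ρbar σ = 1 → ψ σ = 1 := fun σ hσ => by
    simp only [ψ, teichmullerDet, MonoidHom.comp_apply, hσ, map_one]
  change φ g = ψ g
  have hk : ∀ k, (Units.map (Ideal.Quotient.mk (maximalIdeal R ^ k)).toMonoidHom).comp φ =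
      (Units.map (Ideal.Quotient.mk (maximalIdeal R ^ k)).toMonoidHom).comp ψ := by
    intro k
    refine h.gen.hom_ext ?_ ?_
      (congrArg (Units.map (Ideal.Quotient.mk (maximalIdeal R ^ k)).toMonoidHom) hs)
      (congrArg (Units.map (Ideal.Quotient.mk (maximalIdeal R ^ k)).toMonoidHom) ht)
      (fun σ hσ => ?_) (fun σ hσ => ?_)
    · refine Subgroup.isOpen_mono (fun σ hσ => ?_) (isContinuousRep_iff.mp hc k)
      refine Units.ext ((RingHom.map_det (Ideal.Quotient.mk (maximalIdeal R ^ k))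
        (ρ σ).val).trans ?_)
      have h1 : ((ρ σ).val.map (Ideal.Quotient.mk (maximalIdeal R ^ k))) = 1 :=
        congrArg Units.val hσ
      change ((ρ σ).val.map (Ideal.Quotient.mk (maximalIdeal R ^ k))).det = 1
      rw [h1, Matrix.det_one]
    · refine Subgroup.isOpen_mono (fun σ hσ => ?_) h.continuous.isOpen_ker
      rw [MonoidHom.mem_ker, MonoidHom.comp_apply, hψ σ hσ, map_one]
    · simp only [φ, MonoidHom.comp_apply, hP σ hσ, map_one]
    · rw [MonoidHom.comp_apply, hψ σ (h.tame σ hσ), map_one]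
  refine Units.ext (sub_eq_zero.mp ?_)
  have h2 : (φ g).val - (ψ g).val ∈ ⨅ k, maximalIdeal R ^ k := Ideal.mem_iInf.mpr fun k =>
    Ideal.Quotient.eq.mp (congrArg Units.val (DFunLike.congr_fun (hk k) g))
  rwa [Ideal.iInf_pow_eq_bot_of_isLocalRing _ (maximalIdeal.isMaximal R).ne_top] at h2

/-- Lifts exist along small surjections. -/
theorem exists_lift_mem_minimalLifts (h : LiftData p I P q s t ρbar T)
    {Z₀ : Matrix (Fin n) (Fin n) F} (hZ₀ : Z₀.trace = 1)
    (hZ₀t : Z₀ * (ρbar t).val = (ρbar t).val * Z₀) {R Q : CoeffRing ℓ F} (π : R.Hom Q)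
    (hπ : Function.Surjective π.toAlgHom)
    (hI : ∀ x ∈ maximalIdeal R, ∀ y, π.toAlgHom y = 0 → x * y = 0)
    {ρ : G →* GL (Fin n) Q} (hρ : ρ ∈ minimalLifts ρbar T t Q) :
    ∃ ρ' ∈ minimalLifts ρbar T t R, pushRep (π.toAlgHom : R →+* Q) ρ' = ρ := by
  obtain ⟨hl, Y, hY, hYT⟩ := hρ
  let mp := Matrix.GeneralLinearGroup.map (n := Fin n) (π.toAlgHom : R →+* Q)
  have hmp : ∀ (A : GL (Fin n) R) (B : GL (Fin n) Q), A.val.map π.toAlgHom = B.val → mp A = B :=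
    fun A B hAB => Units.ext hAB
  have hmres : ∀ A : Matrix (Fin n) (Fin n) R,
      A.map R.residue = (A.map π.toAlgHom).map Q.residue :=
    fun A => Matrix.ext fun i j => (π.residue_comp _).symm
  have hker : ∀ y, π.toAlgHom y = 0 → y ∈ maximalIdeal R := fun y hy => by
    rw [R.mem_maximalIdeal_iff, ← π.residue_comp, hy, map_zero]
  obtain ⟨tR, htR, htR1⟩ := R.exists_unit_of_map_residue (B := ρbar t)
    ((map_residue_algebraMap T R).trans h.map_eq)
  have htQ : (mp tR).val = T.map (algebraMap (WittVector ℓ F) Q) := by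
    change tR.val.map π.toAlgHom = _
    rw [htR, map_map_algebraMap]
  have hρt : ρ t = Y * mp tR * Y⁻¹ := by
    rw [eq_mul_inv_iff_mul_eq]
    exact Units.ext (by rw [Units.val_mul, Units.val_mul, hYT, htQ])
  have hrel := h.relation hl
  -- After conjugation by `Y` the tame generator acts as `T`, and the tame relation becomes a linear
  -- equation for the Frobenius matrix. Its solutions lift.
  have hzQ : Y⁻¹ * ρ s * Y * mp tR = mp tR ^ q * (Y⁻¹ * ρ s * Y) := by
    rw [mul_inv_eq_iff_eq_mul, hρt, conj_pow] at hrel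
    have h1 : ρ s * (Y * mp tR) = Y * mp tR ^ q * Y⁻¹ * ρ s * Y := by
      rw [← hrel]; group
    rw [mul_assoc, mul_assoc, h1]; group
  obtain ⟨zm, hzm1, hzm2⟩ := exists_lift_intertwiner h.frob π.toAlgHom hπ (Y⁻¹ * ρ s * Y).val (by
    rw [← htQ, ← Units.val_mul, hzQ]; rfl)
  obtain ⟨z, rfl, -⟩ := R.exists_unit_of_map_residue
    (B := Matrix.GeneralLinearGroup.map Q.residue (Y⁻¹ * ρ s * Y)) (A := zm) (by
      rw [hmres, hzm1]; rfl)
  have hz : mp z = Y⁻¹ * ρ s * Y := hmp _ _ hzm1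
  -- `V` lifts the trace-one matrix `Z₀` inside the centralizer of `T`.
  obtain ⟨V, hV1, hV2⟩ := exists_lift_intertwiner h.comm R.residueHom.toAlgHom
    R.residue_surjective Z₀ (by
      rw [pow_one]
      exact (congrArg (Z₀ * ·) h.map_eq).trans (hZ₀t.trans (congrArg (· * Z₀) h.map_eq).symm))
  let η := Units.map (algebraMap (WittVector ℓ F) R).toMonoidHom (teichmullerDet ℓ ρbar s)
  -- The lifted Frobenius matrix `z` misses the prescribed determinant by `d = 1 + y`. The factor `v
  -- = 1 + y V` repairs this without disturbing the relation, as it commutes with `T` and maps to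
  -- `1`.
  let d : Rˣ := η * (Matrix.GeneralLinearGroup.det z)⁻¹
  obtain ⟨y, hy⟩ : ∃ y : R, y = d.val - 1 := ⟨_, rfl⟩
  have hπy : π.toAlgHom y = 0 := by
    have h1 : Units.map (π.toAlgHom : R →* Q) (Matrix.GeneralLinearGroup.det z) =
        Matrix.GeneralLinearGroup.det (mp z) := Units.ext (RingHom.map_det (π.toAlgHom : R →+* Q) _)
    have h2 : Units.map (π.toAlgHom : R →* Q) η =
        Units.map (algebraMap (WittVector ℓ F) Q).toMonoidHom (teichmullerDet ℓ ρbar s) :=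
      Units.ext (π.toAlgHom.commutes _)
    have h3 : Units.map (π.toAlgHom : R →* Q) d = 1 := by
      rw [map_mul, map_inv, h1, h2, hz, map_mul, map_mul, map_inv, mul_right_comm, inv_mul_cancel,
        one_mul, hl.det_eq, mul_inv_cancel]
    rw [hy, map_sub, map_one, sub_eq_zero]
    exact congrArg Units.val h3
  -- Since `y` is killed by the maximal ideal and `V` has trace congruent to `1`, the determinant of
  -- `1 + y V` is exactly `1 + y`.
  have hyy : y ^ 2 = 0 := by rw [pow_two]; exact hI y (hker y hπy) y hπy
  have htr : V.trace * y = y := by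
    have h1 : V.trace - 1 ∈ maximalIdeal R := by
      rw [R.mem_maximalIdeal_iff, map_sub, map_one, sub_eq_zero, ← hZ₀, ← hV1]
      exact map_sum R.residue _ _
    have h2 := hI _ h1 y hπy
    rwa [sub_mul, one_mul, sub_eq_zero] at h2
  have hvmap : (1 + y • V).map π.toAlgHom = 1 := by
    rw [Matrix.map_add _ (map_add _), Matrix.map_one _ (map_zero _) (map_one _)]
    have h1 : (y • V).map π.toAlgHom = 0 := Matrix.ext fun i j => by
      rw [Matrix.map_apply, Matrix.smul_apply, smul_eq_mul, map_mul, hπy, zero_mul]; rfl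
    rw [h1, add_zero]
  obtain ⟨v, hv, -⟩ := R.exists_unit_of_map_residue (B := 1) (A := 1 + y • V) (by
    rw [hmres, hvmap, Matrix.map_one _ (map_zero _) (map_one _)]; rfl)
  have hvQ : mp v = 1 := hmp _ _ (by rw [hv, hvmap]; rfl)
  have hdet : Matrix.GeneralLinearGroup.det (z * v) = η := by
    have h1 : Matrix.GeneralLinearGroup.det v = d := by
      refine Units.ext ?_
      change v.val.det = d.val
      rw [hv, Matrix.det_one_add_smul, htr, hyy, mul_zero, add_zero, hy]; ring
    rw [map_mul, h1, mul_comm, inv_mul_cancel_right]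
  have hzv : z * v * tR = tR ^ q * (z * v) := by
    refine Units.ext ?_
    have h1 : v.val * tR.val = tR.val * v.val := by
      rw [hv, htR, add_mul, mul_add, one_mul, mul_one, smul_mul_assoc, hV2, pow_one, mul_smul_comm]
    rw [Units.val_mul, Units.val_mul, mul_assoc, h1, ← mul_assoc, htR, hzm2, ← htR, mul_assoc]
    rfl
  choose Ym hYm using fun i j => hπ (Y.val i j)
  have hYm' : (Matrix.of Ym).map π.toAlgHom = Y.val := Matrix.ext hYm
  obtain ⟨yR, hyR, hyR1⟩ := R.exists_unit_of_map_residue (B := 1) (A := Matrix.of Ym) (by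
    rw [hmres, hYm']; exact congrArg Units.val hY)
  have hyQ : mp yR = Y := hmp _ _ (by rw [hyR, hYm'])
  obtain ⟨ρ', hc, hs', ht', hP'⟩ := h.exists_representation (R := R)
    (S := yR * (z * v) * yR⁻¹) (T' := yR * tR * yR⁻¹) (by
      rw [conj_pow, mul_inv_eq_iff_eq_mul]
      rw [show yR * tR ^ q * yR⁻¹ * (yR * (z * v) * yR⁻¹) = yR * (tR ^ q * (z * v)) * yR⁻¹ by group,
        ← hzv]
      group) (by rw [map_mul, map_mul, map_inv, hyR1, htR1, inv_one, one_mul, mul_one])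
  have hpush : pushRep (π.toAlgHom : R →+* Q) ρ' = ρ := by
    refine h.gen.representation_ext (hc.push π) hl.continuous ?_ ?_ ?_
      fun σ hσ => h.eq_one_of_mem hl hσ
    · change mp (ρ' s) = _
      rw [hs', map_mul, map_mul, map_mul, map_inv, hz, hvQ, hyQ]; group
    · change mp (ρ' t) = _
      rw [ht', map_mul, map_mul, map_inv, hyQ, hρt]
    · intro σ hσ
      rw [pushRep, MonoidHom.comp_apply, hP' σ hσ, map_one]
  refine ⟨ρ', ⟨⟨hc, ?_, h.det_eq_of_generators hc hP' ?_ ?_⟩, yR, hyR1, ?_⟩, hpush⟩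
  · rw [← hl.reduction, ← hpush]
    exact MonoidHom.ext fun g => Units.ext (hmres _)
  · rw [hs', map_mul, map_mul, map_inv, mul_right_comm, mul_inv_cancel, one_mul, hdet]
  -- At `t` nothing needs correction: the determinant of `T` is already the Teichmüller lift.
  · rw [ht', map_mul, map_mul, map_inv, mul_right_comm, mul_inv_cancel, one_mul]
    refine Units.ext ?_
    change tR.val.det = algebraMap (WittVector ℓ F) R (teichmullerDet ℓ ρbar t)
    rw [htR, ← h.det_eq, RingHom.map_det]; rfl
  · rw [← htR, ← Units.val_mul, ← Units.val_mul, ht', inv_mul_cancel_right]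

/-- Vectors fixed by `t` are fixed by the inertia group. -/
theorem mem_fixedVectors_iff (h : LiftData p I P q s t ρbar T) {R : CoeffRing ℓ F}
    {ρ : G →* GL (Fin n) R} {η : G →* (WittVector ℓ F)ˣ} (hρ : IsLift ρbar η R ρ)
    (x : Fin n → R) : x ∈ fixedVectors ρ I ↔ (ρ t).val.mulVec x = x := by
  refine ⟨fun hx => hx t h.gen.mem_inertia, fun hx σ hσ => ?_⟩
  have hk : ∀ k, ∀ i, ((ρ σ).val.mulVec x) i - x i ∈ maximalIdeal R ^ k := by
    intro k
    let m := Ideal.Quotient.mk (maximalIdeal R ^ k)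
    let ρk := pushRep m ρ
    have hval : ∀ g, (ρk g).val.mulVec (m ∘ x) = m ∘ (ρ g).val.mulVec x := fun g =>
      funext fun i => (RingHom.map_mulVec m (ρ g).val x i).symm
    -- The stabilizer of `x` modulo `𝔪 ^ k` is open and contains `t` and `P`, hence all of inertia.
    let U : Subgroup G :=
      { carrier := {g | (ρk g).val.mulVec (m ∘ x) = m ∘ x}
        one_mem' := by
          change (ρk 1).val.mulVec (m ∘ x) = m ∘ x
          rw [map_one, Units.val_one, Matrix.one_mulVec]
        mul_mem' := fun {a b} ha hb => by
          change (ρk (a * b)).val.mulVec (m ∘ x) = m ∘ x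
          change (ρk a).val.mulVec (m ∘ x) = m ∘ x at ha
          change (ρk b).val.mulVec (m ∘ x) = m ∘ x at hb
          rw [map_mul, Units.val_mul, ← Matrix.mulVec_mulVec, hb, ha]
        inv_mem' := fun {a} ha => by
          change (ρk a⁻¹).val.mulVec (m ∘ x) = m ∘ x
          change (ρk a).val.mulVec (m ∘ x) = m ∘ x at ha
          conv_lhs => rw [← ha, Matrix.mulVec_mulVec, ← Units.val_mul, ← map_mul, inv_mul_cancel,
            map_one, Units.val_one, Matrix.one_mulVec] }
    have hU : ∀ g, ρk g = 1 → g ∈ U := fun g hg => by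
      change (ρk g).val.mulVec (m ∘ x) = m ∘ x
      rw [hg, Units.val_one, Matrix.one_mulVec]
    have hIU : I ≤ U := by
      refine h.gen.inertia_le U
        (Subgroup.isOpen_mono (fun g hg => hU g hg) (isContinuousRep_iff.mp hρ.continuous k)) ?_ ?_
      · change (ρk t).val.mulVec (m ∘ x) = m ∘ x
        rw [hval, hx]
      · intro g hg
        exact hU g (by rw [MonoidHom.comp_apply, h.eq_one_of_mem hρ hg, map_one])
    intro i
    have h1 : (ρk σ).val.mulVec (m ∘ x) = m ∘ x := hIU hσ
    rw [hval] at h1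
    exact Ideal.Quotient.eq.mp (congrFun h1 i)
  funext i
  have h2 : ((ρ σ).val.mulVec x) i - x i ∈ ⨅ k, maximalIdeal R ^ k :=
    Ideal.mem_iInf.mpr fun k => hk k i
  rw [Ideal.iInf_pow_eq_bot_of_isLocalRing _ (maximalIdeal.isMaximal R).ne_top] at h2
  exact sub_eq_zero.mp h2

/-- The inertia invariants of the lifts in `minimalLifts` are free of constant rank. -/
theorem exists_rank_fixedVectors (h : LiftData p I P q s t ρbar T) :
    ∃ r : ℕ, ∀ (R : CoeffRing ℓ F), ∀ ρ ∈ minimalLifts ρbar T t R,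
      Nonempty (fixedVectors ρ I ≃ₗ[R] (Fin r → R)) := by
  obtain ⟨B, hB⟩ := h.fixed
  obtain ⟨r, hr⟩ := exists_kernel_rank hB
  refine ⟨r, fun R ρ hρ => ?_⟩
  obtain ⟨hl, Y, -, hYT⟩ := hρ
  obtain ⟨e⟩ := hr R
  -- The conjugator `Y` carries the kernel of `T - 1` onto the inertia invariants.
  have hmem : ∀ x, x ∈ LinearMap.ker ((T - 1).map (algebraMap (WittVector ℓ F) R)).mulVecLin ↔
      Y.val.mulVec x ∈ fixedVectors ρ I := by
    intro x
    rw [h.mem_fixedVectors_iff hl, Matrix.mulVec_mulVec, hYT, ← Matrix.mulVec_mulVec,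
      LinearMap.mem_ker, Matrix.mulVecLin_apply, Matrix.map_sub _ (map_sub _),
      Matrix.map_one _ (map_zero _) (map_one _), Matrix.sub_mulVec, Matrix.one_mulVec, sub_eq_zero]
    refine ⟨fun hx => by rw [hx], fun hx => ?_⟩
    have h1 := congrArg (fun z => Y⁻¹.val.mulVec z) hx
    simpa only [Matrix.mulVec_mulVec, ← Units.val_mul, inv_mul_cancel, Units.val_one,
      Matrix.one_mulVec, ← mul_assoc, Units.inv_mul, one_mul] using h1
  have hY : ∀ x, Y.val.mulVec (Y⁻¹.val.mulVec x) = x := fun x => by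
    rw [Matrix.mulVec_mulVec, ← Units.val_mul, mul_inv_cancel, Units.val_one, Matrix.one_mulVec]
  have hY' : ∀ x, Y⁻¹.val.mulVec (Y.val.mulVec x) = x := fun x => by
    rw [Matrix.mulVec_mulVec, ← Units.val_mul, inv_mul_cancel, Units.val_one, Matrix.one_mulVec]
  have f : LinearMap.ker ((T - 1).map (algebraMap (WittVector ℓ F) R)).mulVecLin ≃ₗ[R]
      fixedVectors ρ I :=
    { (Y.val.mulVecLin.restrict (fun x hx => (hmem x).mp hx) :
        LinearMap.ker ((T - 1).map (algebraMap (WittVector ℓ F) R)).mulVecLin →ₗ[R]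
          fixedVectors ρ I) with
      invFun := fun x => ⟨Y⁻¹.val.mulVec x.1, (hmem _).mpr (by rw [hY]; exact x.2)⟩
      left_inv := fun x => Subtype.ext (hY' x.1)
      right_inv := fun x => Subtype.ext (hY x.1) }
  exact ⟨f.symm.trans e⟩

theorem fixedVectors_eq_top (h : LiftData p I P q s t ρbar T) {R : CoeffRing ℓ F}
    {ρ : G →* GL (Fin n) R} {η : G →* (WittVector ℓ F)ˣ} (hρ : IsLift ρbar η R ρ)
    {H : Subgroup G} (hH : H ≤ P) : fixedVectors ρ H = ⊤ :=
  eq_top_iff.mpr fun x _ σ hσ => by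
    rw [h.eq_one_of_mem hρ (hH hσ), Units.val_one, Matrix.one_mulVec]

end LiftData

end LocalDeformation

/-! ### Cocycles and the dimension of unramified cohomology. -/

open ValuativeRel IsLocalRing

namespace LocalDeformation

theorem isLocallyConstant_of_forall_mem {G : Type*} [Group G] [TopologicalSpace G]
    [IsTopologicalGroup G] {X : Type*} {f : G → X} {U : Subgroup G} (hU : IsOpen (U : Set G))
    (h : ∀ g, ∀ σ ∈ U, f (g * σ) = f g) : IsLocallyConstant f := by
  refine (IsLocallyConstant.iff_exists_open f).mpr fun g => ⟨(fun x => g⁻¹ * x) ⁻¹' (U : Set G),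
    hU.preimage (continuous_const_mul g⁻¹), ?_, fun x hx => ?_⟩
  · rw [Set.mem_preimage, inv_mul_cancel]
    exact U.one_mem
  · rw [← h g _ hx, mul_inv_cancel_left]

section Cocycles

variable {F : Type u} [Field F] {G : Type v} [Group G] [TopologicalSpace G] {V : Type u}
  [AddCommGroup V] [Module F V] {τ : Representation F G V}

theorem cocycle_one (c : Z1 τ) : c.1 1 = 0 := by
  have h := c.2.2 1 1
  rw [map_one, mul_one, Module.End.one_apply] at h
  exact left_eq_add.mp h

theorem cocycle_inv_of_eq_zero (c : Z1 τ) {g : G} (h : c.1 g = 0) : c.1 g⁻¹ = 0 := by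
  have h1 := c.2.2 g⁻¹ g
  rw [h, map_zero, add_zero, inv_mul_cancel, cocycle_one] at h1
  exact h1.symm

/-- The zeros of a cocycle. -/
def cocycleKer (c : Z1 τ) : Subgroup G where
  carrier := {g | c.1 g = 0}
  one_mem' := cocycle_one c
  mul_mem' := fun {a b} ha hb => by
    change c.1 (a * b) = 0
    rw [c.2.2, ha, hb, map_zero, add_zero]
  inv_mem' := fun h => cocycle_inv_of_eq_zero c h

theorem isOpen_cocycleKer (c : Z1 τ) : IsOpen (cocycleKer c : Set G) :=
  c.2.1.isOpen_fiber 0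

/-- A cocycle vanishing on `I` satisfies `c (g σ) = c g` and `c (σ g) = τ σ (c g)`. By normality `σ
g = g σ'` with `σ' ∈ I`, so its values are fixed by `I`. -/
theorem mem_inflatedZ1_iff {I : Subgroup G} [I.Normal] {c : Z1 τ} :
    c ∈ inflatedZ1 τ I ↔ I ≤ cocycleKer c := by
  constructor
  · intro h σ hσ
    have h1 := (h 1 σ hσ).1
    rw [one_mul, cocycle_one] at h1
    exact h1
  · intro h g σ hσ
    have h0 : ∀ x ∈ I, c.1 x = 0 := fun x hx => h hx
    have h1 : ∀ x ∈ I, c.1 (g * x) = c.1 g := fun x hx => by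
      rw [c.2.2, h0 x hx, map_zero, add_zero]
    refine ⟨h1 σ hσ, ?_⟩
    have h2 := c.2.2 σ g
    rw [h0 σ hσ, zero_add] at h2
    rw [← h2, show σ * g = g * (g⁻¹ * σ * g⁻¹⁻¹) by group]
    exact h1 _ (Subgroup.Normal.conj_mem inferInstance σ hσ g⁻¹)

theorem isLocallyConstant_orbit [IsTopologicalGroup G] (hτ : IsOpen (τ.ker : Set G)) (v : V) :
    IsLocallyConstant fun g => τ g v :=
  isLocallyConstant_of_forall_mem hτ fun g σ hσ => by
    rw [map_mul, MonoidHom.mem_ker.mp hσ, mul_one]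

/-- The coboundary of a vector. -/
def coboundary [IsTopologicalGroup G] (hτ : IsOpen (τ.ker : Set G)) (v : V) : Z1 τ :=
  ⟨fun g => τ g v - v, (isLocallyConstant_orbit hτ v).sub (IsLocallyConstant.const v),
    fun g h => by
      change τ (g * h) v - v = τ g v - v + τ g (τ h v - v)
      rw [map_mul, Module.End.mul_apply, map_sub]; abel⟩

theorem coboundary_mem [IsTopologicalGroup G] (hτ : IsOpen (τ.ker : Set G)) (v : V) :
    coboundary hτ v ∈ B1 τ := ⟨v, fun _ => rfl⟩

/-- The stabilizer of a vector. -/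
def vectorStabilizer (τ : Representation F G V) (v : V) : Subgroup G where
  carrier := {g | τ g v = v}
  one_mem' := by
    change τ 1 v = v
    rw [map_one, Module.End.one_apply]
  mul_mem' := fun {a b} ha hb => by
    change τ a v = v at ha
    change τ b v = v at hb
    change τ (a * b) v = v
    rw [map_mul, Module.End.mul_apply, hb, ha]
  inv_mem' := fun {a} ha => by
    change τ a v = v at ha
    change τ a⁻¹ v = v
    conv_lhs => rw [← ha, ← Module.End.mul_apply, ← map_mul, inv_mul_cancel, map_one,
      Module.End.one_apply]

/-- The vectors fixed by a subgroup. -/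
def invariantsOf (τ : Representation F G V) (I : Subgroup G) : Submodule F V where
  carrier := {v | ∀ σ ∈ I, τ σ v = v}
  zero_mem' := fun σ _ => map_zero _
  add_mem' := fun {x y} hx hy σ hσ => by rw [map_add, hx σ hσ, hy σ hσ]
  smul_mem' := fun a x hx σ hσ => by rw [map_smul, hx σ hσ]

theorem map_mem_invariantsOf {I : Subgroup G} [I.Normal] {v : V} (hv : v ∈ invariantsOf τ I)
    (g : G) : τ g v ∈ invariantsOf τ I := fun σ hσ => by
  rw [← Module.End.mul_apply, ← map_mul, show σ * g = g * (g⁻¹ * σ * g⁻¹⁻¹) by group, map_mul,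
    Module.End.mul_apply, hv _ (Subgroup.Normal.conj_mem inferInstance σ hσ g⁻¹)]

namespace TameGenerators

variable [IsTopologicalGroup G] {ℓ p : ℕ} [Fact ℓ.Prime] [Fact p.Prime] [CharP F ℓ]
  {I P : Subgroup G} {q : ℕ} {s t : G}

/-- `P` acts trivially, so `c` is additive on powers of `σ ∈ P`. It vanishes on some `p`-power of
`σ`, and `p` is invertible in `F`. -/
theorem cocycle_eq_zero (h : TameGenerators.{v, u} p I P q s t) (hne : ℓ ≠ p)
    (hP : ∀ σ ∈ P, τ σ = 1) (c : Z1 τ) : P ≤ cocycleKer c := by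
  intro σ hσ
  obtain ⟨a, ha⟩ := h.wild_pow σ hσ _ (isOpen_cocycleKer c)
  have h1 : ∀ k : ℕ, c.1 (σ ^ k) = (k : F) • c.1 σ := by
    intro k
    induction k with
    | zero => rw [pow_zero, cocycle_one, Nat.cast_zero, zero_smul]
    | succ k ih =>
      rw [pow_succ', c.2.2, ih, hP σ hσ, Module.End.one_apply, Nat.cast_succ, add_smul, one_smul,
        add_comm]
  have h2 : ((p ^ a : ℕ) : F) • c.1 σ = 0 := by rw [← h1]; exact ha
  refine (smul_eq_zero.mp h2).resolve_left fun h0 => hne ?_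
  have h3 := (CharP.cast_eq_zero_iff F ℓ _).mp h0
  exact (Nat.prime_dvd_prime_iff_eq Fact.out Fact.out).mp ((Fact.out : ℓ.Prime).dvd_of_dvd_pow h3)

/-- A class is unramified if and only if it is trivial on the tame generator. -/
theorem mkQ_mem_H1unr_iff [I.Normal] (h : TameGenerators.{v, u} p I P q s t) (hne : ℓ ≠ p)
    (hτ : IsOpen (τ.ker : Set G)) (hP : ∀ σ ∈ P, τ σ = 1) {c : Z1 τ} :
    (B1 τ).mkQ c ∈ H1unr τ I ↔ ∃ v, c.1 t = τ t v - v := by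
  constructor
  · rintro ⟨d, hd, hdc⟩
    obtain ⟨x, hx⟩ := (Submodule.Quotient.eq (B1 τ)).mp hdc
    have h1 : d.1 t = 0 := mem_inflatedZ1_iff.mp hd h.mem_inertia
    have h2 : d.1 t - c.1 t = τ t x - x := hx t
    refine ⟨-x, ?_⟩
    rw [map_neg, sub_neg_eq_add, neg_add_eq_sub, ← neg_sub, ← h2, h1]; abel
  · rintro ⟨x, hx⟩
    -- After subtraction of the coboundary the cocycle vanishes at `t` and on `P`, hence on inertia.
    refine ⟨c - coboundary hτ x, mem_inflatedZ1_iff.mpr (h.inertia_le _ (isOpen_cocycleKer _) ?_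
      (h.cocycle_eq_zero hne hP _)), ?_⟩
    · exact sub_eq_zero.mpr hx
    · refine (Submodule.Quotient.eq (B1 τ)).mpr ?_
      rw [sub_sub_cancel_left]
      exact neg_mem (coboundary_mem hτ x)

/-- A cocycle is the translation part of an affine action. Let `s` act by `x ↦ s x + v` and `t`
linearly; the tame relation holds because `v` is fixed by `t`, so this extends to a homomorphism
into the finite group of permutations of `V`. -/
theorem exists_cocycle [Finite V] [I.Normal] (h : TameGenerators.{v, u} p I P q s t)
    (hne : ℓ ≠ p) (hτ : IsOpen (τ.ker : Set G)) (hP : ∀ σ ∈ P, τ σ = 1) {v : V}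
    (hv : v ∈ invariantsOf τ I) : ∃ c ∈ inflatedZ1 τ I, c.1 s = v := by
  have hτi : ∀ g x, τ g (τ g⁻¹ x) = x := fun g x => by
    rw [← Module.End.mul_apply, ← map_mul, mul_inv_cancel, map_one, Module.End.one_apply]
  have hτi' : ∀ g x, τ g⁻¹ (τ g x) = x := fun g x => by
    rw [← Module.End.mul_apply, ← map_mul, inv_mul_cancel, map_one, Module.End.one_apply]
  let S : Equiv.Perm V :=
    ⟨fun x => τ s x + v, fun x => τ s⁻¹ (x - v), fun x =>
      (congrArg (τ s⁻¹) (add_sub_cancel_right _ _)).trans (hτi' s x),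
      fun x => (congrArg (· + v) (hτi s (x - v))).trans (sub_add_cancel _ _)⟩
  let T : Equiv.Perm V := ⟨τ t, τ t⁻¹, hτi' t, hτi t⟩
  have hT : ∀ k x, (T ^ k) x = τ (t ^ k) x := by
    intro k
    induction k with
    | zero => intro x; rw [pow_zero, pow_zero, map_one]; rfl
    | succ k ih =>
      intro x
      rw [pow_succ, pow_succ, map_mul, Module.End.mul_apply, Equiv.Perm.mul_apply, ih]; rfl
  have hST : S * T * S⁻¹ = T ^ q := by
    rw [mul_inv_eq_iff_eq_mul]
    ext x
    rw [Equiv.Perm.mul_apply, Equiv.Perm.mul_apply, hT]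
    change τ s (τ t x) + v = τ (t ^ q) (τ s x + v)
    rw [map_add, hv _ (I.pow_mem h.mem_inertia q), ← Module.End.mul_apply, ← Module.End.mul_apply,
      ← map_mul, ← map_mul]
    congr 2
    rw [show s * t = s * t * s⁻¹ * (t ^ q)⁻¹ * (t ^ q * s) by group, map_mul, hP _ h.relation,
      one_mul]
  obtain ⟨j, hj, hj1⟩ := h.exists_pow_mem _ hτ hP
  obtain ⟨ψ, hψ, hψs, hψt, hψP⟩ := h.exists_hom (Equiv.Perm V) S T hST ⟨j, hj, by
    ext x
    rw [hT, MonoidHom.mem_ker.mp hj1]; rfl⟩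
  -- `A` consists of the elements acting affinely with linear part `τ g`. It is open and contains
  -- the generators and `P`.
  let A : Subgroup G :=
    { carrier := {g | ∀ x, ψ g x = τ g x + ψ g 0}
      one_mem' := fun x => by rw [map_one, map_one]; exact (add_zero x).symm
      mul_mem' := fun {a b} ha hb x => by
        rw [map_mul, map_mul, Equiv.Perm.mul_apply, Equiv.Perm.mul_apply, hb, ha, ha (ψ b 0),
          map_add, Module.End.mul_apply, add_assoc]
      inv_mem' := fun {a} ha x => by
        have hinv : ∀ y, ψ a (ψ a⁻¹ y) = y := fun y => by
          rw [← Equiv.Perm.mul_apply, ← map_mul, mul_inv_cancel, map_one, Equiv.Perm.one_apply]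
        apply (ψ a).injective
        rw [hinv, ha (τ a⁻¹ x + ψ a⁻¹ 0), map_add, hτi, add_assoc, ← ha (ψ a⁻¹ 0), hinv, add_zero] }
  have hker : ∀ g, ψ g = 1 → τ g = 1 → g ∈ A := fun g h1 h2 x => by
    rw [h1, h2]; exact (add_zero x).symm
  have hAo : IsOpen (A : Set G) :=
    Subgroup.isOpen_mono (H₁ := ψ.ker ⊓ τ.ker) (fun g hg => hker g hg.1 hg.2) (hψ.inter hτ)
  have hA : A = ⊤ := by
    refine h.eq_top A hAo (fun x => ?_) (h.inertia_le A hAo (fun x => ?_)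
      fun σ hσ => hker σ (hψP hσ) (hP σ hσ))
    · rw [hψs]
      change τ s x + v = τ s x + (τ s 0 + v)
      rw [map_zero, zero_add]
    · rw [hψt]
      change τ t x = τ t x + τ t 0
      rw [map_zero, add_zero]
  have hmul : ∀ g x, ψ g x = τ g x + ψ g 0 := fun g => by
    have : g ∈ A := hA ▸ Subgroup.mem_top g
    exact this
  let c : Z1 τ := ⟨fun g => ψ g 0, isLocallyConstant_of_forall_mem hψ fun g σ hσ => by
    rw [map_mul, MonoidHom.mem_ker.mp hσ, mul_one], fun g k => by
    change ψ (g * k) 0 = ψ g 0 + τ g (ψ k 0)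
    rw [map_mul, Equiv.Perm.mul_apply, hmul, add_comm]⟩
  refine ⟨c, mem_inflatedZ1_iff.mpr (h.inertia_le _ (isOpen_cocycleKer _) ?_
    (h.cocycle_eq_zero hne hP _)), ?_⟩
  · change ψ t 0 = 0
    rw [hψt]
    exact map_zero (τ t)
  · change ψ s 0 = v
    rw [hψs]
    change τ s 0 + v = v
    rw [map_zero, zero_add]

/-- The unramified cohomology has the same dimension as the invariants. -/
theorem finrank_H1unr [Finite V] [I.Normal] (h : TameGenerators.{v, u} p I P q s t)
    (hne : ℓ ≠ p) (hτ : IsOpen (τ.ker : Set G)) (hP : ∀ σ ∈ P, τ σ = 1) :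
    Module.Finite F (H1unr τ I) ∧ Module.finrank F (H1unr τ I) = h0 τ := by
  have hW : ∀ c ∈ inflatedZ1 τ I, c.1 s ∈ invariantsOf τ I := fun c hc σ hσ => (hc s σ hσ).2
  let E : inflatedZ1 τ I →ₗ[F] invariantsOf τ I :=
    { toFun := fun c => ⟨c.1.1 s, hW c.1 c.2⟩
      map_add' := fun _ _ => rfl
      map_smul' := fun _ _ => rfl }
  have hEs : Function.Surjective E := fun v => by
    obtain ⟨c, hc, hcs⟩ := h.exists_cocycle hne hτ hP v.2
    exact ⟨⟨c, hc⟩, Subtype.ext hcs⟩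
  have hEi : Function.Injective E := by
    intro c d hcd
    have h0 : (c.1 - d.1).1 s = 0 := sub_eq_zero.mpr (congrArg Subtype.val hcd)
    have h1 : cocycleKer (c.1 - d.1) = ⊤ := h.eq_top _ (isOpen_cocycleKer _) h0
      (mem_inflatedZ1_iff.mp (sub_mem c.2 d.2))
    refine Subtype.ext (Subtype.ext (funext fun g => ?_))
    have h2 : g ∈ cocycleKer (c.1 - d.1) := h1 ▸ Subgroup.mem_top g
    exact sub_eq_zero.mp h2
  -- An inflated cocycle is determined by its value at Frobenius, which can be any inertia
  -- invariant.
  let e : inflatedZ1 τ I ≃ₗ[F] invariantsOf τ I := LinearEquiv.ofBijective E ⟨hEi, hEs⟩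
  let f : invariantsOf τ I →ₗ[F] invariantsOf τ I :=
    (τ s - 1).restrict fun v hv => sub_mem (map_mem_invariantsOf hv s) hv
  have hf : ∀ v, (f v).1 = τ s v.1 - v.1 := fun _ => rfl
  let g : invariantsOf τ I →ₗ[F] H1unr τ I :=
    LinearMap.codRestrict (H1unr τ I) ((B1 τ).mkQ ∘ₗ (inflatedZ1 τ I).subtype ∘ₗ e.symm)
      fun v => Submodule.mem_map_of_mem (e.symm v).2
  have hg : Function.Surjective g := by
    rintro ⟨_, c, hc, rfl⟩
    refine ⟨e ⟨c, hc⟩, Subtype.ext ?_⟩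
    change (B1 τ).mkQ (e.symm (e ⟨c, hc⟩)).1 = _
    rw [e.symm_apply_apply]
  -- Coboundaries correspond to the image of `s - 1` on the inertia invariants. So the unramified
  -- cohomology is the cokernel of `s - 1` and the invariants are its kernel.
  have hker : LinearMap.ker g = LinearMap.range f := by
    ext v
    have h1 : v ∈ LinearMap.ker g ↔ (e.symm v).1 ∈ B1 τ := by
      rw [LinearMap.mem_ker, ← Submodule.Quotient.mk_eq_zero]
      exact Subtype.ext_iff
    have h2 : v.1 = (e.symm v).1.1 s := congrArg Subtype.val (e.apply_symm_apply v).symm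
    rw [h1]
    constructor
    · rintro ⟨x, hx⟩
      have hxI : x ∈ invariantsOf τ I := fun σ hσ => by
        rw [← sub_eq_zero, ← hx σ]
        exact mem_inflatedZ1_iff.mp (e.symm v).2 hσ
      exact ⟨⟨x, hxI⟩, Subtype.ext (by rw [hf, h2, hx s])⟩
    · rintro ⟨x, rfl⟩
      have h3 : coboundary hτ x.1 ∈ inflatedZ1 τ I :=
        mem_inflatedZ1_iff.mpr fun σ hσ => sub_eq_zero.mpr (x.2 σ hσ)
      have h4 : e ⟨_, h3⟩ = f x := Subtype.ext rfl
      rw [← h4, e.symm_apply_apply]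
      exact coboundary_mem hτ x.1
  have hinv : LinearMap.ker f ≃ₗ[F] τ.invariants :=
    { toFun := fun v => ⟨v.1.1, fun σ => by
        have h1 : vectorStabilizer τ v.1.1 = ⊤ := by
          refine h.eq_top _ (Subgroup.isOpen_mono (fun σ hσ => ?_) hτ) ?_ v.1.2
          · change τ σ _ = _
            rw [MonoidHom.mem_ker.mp hσ, Module.End.one_apply]
          · exact sub_eq_zero.mp (congrArg Subtype.val v.2)
        have h2 : σ ∈ vectorStabilizer τ v.1.1 := h1 ▸ Subgroup.mem_top σ
        exact h2⟩
      map_add' := fun _ _ => rfl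
      map_smul' := fun _ _ => rfl
      invFun := fun v => ⟨⟨v.1, fun σ _ => v.2 σ⟩, Subtype.ext (sub_eq_zero.mpr (v.2 s))⟩
      left_inv := fun _ => rfl
      right_inv := fun _ => rfl }
  have hfin : Module.Finite F (invariantsOf τ I) := Module.Finite.of_finite
  refine ⟨Module.Finite.of_surjective g hg, ?_⟩
  have h1 := LinearMap.finrank_range_add_finrank_ker g
  have h2 := LinearMap.finrank_range_add_finrank_ker f
  rw [LinearMap.range_eq_top.mpr hg, finrank_top, hker] at h1
  rw [h0, ← hinv.finrank_eq]
  omega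

end TameGenerators

end Cocycles

end LocalDeformation

/-! ### Ideals killed by the maximal ideal. -/

open ValuativeRel IsLocalRing

namespace LocalDeformation

/-- Infinitesimal determinants. -/
theorem det_one_add_of_mul_eq_zero {R : Type*} [CommRing R] {n : Type*} [Fintype n]
    [DecidableEq n] {J : Ideal R} (hJ : ∀ x ∈ J, ∀ y ∈ J, x * y = 0) {D : Matrix n n R}
    (hD : ∀ i j, D i j ∈ J) : (1 + D).det = 1 + D.trace := by
  rw [Matrix.det_apply, Finset.sum_eq_single 1]
  · rw [Equiv.Perm.sign_one, one_smul, Matrix.trace]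
    have h1 : ∀ S : Finset n, ∏ i ∈ S, (1 + D i i) = 1 + ∑ i ∈ S, D i i := by
      intro S
      induction S using Finset.induction_on with
      | empty => simp
      | insert a S ha ih =>
        rw [Finset.prod_insert ha, Finset.sum_insert ha, ih, add_mul, one_mul, mul_add, mul_one,
          hJ _ (hD a a) _ (sum_mem fun i _ => hD i i)]
        ring
    exact (Finset.prod_congr rfl fun i _ => by
      rw [Equiv.Perm.one_apply, Matrix.add_apply, Matrix.one_apply_eq]).trans (h1 Finset.univ)
  · intro σ _ hσ
    obtain ⟨i, hi⟩ : ∃ i, σ i ≠ i := by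
      by_contra h
      push Not at h
      exact hσ (Equiv.ext h)
    have hi' : σ (σ i) ≠ σ i := fun h => hi (σ.injective h)
    have hmem : ∀ k, σ k ≠ k → (1 + D) (σ k) k ∈ J := fun k hk => by
      rw [Matrix.add_apply, Matrix.one_apply_ne hk, zero_add]
      exact hD _ _
    -- A nontrivial permutation moves both `i` and `σ i`, so its term contains two factors from `J`,
    -- whose product is zero.
    rw [← Finset.mul_prod_erase _ _ (Finset.mem_univ i),
      ← Finset.mul_prod_erase _ _ (Finset.mem_erase.mpr ⟨hi, Finset.mem_univ (σ i)⟩), ← mul_assoc,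
      hJ _ (hmem i hi) _ (hmem _ hi'), zero_mul, smul_zero]
  · exact fun h => absurd (Finset.mem_univ _) h

namespace CoeffRing

variable {ℓ : ℕ} [Fact ℓ.Prime] {F : Type u} [Field F] (R : CoeffRing ℓ F) {J : Ideal R}

/-- Scalars act on `J` through their residues. This is why the Teichmüller section, which is not
additive, still describes the `F`-structure. -/
theorem mul_eq_mul_of_residue_eq (hJ : maximalIdeal R * J = ⊥) {y a b : R} (hy : y ∈ J)
    (h : R.residue a = R.residue b) : a * y = b * y := by
  have h1 : a - b ∈ maximalIdeal R := by rw [mem_maximalIdeal_iff, map_sub, h, sub_self]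
  rw [← sub_eq_zero, ← sub_mul, ← Ideal.mem_bot, ← hJ]
  exact Ideal.mul_mem_mul h1 hy

/-- By Artin–Rees a high power of the maximal ideal meets `J` inside `𝔪 J = 0`. So `J` is discrete
in the adic topology, which makes differences of lifts locally constant. -/
theorem exists_pow_inf_eq_bot (hJ : maximalIdeal R * J = ⊥) :
    ∃ k, ∀ x ∈ J, x ∈ maximalIdeal R ^ k → x = 0 := by
  obtain ⟨k, hk⟩ := (maximalIdeal R).exists_pow_inf_eq_pow_smul (M := R) J
  refine ⟨k + 1, fun x hx hxm => ?_⟩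
  have h1 := hk (k + 1) (Nat.le_succ k)
  rw [smul_eq_mul, Ideal.mul_top, Nat.add_sub_cancel_left, pow_one] at h1
  have h2 : x ∈ maximalIdeal R • (maximalIdeal R ^ k • (⊤ : Ideal R) ⊓ J) := h1 ▸ ⟨hxm, hx⟩
  have h3 : maximalIdeal R • (maximalIdeal R ^ k • (⊤ : Ideal R) ⊓ J) ≤ ⊥ :=
    hJ ▸ Ideal.mul_mono_right inf_le_right
  exact h3 h2

/-- Coordinates on an ideal killed by the maximal ideal. -/
theorem exists_coordinates (hJ : maximalIdeal R * J = ⊥) :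
    ∃ (d : ℕ) (x : Fin d → R) (c : Fin d → R → F), (∀ j, x j ∈ J) ∧
      (∀ y ∈ J, y = ∑ j, algebraMap (WittVector ℓ F) R (WittVector.teichmuller ℓ (c j y)) * x j) ∧
      (∀ j, ∀ y ∈ J, ∀ z ∈ J, c j (y + z) = c j y + c j z) ∧
      ∀ j, ∀ r, ∀ y ∈ J, c j (r * y) = R.residue r * c j y := by
  let θ : F → R := fun a => algebraMap (WittVector ℓ F) R (WittVector.teichmuller ℓ a)
  have hθ : ∀ a, R.residue (θ a) = a := fun a => by
    rw [R.residue_algebraMap]; exact WittVector.teichmuller_coeff_zero ℓ a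
  let _ : SMul F J := ⟨fun a y => θ a • y⟩
  let _ : Module F J := Function.Surjective.moduleLeft R.residue R.residue_surjective
    fun r y => Subtype.ext (R.mul_eq_mul_of_residue_eq hJ y.2 (hθ _))
  let f : J →ₛₗ[R.residue] J :=
    { toFun := id
      map_add' := fun _ _ => rfl
      map_smul' := fun r y => Subtype.ext (R.mul_eq_mul_of_residue_eq hJ y.2 (hθ _).symm) }
  have : RingHomSurjective R.residue := ⟨R.residue_surjective⟩
  -- `J` is finitely generated over the noetherian ring `R`, and the identity is semilinear along
  -- the residue map.
  have : Module.Finite F J := Module.Finite.of_surjective f Function.surjective_id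
  let b := Module.finBasis F J
  -- The coordinates are extended by zero outside `J`; only their values on `J` are used.
  refine ⟨_, fun j => (b j).1, fun j y => open Classical in
    if hy : y ∈ J then b.repr ⟨y, hy⟩ j else 0, fun j => (b j).2, fun y hy => ?_,
    fun j y hy z hz => ?_, fun j r y hy => ?_⟩
  · have h1 := congrArg Subtype.val (b.sum_repr ⟨y, hy⟩)
    rw [AddSubmonoidClass.coe_finsetSum] at h1
    refine h1.symm.trans (Finset.sum_congr rfl fun j _ => ?_)
    simp only [dif_pos hy]; rfl
  · simp only [dif_pos hy, dif_pos hz, dif_pos (add_mem hy hz)]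
    exact DFunLike.congr_fun (b.repr.map_add ⟨y, hy⟩ ⟨z, hz⟩) j
  · simp only [dif_pos hy, dif_pos (J.mul_mem_left r hy)]
    have h1 : (⟨r * y, J.mul_mem_left r hy⟩ : J) = R.residue r • ⟨y, hy⟩ := f.map_smulₛₗ r ⟨y, hy⟩
    rw [h1, map_smul]; rfl

end CoeffRing

end LocalDeformation

/-! ### Differences of lifts and the tangent space. -/

open ValuativeRel IsLocalRing

namespace LocalDeformation

section Coordinates

variable {R F : Type*} [CommRing R] [Field F] {n : ℕ} {J : Ideal R} {res : R →+* F} {c : R → F}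

theorem coordinate_sum (hadd : ∀ y ∈ J, ∀ z ∈ J, c (y + z) = c y + c z)
    (hmul : ∀ r, ∀ y ∈ J, c (r * y) = res r * c y) {ι : Type*} (S : Finset ι) {y : ι → R}
    (hy : ∀ i, y i ∈ J) : c (∑ i ∈ S, y i) = ∑ i ∈ S, c (y i) := by
  classical
  induction S using Finset.induction_on with
  | empty =>
    have h := hmul 0 0 J.zero_mem
    rwa [zero_mul, map_zero, zero_mul] at h
  | insert a S ha ih =>
    rw [Finset.sum_insert ha, Finset.sum_insert ha, hadd _ (hy a) _ (sum_mem fun i _ => hy i), ih]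

theorem matrix_mul_mem_left {D : Matrix (Fin n) (Fin n) R} (hD : ∀ i j, D i j ∈ J)
    (A : Matrix (Fin n) (Fin n) R) (i j : Fin n) : (A * D) i j ∈ J := by
  rw [Matrix.mul_apply]
  exact sum_mem fun k _ => J.mul_mem_left _ (hD k j)

theorem matrix_mul_mem_right {D : Matrix (Fin n) (Fin n) R} (hD : ∀ i j, D i j ∈ J)
    (A : Matrix (Fin n) (Fin n) R) (i j : Fin n) : (D * A) i j ∈ J := by
  rw [Matrix.mul_apply]
  exact sum_mem fun k _ => J.mul_mem_right _ (hD i k)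

theorem coordinate_mul_mul (hadd : ∀ y ∈ J, ∀ z ∈ J, c (y + z) = c y + c z)
    (hmul : ∀ r, ∀ y ∈ J, c (r * y) = res r * c y) {D : Matrix (Fin n) (Fin n) R}
    (hD : ∀ i j, D i j ∈ J) (A B : Matrix (Fin n) (Fin n) R) :
    (A * D * B).map c = A.map res * D.map c * B.map res := by
  have h1 : (A * D).map c = A.map res * D.map c := Matrix.ext fun i j => by
    rw [Matrix.map_apply, Matrix.mul_apply, Matrix.mul_apply,
      coordinate_sum hadd hmul _ fun k => J.mul_mem_left _ (hD k j)]
    exact Finset.sum_congr rfl fun k _ => hmul _ _ (hD k j)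
  rw [← h1]
  refine Matrix.ext fun i j => ?_
  rw [Matrix.map_apply, Matrix.mul_apply, Matrix.mul_apply,
    coordinate_sum hadd hmul _ fun k => J.mul_mem_right _ (matrix_mul_mem_left hD A i k)]
  exact Finset.sum_congr rfl fun k _ => by
    rw [mul_comm, hmul _ _ (matrix_mul_mem_left hD A i k), mul_comm]; rfl

theorem matrix_mul_eq_zero (hJ : ∀ x ∈ J, ∀ y ∈ J, x * y = 0) {D E : Matrix (Fin n) (Fin n) R}
    (hD : ∀ i j, D i j ∈ J) (hE : ∀ i j, E i j ∈ J) : D * E = 0 :=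
  Matrix.ext fun i j => by
    rw [Matrix.mul_apply]
    exact Finset.sum_eq_zero fun k _ => hJ _ (hD i k) _ (hE k j)

end Coordinates

section Adjoint

variable {F : Type u} [Field F] {G : Type v} [Group G] {n : ℕ}

theorem coe_ad0Rep_apply (ρbar : G →* GL (Fin n) F) (g : G) (X : TraceZero F n) :
    (ad0Rep ρbar g X).1 = (ρbar g).val * X.1 * (ρbar g)⁻¹.val := rfl

theorem ker_le_ker_ad0Rep (ρbar : G →* GL (Fin n) F) : ρbar.ker ≤ (ad0Rep ρbar).ker :=
  fun g hg => LinearMap.ext fun X => Subtype.ext (by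
    rw [coe_ad0Rep_apply, MonoidHom.mem_ker.mp hg, inv_one, Units.val_one, one_mul, mul_one]; rfl)

end Adjoint

variable {ℓ : ℕ} [Fact ℓ.Prime] {F : Type u} [Field F]
  {G : Type v} [Group G] [TopologicalSpace G] [IsTopologicalGroup G] {n : ℕ}

/-- The matrix-valued difference of two lifts. -/
def liftDifference {R : Type u} [CommRing R] (ρ₁ ρ₂ : G →* GL (Fin n) R) (g : G) :
    Matrix (Fin n) (Fin n) R := (ρ₂ g).val * (ρ₁ g)⁻¹.val - 1

section Difference

variable {R : Type u} [CommRing R] {ρ₁ ρ₂ : G →* GL (Fin n) R}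

omit [TopologicalSpace G] [IsTopologicalGroup G] in
-- When the difference has entries in an ideal killed by `𝔪`, the outer factors act through `ρbar`
-- and this becomes the cocycle identity for the adjoint representation.
theorem liftDifference_mul (g k : G) : liftDifference ρ₁ ρ₂ (g * k) =
    liftDifference ρ₁ ρ₂ g + (ρ₂ g).val * liftDifference ρ₁ ρ₂ k * (ρ₁ g)⁻¹.val := by
  simp only [liftDifference, map_mul, mul_inv_rev, Units.val_mul]
  noncomm_ring

omit [TopologicalSpace G] [IsTopologicalGroup G] in
theorem liftDifference_mem {J : Ideal R}
    (h : pushRep (Ideal.Quotient.mk J) ρ₁ = pushRep (Ideal.Quotient.mk J) ρ₂) (g : G)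
    (i j : Fin n) : liftDifference ρ₁ ρ₂ g i j ∈ J := by
  have h1 : Matrix.GeneralLinearGroup.map (Ideal.Quotient.mk J) (ρ₂ g * (ρ₁ g)⁻¹) =
      Matrix.GeneralLinearGroup.map (Ideal.Quotient.mk J) 1 := by
    have h2 : Matrix.GeneralLinearGroup.map (Ideal.Quotient.mk J) (ρ₁ g) =
      Matrix.GeneralLinearGroup.map (Ideal.Quotient.mk J) (ρ₂ g) := DFunLike.congr_fun h g
    rw [map_mul, map_inv, h2, mul_inv_cancel, map_one]
  exact map_mk_eq_iff.mp h1 i j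

end Difference

/-- The coordinates of the difference of two lifts are cocycles. -/
theorem exists_cocycle_coordinate {ρbar : G →* GL (Fin n) F} {η : G →* (WittVector ℓ F)ˣ}
    {R : CoeffRing ℓ F} {J : Ideal R} (hJ : maximalIdeal R * J = ⊥) (hJm : J ≤ maximalIdeal R)
    {c : R → F} (hadd : ∀ y ∈ J, ∀ z ∈ J, c (y + z) = c y + c z)
    (hmul : ∀ r, ∀ y ∈ J, c (r * y) = R.residue r * c y)
    {ρ₁ ρ₂ : G →* GL (Fin n) R} (h₁ : IsLift ρbar η R ρ₁) (h₂ : IsLift ρbar η R ρ₂)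
    (h : pushRep (Ideal.Quotient.mk J) ρ₁ = pushRep (Ideal.Quotient.mk J) ρ₂) :
    ∃ z : Z1 (ad0Rep ρbar), ∀ g, (z.1 g).1 = (liftDifference ρ₁ ρ₂ g).map c := by
  have hJJ : ∀ x ∈ J, ∀ y ∈ J, x * y = 0 := fun x hx y hy => by
    rw [← Ideal.mem_bot, ← hJ]
    exact Ideal.mul_mem_mul (hJm hx) hy
  have hmem := liftDifference_mem h
  have htr : ∀ g, ((liftDifference ρ₁ ρ₂ g).map c).trace = 0 := by
    intro g
    -- Equal determinants and `J ^ 2 = 0` force the trace of the difference to vanish.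
    have h3 : (1 + liftDifference ρ₁ ρ₂ g).det = 1 := by
      have h4 : Matrix.GeneralLinearGroup.det (ρ₂ g * (ρ₁ g)⁻¹) = 1 := by
        rw [map_mul, map_inv, h₁.det_eq, h₂.det_eq, mul_inv_cancel]
      rw [liftDifference, add_sub_cancel]
      exact congrArg Units.val h4
    rw [det_one_add_of_mul_eq_zero hJJ (hmem g), add_eq_left] at h3
    have h5 := coordinate_sum hadd hmul Finset.univ fun i => hmem g i i
    have h6 := hmul 0 0 J.zero_mem
    rw [zero_mul, map_zero, zero_mul] at h6
    change c (Matrix.trace (liftDifference ρ₁ ρ₂ g)) = _ at h5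
    rw [h3, h6] at h5
    exact h5.symm
  obtain ⟨k, hk⟩ := R.exists_pow_inf_eq_bot hJ
  refine ⟨⟨fun g => ⟨(liftDifference ρ₁ ρ₂ g).map c, htr g⟩, ?_, fun g σ => Subtype.ext ?_⟩,
    fun g => rfl⟩
  · have hU : IsOpen (((pushRep (Ideal.Quotient.mk (maximalIdeal R ^ k)) ρ₁).ker ⊓
        (pushRep (Ideal.Quotient.mk (maximalIdeal R ^ k)) ρ₂).ker : Subgroup G) : Set G) :=
      (isContinuousRep_iff.mp h₁.continuous k).inter (isContinuousRep_iff.mp h₂.continuous k)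
    refine isLocallyConstant_of_forall_mem hU fun g σ hσ => Subtype.ext ?_
    -- On this open subgroup the entries of `ρ₁ σ - ρ₂ σ` lie in `J ∩ 𝔪 ^ k = 0`.
    have h3 : ρ₁ σ = ρ₂ σ := by
      refine Units.ext (Matrix.ext fun i j => ?_)
      rw [← sub_eq_zero]
      refine hk _ ?_ ?_
      · exact map_mk_eq_iff.mp (DFunLike.congr_fun h σ) i j
      · have h4 := sub_mem (mem_ker_pushRep_mk.mp hσ.1 i j) (mem_ker_pushRep_mk.mp hσ.2 i j)
        rwa [sub_sub_sub_cancel_right] at h4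
    change (liftDifference ρ₁ ρ₂ (g * σ)).map c = (liftDifference ρ₁ ρ₂ g).map c
    congr 1
    rw [liftDifference, map_mul, map_mul, h3, ← Units.val_mul, mul_inv_rev, mul_assoc,
      mul_inv_cancel_left, Units.val_mul, liftDifference]
  · change (liftDifference ρ₁ ρ₂ (g * σ)).map c = (liftDifference ρ₁ ρ₂ g).map c +
      (ρbar g).val * (liftDifference ρ₁ ρ₂ σ).map c * (ρbar g)⁻¹.val
    have h3 : (ρ₁ g)⁻¹.val.map R.residue = (ρbar g)⁻¹.val := by
      rw [← map_inv, ← map_inv]; exact residue_val h₁ g⁻¹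
    rw [liftDifference_mul, ← residue_val h₂ g, ← h3, ← coordinate_mul_mul hadd hmul (hmem σ)]
    exact Matrix.ext fun i j => hadd _ (hmem g i j) _
      (matrix_mul_mem_right (matrix_mul_mem_left (hmem σ) _) _ i j)

namespace LiftData

variable [CharP F ℓ] [Finite F] {p : ℕ} [Fact p.Prime] {I P : Subgroup G} [I.Normal] {q : ℕ}
  {s t : G} {ρbar : G →* GL (Fin n) F} {T : Matrix (Fin n) (Fin n) (WittVector ℓ F)}

omit [Finite F] in
theorem mkQ_mem_H1unr_iff (h : LiftData p I P q s t ρbar T) {c : Z1 (ad0Rep ρbar)} :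
    (B1 (ad0Rep ρbar)).mkQ c ∈ H1unr (ad0Rep ρbar) I ↔ ∃ v, c.1 t = ad0Rep ρbar t v - v :=
  h.gen.mkQ_mem_H1unr_iff h.ne (Subgroup.isOpen_mono (ker_le_ker_ad0Rep ρbar) h.continuous.isOpen_ker)
    fun σ hσ => ker_le_ker_ad0Rep ρbar (h.tame σ hσ)

theorem finrank_H1unr (h : LiftData p I P q s t ρbar T) :
    Module.Finite F (H1unr (ad0Rep ρbar) I) ∧
      Module.finrank F (H1unr (ad0Rep ρbar) I) = h0 (ad0Rep ρbar) :=
  h.gen.finrank_H1unr h.ne (Subgroup.isOpen_mono (ker_le_ker_ad0Rep ρbar) h.continuous.isOpen_ker)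
    fun σ hσ => ker_le_ker_ad0Rep ρbar (h.tame σ hσ)

/-- The conjugators differ modulo `J` by an element of the centralizer of `T`. Lifting it to `Z`
gives `U = Y₂ Z⁻¹ Y₁⁻¹ ≡ 1` modulo `J` with `ρ₂(t) U = U ρ₁(t)`. So the difference at `t` is, up to
sign, the coboundary of `M = U - 1`, and classes trivial at `t` are unramified. -/
theorem differenceMem_of_mem (h : LiftData p I P q s t ρbar T)
    {Z₀ : Matrix (Fin n) (Fin n) F} (hZ₀ : Z₀.trace = 1)
    (hZ₀t : Z₀ * (ρbar t).val = (ρbar t).val * Z₀) {R : CoeffRing ℓ F} {J : Ideal R}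
    (hJ : maximalIdeal R * J = ⊥) (hJm : J ≤ maximalIdeal R) {ρ₁ ρ₂ : G →* GL (Fin n) R}
    (hρ₁ : ρ₁ ∈ minimalLifts ρbar T t R) (hρ₂ : ρ₂ ∈ minimalLifts ρbar T t R)
    (heq : pushRep (Ideal.Quotient.mk J) ρ₁ = pushRep (Ideal.Quotient.mk J) ρ₂) :
    DifferenceMem ρbar (H1unr (ad0Rep ρbar) I) J ρ₁ ρ₂ := by
  have hJJ : ∀ x ∈ J, ∀ y ∈ J, x * y = 0 := fun x hx y hy => by
    rw [← Ideal.mem_bot, ← hJ]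
    exact Ideal.mul_mem_mul (hJm hx) hy
  obtain ⟨h₁, Y₁, hY₁, hT₁⟩ := hρ₁
  obtain ⟨h₂, Y₂, hY₂, hT₂⟩ := hρ₂
  obtain ⟨tR, htR, -⟩ := R.exists_unit_of_map_residue (B := ρbar t)
    ((map_residue_algebraMap T R).trans h.map_eq)
  replace hT₁ : ρ₁ t * Y₁ = Y₁ * tR := Units.ext (by rw [Units.val_mul, hT₁, ← htR]; rfl)
  replace hT₂ : ρ₂ t * Y₂ = Y₂ * tR := Units.ext (by rw [Units.val_mul, hT₂, ← htR]; rfl)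
  let mp := Matrix.GeneralLinearGroup.map (n := Fin n) (Ideal.Quotient.mk J)
  have htQ : (mp tR).val = T.map (algebraMap (WittVector ℓ F) (R ⧸ J)) := by
    change tR.val.map _ = _
    rw [htR]; rfl
  have hmeq : mp (ρ₁ t) = mp (ρ₂ t) := DFunLike.congr_fun heq t
  have hcomm : mp (Y₁⁻¹ * Y₂) * mp tR = mp tR * mp (Y₁⁻¹ * Y₂) := by
    rw [← map_mul, mul_assoc, ← hT₂, map_mul, map_mul, ← hmeq, ← map_mul, ← map_mul,
      ← map_mul, ← mul_assoc, ← mul_assoc]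
    congr 2
    rw [eq_mul_inv_iff_mul_eq, mul_assoc, hT₁, inv_mul_cancel_left]
  obtain ⟨Zm, hZm, hZm2⟩ := exists_lift_intertwiner h.comm (Ideal.Quotient.mkₐ (WittVector ℓ F) J)
    Ideal.Quotient.mk_surjective (mp (Y₁⁻¹ * Y₂)).val (by
      have h3 := congrArg Units.val hcomm
      rw [Units.val_mul, Units.val_mul, htQ] at h3
      exact h3.trans (congrArg (· * (mp (Y₁⁻¹ * Y₂)).val)
        (pow_one (T.map (algebraMap (WittVector ℓ F) (R ⧸ J)))).symm))
  obtain ⟨Z, rfl, -⟩ := R.exists_unit_of_map_residue (B := 1) (A := Zm) (by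
    refine Matrix.ext fun i j => ?_
    have h3 : R.residue ((Y₁⁻¹ * Y₂).val i j) = (1 : Matrix (Fin n) (Fin n) F) i j := by
      have h4 : Matrix.GeneralLinearGroup.map R.residue (Y₁⁻¹ * Y₂) = 1 := by
        rw [map_mul, map_inv, hY₁, hY₂, inv_one, one_mul]
      have h5 := congrArg (fun A : GL (Fin n) F => A.val i j) h4
      exact h5
    rw [Units.val_one, ← h3, Matrix.map_apply, ← sub_eq_zero, ← map_sub, ← R.mem_maximalIdeal_iff]
    exact hJm (Ideal.Quotient.eq.mp (congrFun (congrFun hZm i) j)))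
  have hZT : Z * tR = tR * Z := Units.ext (by
    rw [Units.val_mul, htR, hZm2, pow_one, ← htR]; rfl)
  have hZ : mp Z = mp (Y₁⁻¹ * Y₂) := Units.ext hZm
  let U := Y₂ * Z⁻¹ * Y₁⁻¹
  have hU : ρ₂ t * U = U * ρ₁ t := by
    have h3 : ρ₁ t = Y₁ * tR * Y₁⁻¹ := eq_mul_inv_of_mul_eq hT₁
    have h4 : ρ₂ t = Y₂ * tR * Y₂⁻¹ := eq_mul_inv_of_mul_eq hT₂
    have h5 : tR * Z⁻¹ = Z⁻¹ * tR := by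
      rw [mul_inv_eq_iff_eq_mul, mul_assoc, ← hZT, inv_mul_cancel_left]
    rw [h3, h4]
    simp only [U]
    rw [show Y₂ * tR * Y₂⁻¹ * (Y₂ * Z⁻¹ * Y₁⁻¹) = Y₂ * (tR * Z⁻¹) * Y₁⁻¹ by group, h5]
    group
  have hU1 : mp U = 1 := by
    simp only [U]
    rw [map_mul, map_mul, map_inv mp Z, hZ, ← map_inv, ← map_mul, ← map_mul,
      show Y₂ * (Y₁⁻¹ * Y₂)⁻¹ * Y₁⁻¹ = 1 by group, map_one]
  obtain ⟨M, hM⟩ : ∃ M, M = U.val - 1 := ⟨_, rfl⟩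
  have hMJ : ∀ i j, M i j ∈ J := fun i j => by
    rw [hM]
    exact map_mk_eq_iff.mp (hU1.trans (map_one mp).symm) i j
  have hdiff : liftDifference ρ₁ ρ₂ t = M - (ρ₁ t).val * M * (ρ₁ t)⁻¹.val := by
    have h3 : U.val = 1 + M := by rw [hM, add_sub_cancel]
    have h4 : (ρ₂ t).val * (1 + M) * (ρ₁ t)⁻¹.val = 1 + M := by
      rw [← h3, ← Units.val_mul, ← Units.val_mul, hU, mul_inv_cancel_right]
    have h5 : (ρ₂ t).val * M = (ρ₁ t).val * M := by
      rw [← sub_eq_zero, ← sub_mul]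
      refine matrix_mul_eq_zero hJJ (fun i j => ?_) hMJ
      exact map_mk_eq_iff.mp hmeq.symm i j
    rw [mul_add, mul_one, add_mul, h5] at h4
    rw [liftDifference, eq_sub_of_add_eq h4]; abel
  obtain ⟨d, x, c, hx, hrepr, hadd, hmul⟩ := R.exists_coordinates hJ
  choose z hz using fun j => exists_cocycle_coordinate hJ hJm (hadd j) (hmul j) h₁ h₂ heq
  refine ⟨d, z, x, hx, fun j => h.mkQ_mem_H1unr_iff.mpr ?_, fun g a b => ?_⟩
  · have h3 : (ρ₁ t)⁻¹.val.map R.residue = (ρbar t)⁻¹.val := by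
      rw [← map_inv, ← map_inv]; exact residue_val h₁ t⁻¹
    have h4 : (z j).1 t = M.map (c j) - (ρbar t).val * M.map (c j) * (ρbar t)⁻¹.val := by
      rw [hz, hdiff, ← residue_val h₁ t, ← h3, ← coordinate_mul_mul (hadd j) (hmul j) hMJ]
      refine Matrix.ext fun a b => ?_
      have h6 := matrix_mul_mem_right (matrix_mul_mem_left hMJ (ρ₁ t).val) (ρ₁ t)⁻¹.val a b
      rw [Matrix.map_apply, Matrix.sub_apply, Matrix.sub_apply, eq_sub_iff_add_eq]
      refine (hadd j _ (sub_mem (hMJ a b) h6) _ h6).symm.trans ?_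
      rw [sub_add_cancel]; rfl
    -- `M` need not have trace zero. Adding a multiple of the trace-one matrix `Z₀`, which commutes
    -- with `ρbar t`, moves it into `ad⁰` without changing the coboundary at `t`.
    let w : TraceZero F n := ⟨(M.map (c j)).trace • Z₀ - M.map (c j), by
      rw [LinearMap.mem_ker, Matrix.traceLinearMap_apply, Matrix.trace_sub, Matrix.trace_smul, hZ₀,
        smul_eq_mul, mul_one, sub_self]⟩
    refine ⟨w, Subtype.ext ?_⟩
    have h5 : (ρbar t).val * Z₀ * (ρbar t)⁻¹.val = Z₀ := by
      rw [← hZ₀t, mul_assoc, ← Units.val_mul, mul_inv_cancel, Units.val_one, mul_one]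
    rw [h4]
    change _ = (ρbar t).val * ((M.map (c j)).trace • Z₀ - M.map (c j)) * (ρbar t)⁻¹.val -
      ((M.map (c j)).trace • Z₀ - M.map (c j))
    rw [mul_sub, sub_mul, mul_smul_comm, smul_mul_assoc, h5]; abel
  · change liftDifference ρ₁ ρ₂ g a b = _
    rw [hrepr _ (liftDifference_mem heq g a b)]
    exact Finset.sum_congr rfl fun j _ => by rw [hz, Matrix.map_apply]

/-- An unramified cocycle is at `t` the coboundary of some `w j`. With `N` the sum of the `x j * w
j`, the matrix `1 - N` conjugates `ρ₁(t)` into `ρ₂(t)`, so `(1 - N) Y` is the new conjugator. -/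
theorem mem_of_differenceMem (h : LiftData p I P q s t ρbar T) {R : CoeffRing ℓ F} {J : Ideal R}
    (hJ : maximalIdeal R * J = ⊥) (hJm : J ≤ maximalIdeal R) {ρ₁ ρ₂ : G →* GL (Fin n) R}
    (hρ₁ : ρ₁ ∈ minimalLifts ρbar T t R) (h₂ : IsLift ρbar (teichmullerDet ℓ ρbar) R ρ₂)
    (hd : DifferenceMem ρbar (H1unr (ad0Rep ρbar) I) J ρ₁ ρ₂) :
    ρ₂ ∈ minimalLifts ρbar T t R := by
  have hJJ : ∀ x ∈ J, ∀ y ∈ J, x * y = 0 := fun x hx y hy => by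
    rw [← Ideal.mem_bot, ← hJ]
    exact Ideal.mul_mem_mul (hJm hx) hy
  obtain ⟨h₁, Y, hY, hYT⟩ := hρ₁
  obtain ⟨m, c, x, hx, hc, hdiff⟩ := hd
  choose w hw using fun j => h.mkQ_mem_H1unr_iff.mp (hc j)
  let θ : F → R := fun a => algebraMap (WittVector ℓ F) R (WittVector.teichmuller ℓ a)
  have hθ : ∀ a, R.residue (θ a) = a := fun a => by
    rw [R.residue_algebraMap]; exact WittVector.teichmuller_coeff_zero ℓ a
  have hθm : ∀ A : Matrix (Fin n) (Fin n) F, (A.map θ).map R.residue = A := fun A =>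
    Matrix.ext fun i j => hθ _
  let N : Matrix (Fin n) (Fin n) R := ∑ j, x j • (w j).1.map θ
  have hN : ∀ a b, N a b ∈ J := fun a b => by
    change (∑ j, x j • (w j).1.map θ) a b ∈ J
    rw [Matrix.sum_apply]
    exact sum_mem fun j _ => J.mul_mem_right _ (hx j)
  have hinv : (ρ₁ t)⁻¹.val.map R.residue = (ρbar t)⁻¹.val := by
    rw [← map_inv, ← map_inv]; exact residue_val h₁ t⁻¹
  have hd1 : (ρ₂ t).val * (ρ₁ t)⁻¹.val - 1 = (ρ₁ t).val * N * (ρ₁ t)⁻¹.val - N := by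
    have h3 : (ρ₁ t).val * N * (ρ₁ t)⁻¹.val - N =
        ∑ j, x j • ((ρ₁ t).val * (w j).1.map θ * (ρ₁ t)⁻¹.val - (w j).1.map θ) := by
      simp only [N, smul_sub, Finset.sum_sub_distrib, Finset.mul_sum, Finset.sum_mul,
        mul_smul_comm, smul_mul_assoc]
    rw [h3]
    refine Matrix.ext fun a b => ?_
    rw [hdiff, Matrix.sum_apply]
    refine Finset.sum_congr rfl fun j _ => ?_
    rw [Matrix.smul_apply, smul_eq_mul, mul_comm (x j)]
    refine R.mul_eq_mul_of_residue_eq hJ (hx j) ?_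
    have h4 : ((ρ₁ t).val * (w j).1.map θ * (ρ₁ t)⁻¹.val - (w j).1.map θ).map R.residue =
        ((c j).1 t).1 := by
      rw [hw, Matrix.map_sub _ (map_sub _), Matrix.map_mul, Matrix.map_mul, hθm, residue_val h₁,
        hinv]; rfl
    exact (hθ _).trans (congrFun (congrFun h4 a) b).symm
  have hres : (1 - N).map R.residue = 1 := by
    rw [Matrix.map_sub _ (map_sub _), Matrix.map_one _ (map_zero _) (map_one _)]
    have h3 : N.map R.residue = 0 := Matrix.ext fun a b =>
      (R.mem_maximalIdeal_iff).mp (hJm (hN a b))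
    rw [h3, sub_zero]
  obtain ⟨V, hV, hV1⟩ := R.exists_unit_of_map_residue (B := 1) (A := 1 - N) hres
  have hcomm : (ρ₂ t).val * V.val = V.val * (ρ₁ t).val := by
    have h3 : (ρ₂ t).val = (ρ₁ t).val + ((ρ₁ t).val * N - N * (ρ₁ t).val) := by
      have h4 := congrArg (· * (ρ₁ t).val) hd1
      simp only [sub_mul, one_mul, mul_assoc] at h4
      rw [← Units.val_mul, inv_mul_cancel, Units.val_one, mul_one, mul_one] at h4
      rw [← h4]; abel
    have h5 : ∀ A, N * A * N = 0 := fun A =>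
      matrix_mul_eq_zero hJJ (matrix_mul_mem_right hN A) hN
    have h6 : N * N = 0 := matrix_mul_eq_zero hJJ hN hN
    rw [hV, h3, mul_sub, mul_one, add_mul, sub_mul, mul_assoc, h6, h5, mul_zero, sub_mul, one_mul]
    abel
  refine ⟨h₂, V * Y, by rw [map_mul, hV1, hY, one_mul], ?_⟩
  rw [Units.val_mul, ← mul_assoc, hcomm, mul_assoc, hYT, mul_assoc]

theorem minimalLifts_P7 (h : LiftData p I P q s t ρbar T)
    {Z₀ : Matrix (Fin n) (Fin n) F} (hZ₀ : Z₀.trace = 1)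
    (hZ₀t : Z₀ * (ρbar t).val = (ρbar t).val * Z₀) {R : CoeffRing ℓ F} {J : Ideal R}
    (hJ : maximalIdeal R * J = ⊥) {ρ₁ ρ₂ : G →* GL (Fin n) R}
    (hρ₁ : ρ₁ ∈ minimalLifts ρbar T t R) (h₂ : IsLift ρbar (teichmullerDet ℓ ρbar) R ρ₂)
    (heq : pushRep (Ideal.Quotient.mk J) ρ₁ = pushRep (Ideal.Quotient.mk J) ρ₂) :
    DifferenceMem ρbar (H1unr (ad0Rep ρbar) I) J ρ₁ ρ₂ ↔ ρ₂ ∈ minimalLifts ρbar T t R := by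
  -- If `J` is the unit ideal, then `R` is a field and both lifts are `ρbar`; the empty sum
  -- witnesses the condition on the difference.
  by_cases hJt : J = ⊤
  · have h3 : maximalIdeal R = ⊥ := by rw [← hJ, hJt, Ideal.mul_top]
    have h4 : ρ₁ = ρ₂ := by
      refine MonoidHom.ext fun g => Units.ext (Matrix.ext fun i j => ?_)
      rw [← sub_eq_zero, ← Ideal.mem_bot, ← h3, R.mem_maximalIdeal_iff, map_sub, sub_eq_zero]
      exact congrFun (congrFun ((residue_val hρ₁.1 g).trans (residue_val h₂ g).symm) i) j
    rw [← h4]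
    refine iff_of_true ⟨0, Fin.elim0, Fin.elim0, fun j => j.elim0, fun j => j.elim0,
      fun g a b => ?_⟩ hρ₁
    rw [← Units.val_mul, mul_inv_cancel, Units.val_one, sub_self, Finset.univ_eq_empty,
      Finset.sum_empty]; rfl
  · have hJm := le_maximalIdeal hJt
    exact ⟨h.mem_of_differenceMem hJ hJm hρ₁ h₂,
      fun hρ₂ => h.differenceMem_of_mem hZ₀ hZ₀t hJ hJm hρ₁ hρ₂ heq⟩

end LiftData

end LocalDeformation

/-! ### Upper numbering, conductors and the trace-one matrix. -/

open ValuativeRel IsLocalRing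

namespace LocalDeformation

section Herbrand

variable (K : Type v) [Field K] [ValuativeRel K] [TopologicalSpace K]
  [IsNonarchimedeanLocalField K] (L : Type v) [Field L] [Algebra K L]
  [FiniteDimensional K L]

theorem antitone_card_lowerRamification : Antitone fun t : ℝ =>
    (Nat.card (lowerRamification K L ⌈t⌉₊) : ℝ) / (Nat.card (lowerRamification K L 0) : ℝ) := by
  intro a b hab
  refine div_le_div_of_nonneg_right ?_ (Nat.cast_nonneg _)
  exact_mod_cast Nat.card_mono (Set.toFinite _) (lowerRamification_anti K L (Nat.ceil_mono hab))

/-- The Herbrand function takes all positive values at positive numbers. -/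
theorem exists_herbrand_eq {w : ℝ} (hw : 0 < w) : ∃ u, 0 < u ∧ herbrand K L u = w := by
  have hint := fun a b => (antitone_card_lowerRamification K L).intervalIntegrable
    (μ := MeasureTheory.volume) (a := a) (b := b)
  have hcont : Continuous (herbrand K L) := intervalIntegral.continuous_primitive hint 0
  have h0 : herbrand K L 0 = 0 := intervalIntegral.integral_same
  let N : ℝ := Nat.card (lowerRamification K L 0)
  have hN : 0 < N := Nat.cast_pos.mpr Nat.card_pos
  have hb : 0 ≤ w * N := by positivity
  -- The integrand is at least `1 / #G_0`, so the value `w` is reached before `w * #G_0` by the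
  -- intermediate value theorem.
  have hlow : w ≤ herbrand K L (w * N) := by
    have h1 : ∫ _ in (0 : ℝ)..(w * N), 1 / N ≤ herbrand K L (w * N) := by
      refine intervalIntegral.integral_mono hb intervalIntegrable_const (hint _ _) fun t => ?_
      refine div_le_div_of_nonneg_right ?_ hN.le
      exact Nat.one_le_cast.mpr Nat.card_pos
    rw [intervalIntegral.integral_const, sub_zero, smul_eq_mul, mul_one_div,
      mul_div_cancel_right₀ _ hN.ne'] at h1
    exact h1
  obtain ⟨u, hu, huw⟩ := intermediate_value_Icc hb hcont.continuousOn ⟨h0.trans_le hw.le, hlow⟩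
  refine ⟨u, lt_of_le_of_ne hu.1 fun h => ?_, huw⟩
  rw [← h, h0] at huw
  exact hw.ne huw

/-- The upper numbering groups of positive index are contained in the wild inertia group. -/
theorem upperRamification_le_wildInertia {w : ℝ} (hw : 0 < w) :
    upperRamification K w ≤ wildInertia K := by
  refine iInf_mono fun L => Subgroup.comap_mono ?_
  -- A solution `u` guarantees that the infimum defining the upper numbering group is not the empty
  -- one. As `u > 0`, the index `⌈u⌉` is at least one.
  obtain ⟨u, hu, huw⟩ := exists_herbrand_eq K L hw
  exact ((iInf_le _ u).trans ((iInf_le _ hu.le).trans (iInf_le _ huw))).trans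
    (lowerRamification_anti K L (Nat.one_le_ceil_iff.mpr hu))

end Herbrand

namespace LiftData

variable {ℓ : ℕ} [Fact ℓ.Prime] {F : Type u} [Field F] [Finite F] [CharP F ℓ]
  {K : Type v} [Field K] [ValuativeRel K] [TopologicalSpace K] [IsNonarchimedeanLocalField K]
  {n : ℕ} {p : ℕ} [Fact p.Prime] {q : ℕ} {s t : AbsGal K} {ρbar : AbsGal K →* GL (Fin n) F}
  {T : Matrix (Fin n) (Fin n) (WittVector ℓ F)}

/-- The conductor is constant on `minimalLifts`. -/
theorem exists_conductor_eq (h : LiftData p (inertia K) (wildInertia K) q s t ρbar T) :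
    ∃ a : ENNReal, ∀ (R : CoeffRing ℓ F), ∀ ρ ∈ minimalLifts ρbar T t R,
      ConductorWellDefined ρ ∧ conductor ρ = a := by
  obtain ⟨r, hr⟩ := h.exists_rank_fixedVectors
  refine ⟨((n - r : ℕ) : ENNReal), fun R ρ hρ => ?_⟩
  obtain ⟨e⟩ := hr R ρ hρ
  have htop : ∀ w : ℝ, 0 < w → fixedVectors ρ (upperRamification K w) = ⊤ := fun w hw =>
    h.fixedVectors_eq_top hρ.1 (upperRamification_le_wildInertia K hw)
  refine ⟨⟨Module.Free.of_equiv e.symm, fun w hw => ?_⟩, ?_⟩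
  · rw [htop w hw]
    exact Module.Free.of_equiv Submodule.topEquiv.symm
  · have h1 : swanConductor ρ = 0 := by
      rw [swanConductor, MeasureTheory.setLIntegral_congr_fun measurableSet_Ioi
        (g := fun _ => 0) fun w hw => ?_, MeasureTheory.lintegral_zero]
      rw [fixedCorank, htop w hw, finrank_top, Module.finrank_fin_fun, Nat.sub_self, Nat.cast_zero]
    rw [conductor, h1, add_zero, fixedCorank, e.finrank_eq, Module.finrank_fin_fun]

end LiftData

/-- If the invariants of `ad⁰` are smaller than those of `ad`, there is an equivariant matrix of
trace one. -/
theorem exists_trace_eq_one {F : Type u} [Field F] {G : Type v} [Group G] {n : ℕ}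
    {ρbar : G →* GL (Fin n) F} (h : h0 (ad0Rep ρbar) < h0 (adRep ρbar)) :
    ∃ Z : Matrix (Fin n) (Fin n) F, Z.trace = 1 ∧ ∀ g, Z * (ρbar g).val = (ρbar g).val * Z := by
  -- Were all invariants of trace zero, those of `ad` would embed into those of `ad⁰`, against the
  -- inequality of dimensions.
  obtain ⟨X, hX, hX0⟩ : ∃ X ∈ (adRep ρbar).invariants, X.trace ≠ 0 := by
    by_contra hne
    push Not at hne
    let f : (adRep ρbar).invariants →ₗ[F] (ad0Rep ρbar).invariants :=
      { toFun := fun X => ⟨⟨X.1, hne X.1 X.2⟩, fun g => Subtype.ext (X.2 g)⟩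
        map_add' := fun _ _ => rfl
        map_smul' := fun _ _ => rfl }
    have hf : Function.Injective f := fun X Y hXY =>
      Subtype.ext (congrArg (fun Z => Z.1.1) hXY)
    exact absurd (LinearMap.finrank_le_finrank_of_injective hf) (not_le.mpr h)
  refine ⟨X.trace⁻¹ • X, ?_, fun g => ?_⟩
  · rw [Matrix.trace_smul, smul_eq_mul, inv_mul_cancel₀ hX0]
  · have h1 : (ρbar g).val * X * (ρbar g)⁻¹.val = X := hX g
    have h2 : X * (ρbar g).val = (ρbar g).val * X := by
      conv_lhs => rw [← h1, mul_assoc, ← Units.val_mul, inv_mul_cancel, Units.val_one, mul_one]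
    rw [smul_mul_assoc, h2, mul_smul_comm]

end LocalDeformation

/-! ### Assembly of the proposition. -/

theorem mainTheorem7
    (p ℓ : ℕ) [Fact p.Prime] [Fact ℓ.Prime] (hpℓ : ℓ ≠ p)
    -- a nonarchimedean local field of characteristic `p`
    (K : Type v) [Field K] [ValuativeRel K] [TopologicalSpace K]
    [IsNonarchimedeanLocalField K] [CharP K p]
    -- a finite field of characteristic `ℓ`
    (F : Type u) [Field F] [Finite F] [CharP F ℓ]
    (n : ℕ) (ρbar : LocalDeformation.AbsGal K →* Matrix.GeneralLinearGroup (Fin n) F)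
    (hcont : LocalDeformation.IsContinuousRep ρbar)
    (htame : ∀ σ ∈ LocalDeformation.wildInertia K, ρbar σ = 1)
    (hlt : LocalDeformation.h0 (LocalDeformation.ad0Rep ρbar) <
      LocalDeformation.h0 (LocalDeformation.adRep ρbar)) :
    ∃ (C : (R : LocalDeformation.CoeffRing ℓ F) →
        Set (LocalDeformation.AbsGal K →* Matrix.GeneralLinearGroup (Fin n) R))
      (L : Submodule F (LocalDeformation.H1 (LocalDeformation.ad0Rep ρbar))),
      LocalDeformation.IsAdmissible ρbar (LocalDeformation.teichmullerDet ℓ ρbar) C L ∧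
      L = LocalDeformation.H1unr (LocalDeformation.ad0Rep ρbar) (LocalDeformation.inertia K) ∧
      Module.Finite F L ∧
      Module.finrank F L = LocalDeformation.h0 (LocalDeformation.ad0Rep ρbar) ∧
      LocalDeformation.ConductorWellDefined ρbar ∧
      ∀ (R : LocalDeformation.CoeffRing ℓ F), ∀ ρ ∈ C R,
        LocalDeformation.ConductorWellDefined ρ ∧
        LocalDeformation.conductor ρ = LocalDeformation.conductor ρbar := by
  obtain ⟨q, s, t, ⟨f, -, hq⟩, gen⟩ := LocalDeformation.exists_tameGenerators.{v, u} K p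
  obtain ⟨j, hj, hj1⟩ := gen.exists_pow_mem _ hcont.isOpen_ker htame
  have hj0 : 0 < j := Nat.pos_of_ne_zero fun h0 => hj (h0 ▸ dvd_zero p)
  have htj : (ρbar t).val ^ j = 1 := by
    rw [MonoidHom.mem_ker, map_pow] at hj1
    rw [← Units.val_pow_eq_pow_val, hj1, Units.val_one]
  obtain ⟨T, hT, hsyl, hfix, hdet⟩ :=
    LocalDeformation.exists_matrix_lift (ℓ := ℓ) (ρbar t).val hj0 htj
  have hℓ : ℓ.Prime := Fact.out
  -- As `q` is a power of `p ≠ ℓ`, the lifting property of `T` applies to the Frobenius equation `Y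
  -- T = T ^ q Y`.
  have hℓq : ¬ ℓ ∣ q := fun h => hpℓ
    ((Nat.prime_dvd_prime_iff_eq hℓ Fact.out).mp (hℓ.dvd_of_dvd_pow (hq ▸ h)))
  have h : LocalDeformation.LiftData p (LocalDeformation.inertia K)
      (LocalDeformation.wildInertia K) q s t ρbar T :=
    ⟨gen, hpℓ, hcont, htame, hT, hsyl 1 hℓ.not_dvd_one, hsyl q hℓq, hfix, hdet⟩
  obtain ⟨Z, hZ, hZρ⟩ := LocalDeformation.exists_trace_eq_one hlt
  obtain ⟨a, ha⟩ := h.exists_conductor_eq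
  obtain ⟨hfin, hrank⟩ := h.finrank_H1unr
  -- `ρbar` itself is a member of the family, so the common conductor is its own.
  have hbar := ha _ _ h.minimalLifts_P1
  refine ⟨LocalDeformation.minimalLifts ρbar T t,
    LocalDeformation.H1unr (LocalDeformation.ad0Rep ρbar) (LocalDeformation.inertia K),
    { isLift := fun R ρ hρ => hρ.1
      P1 := h.minimalLifts_P1
      P2 := fun R ρ hρ M hM => LocalDeformation.LiftData.minimalLifts_P2 R hρ hM
      P3 := fun R S f ρ hρ => LocalDeformation.LiftData.minimalLifts_P3 R S f hρ
      P4 := fun R₁ R₂ R₃ I₁ I₂ φ π₁ π₂ _ _ hinj hrange ρ₁ hρ₁ ρ₂ hρ₂ heq ρ₃ h31 h32 =>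
        h.minimalLifts_P4 R₁ R₂ R₃ I₁ I₂ φ π₁ π₂ hinj hrange hρ₁ hρ₂ heq ρ₃ h31 h32
      P5 := fun R ρ hρ hk => LocalDeformation.LiftData.minimalLifts_P5 R hρ hk
      P6 := fun R I hI hmI ρ hρ => h.exists_lift_mem_minimalLifts hZ (hZρ t) (R.mkHom I hI)
        Ideal.Quotient.mk_surjective (fun x hx y hy => by
          rw [← Ideal.mem_bot, ← hmI]
          exact Ideal.mul_mem_mul hx (Ideal.Quotient.eq_zero_iff_mem.mp hy)) hρ
      P7 := fun R I hI ρ₁ hρ₁ ρ₂ hρ₂ heq => h.minimalLifts_P7 hZ (hZρ t) hI hρ₁ hρ₂ heq },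
    rfl, hfin, hrank, hbar.1, fun R ρ hρ => ⟨(ha R ρ hρ).1, (ha R ρ hρ).2.trans hbar.2.symm⟩⟩
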